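/- Conventions: locally convex spaces are real and Hausdorff; a map $f:S\to Y$ on a subset $S$ with dense interior of a locally convex space $X$ is $C^1$ if it is continuous, its directional derivatives exist on $\operatorname{int}(S)$ and extend to a continuous map $df:S\times X\to Y$; it is $C^k$ if moreover $df$ is $C^{k-1}$, and smooth if it is $C^k$ for all $k$. Manifolds (with corners) and Lie groups are understood in this sense. The space $C^\infty(N,N')$ carries the $C^\infty$-topology, i.e. the initial topology with respect to $f\mapsto (T^kf)_{k\ge 0}\in\prod_{k}C(T^kN,T^kN')$, each factor carrying the compact-open topology; subspaces and products carry the induced topologies. Proposition. Let $K$ be a Lie group modelled on a locally convex space, with Lie algebra $\mathfrak k=T_1K$ (bracket of left invariant vector fields), let $M$ be a finite-dimensional (Hausdorff) manifold with corners, modelled on $[0,\infty)^n$, and let $\pi:P\to M$ be a smooth principal $K$-bundle. Let $\overline{\mathcal V}=(\overline V_i,\sigma_i)_{i\in I}$ be a smooth closed trivialising system: $(V_i)_{i\in I}$ is an open cover of $M$, each closure $\overline V_i$ is a manifold with corners (the inclusion $\overline V_i\to M$ is smooth, and $\overline V_i$ and $M$ induce the same smooth structure on $V_i$), and $\sigma_i:\overline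 V_i\to P$ are smooth sections; define $k_{ij}:\overline V_i\cap\overline V_j\to K$ by $\sigma_i(m)\cdot k_{ij}(m)=\sigma_j(m)$. Put $$C^\infty(P,\mathfrak k)^K=\{\eta\in C^\infty(P,\mathfrak k):\eta(p\cdot k)=\operatorname{Ad}(k^{-1}).\eta(p)\ \text{for all } p\in P,\ k\in K\},$$ $$\mathfrak g_{\overline{\mathcal V}}(P)=\Big\{(\eta_i)\in\prod_{i\in I} C^\infty(\overline V_i,\mathfrak k):\eta_i(m)=\operatorname{Ad}(k_{ij}(m)).\eta_j(m)\ \text{for all } m\in\overline V_i\cap\overline V_j\Big\},$$ $$\mathfrak g_{\mathcal V}(P)=\Big\{(\eta_i)\in\prod_{i\in I} C^\infty(V_i,\mathfrak k):\eta_i(m)=\operatorname{Ad}(k_{ij}(m)).\eta_j(m)\ \text{for all } m\in V_i\cap V_j\Big\},$$ and let $S(\operatorname{Ad}(P))\subseteq C^\infty(M,\operatorname{Ad}(P))$ be the space of smooth sections of the adjoint bundle $\operatorname{Ad}(P)=P\times_K\mathfrak k$, the quotient of $P\times\mathfrak k$ by $(p,x)\cdot k=(p\cdot k,\operatorname{Ad}(k^{-1}).x)$.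 Then, with the pointwise (for $S(\operatorname{Ad}(P))$: fibrewise) vector space operations and Lie bracket, each of these four spaces is a (Hausdorff) locally convex Lie algebra, i.e. a Lie algebra whose topology is a locally convex vector space topology and whose bracket is continuous, and there are isomorphisms of topological Lie algebras $$C^\infty(P,\mathfrak k)^K\cong S(\operatorname{Ad}(P))\cong\mathfrak g_{\mathcal V}(P)\cong\mathfrak g_{\overline{\mathcal V}}(P).$$ More precisely, $\eta\mapsto(\pi(p)\mapsto[p,\eta(p)])$, $\eta\mapsto(\eta\circ\sigma_i|_{V_i})_{i\in I}$ and $\eta\mapsto(\eta\circ\sigma_i)_{i\in I}$ are isomorphisms of topological Lie algebras from $C^\infty(P,\mathfrak k)^K$ onto $S(\operatorname{Ad}(P))$, $\mathfrak g_{\mathcal V}(P)$ and $\mathfrak g_{\overline{\mathcal V}}(P)$. -/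

import Mathlib

open Set Filter
open scoped Topology RightActions

universe u v w z

namespace LCGeom

noncomputable section

/-! ### Differential calculus on locally convex spaces (domains with dense interior) -/

section Calculus

/-- The directional derivative `lim_{h → 0} (f (x + h v) - f x) / h` at `p = (x, v)`. -/
def dirDeriv {X : Type u} {Y : Type v} [AddCommGroup X] [Module ℝ X]
    [AddCommGroup Y] [Module ℝ Y] [TopologicalSpace Y] (f : X → Y) (p : X × X) : Y :=
  limUnder (𝓝[≠] (0 : ℝ)) fun h : ℝ => h⁻¹ • (f (p.1 + h • p.2) - f p.1)

/-- The differential `df : S × X → Y` of a `C¹` map on a set `S` with dense interior: the extension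
by continuity of the directional derivative from `interior S × X`. -/
def differential {X : Type u} {Y : Type v} [AddCommGroup X] [Module ℝ X] [TopologicalSpace X]
    [AddCommGroup Y] [Module ℝ Y] [TopologicalSpace Y] (S : Set X) (f : X → Y) : X × X → Y :=
  extendFrom (interior S ×ˢ (univ : Set X)) (dirDeriv f)

/-- `f` is `C^k` on the set `S` (which has dense interior in all uses): `f` is continuous on `S`,
and, for `k > 0`, the directional derivatives exist in the interior of `S` and extend to a
continuous map `df` on `S × X` which is `C^(k-1)`. -/
def IsCk : ℕ → ∀ {X : Type u} {Y : Type v} [AddCommGroup X] [Module ℝ X] [TopologicalSpace X]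
    [AddCommGroup Y] [Module ℝ Y] [TopologicalSpace Y], Set X → (X → Y) → Prop
  | 0, _, _, _, _, _, _, _, _, S, f => ContinuousOn f S
  | k + 1, X, Y, _, _, _, _, _, _, S, f =>
      ContinuousOn f S ∧ ∃ df : X × X → Y,
        (∀ x ∈ interior S, ∀ v : X,
          Tendsto (fun h : ℝ => h⁻¹ • (f (x + h • v) - f x)) (𝓝[≠] 0) (𝓝 (df (x, v)))) ∧
        ContinuousOn df (S ×ˢ (univ : Set X)) ∧
        IsCk k (S ×ˢ (univ : Set X)) df

/-- `f` is smooth (`C^∞`) on `S`. -/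
def IsSmoothOn {X : Type u} {Y : Type v} [AddCommGroup X] [Module ℝ X] [TopologicalSpace X]
    [AddCommGroup Y] [Module ℝ Y] [TopologicalSpace Y] (S : Set X) (f : X → Y) : Prop :=
  ∀ k : ℕ, IsCk k S f

end Calculus

/-! ### Charts, atlases, smooth maps, tangent bundles -/

/-- A chart of `M` with values in `X`; only the values of `toFun` on `source` matter. -/
structure LCChart (X : Type v) (M : Type u) where
  source : Set M
  toFun : M → X

instance (X : Type v) (M : Type u) [Zero X] : Nonempty (LCChart X M) := ⟨⟨∅, fun _ => 0⟩⟩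

/-- A topology together with a collection of charts and a preferred chart at each point. -/
structure LCAtlas (X : Type v) (M : Type u) where
  top : TopologicalSpace M
  atlas : Set (LCChart X M)
  chartAt : M → LCChart X M

section Manifolds

variable {X : Type v} {M : Type u} [AddCommGroup X] [Module ℝ X] [TopologicalSpace X]
  {Y : Type w} {N : Type z} [AddCommGroup Y] [Module ℝ Y] [TopologicalSpace Y]

open Classical in
/-- The coordinate representation `c' ∘ f ∘ c⁻¹` of `f` in the charts `c` and `c'`
(with value `0` outside the image of `c`). -/
def rep (c : LCChart X M) (c' : LCChart Y N) (f : M → N) (y : X) : Y :=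
  if h : ∃ x, x ∈ c.source ∧ c.toFun x = y then c'.toFun (f h.choose) else 0

/-- The derivative of `f` at `x`, in the charts `c` around `x` and `c'` around `f x`,
applied to the coordinate vector `v`. -/
def chartDeriv (c : LCChart X M) (c' : LCChart Y N) (f : M → N) (x : M) (v : X) : Y :=
  differential (c.toFun '' (c.source ∩ f ⁻¹' c'.source)) (rep c c' f) (c.toFun x, v)

/-- `f` is smooth on the open set `U`: it is continuous there and its representations in all
charts of the atlases are smooth. -/
def MSmoothOn (A : LCAtlas X M) (B : LCAtlas Y N) (f : M → N) (U : Set M) : Prop :=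
  @ContinuousOn M N A.top B.top f U ∧
    ∀ c ∈ A.atlas, ∀ c' ∈ B.atlas,
      IsSmoothOn (c.toFun '' (c.source ∩ U ∩ f ⁻¹' c'.source)) (rep c c' f)

/-- `f` is a smooth map between manifolds. -/
def MSmooth (A : LCAtlas X M) (B : LCAtlas Y N) (f : M → N) : Prop :=
  MSmoothOn A B f univ

/-- All changes of charts are smooth. -/
def SmoothAtlas (A : LCAtlas X M) : Prop :=
  ∀ c ∈ A.atlas, ∀ c' ∈ A.atlas,
    IsSmoothOn (c.toFun '' (c.source ∩ c'.source)) (rep c c' (id : M → M))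

/-- The atlas of a charted space modelled on `H`, where `H` is seen in the vector space `X`
through `ι`. -/
def ofCharted {H : Type*} [TopologicalSpace H] (ι : H → X) (M : Type u) [TopologicalSpace M]
    [ChartedSpace H M] : LCAtlas X M where
  top := inferInstance
  atlas := (fun e : OpenPartialHomeomorph M H => (⟨e.source, fun x => ι (e x)⟩ : LCChart X M)) ''
    (atlas H M)
  chartAt x := ⟨(chartAt H x).source, fun y => ι (chartAt H x y)⟩

/-- A locally convex space as a manifold, with the identity as its only chart. -/
def selfAtlas (X : Type v) [TopologicalSpace X] : LCAtlas X X where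
  top := inferInstance
  atlas := {⟨univ, id⟩}
  chartAt _ := ⟨univ, id⟩

/-- The product of two manifolds. -/
def LCAtlas.prod (A : LCAtlas X M) (B : LCAtlas Y N) : LCAtlas (X × Y) (M × N) where
  top := @instTopologicalSpaceProd M N A.top B.top
  atlas := {c | ∃ a ∈ A.atlas, ∃ b ∈ B.atlas, c = ⟨a.source ×ˢ b.source, Prod.map a.toFun b.toFun⟩}
  chartAt p := ⟨(A.chartAt p.1).source ×ˢ (B.chartAt p.2).source,
    Prod.map (A.chartAt p.1).toFun (B.chartAt p.2).toFun⟩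

/-- The induced structure on an (open) subset. -/
def LCAtlas.restrict (A : LCAtlas X M) (U : Set M) : LCAtlas X U where
  top := TopologicalSpace.induced Subtype.val A.top
  atlas := (fun c : LCChart X M => (⟨Subtype.val ⁻¹' c.source, fun x => c.toFun x⟩ : LCChart X U)) ''
    A.atlas
  chartAt x := ⟨Subtype.val ⁻¹' (A.chartAt x).source, fun y => (A.chartAt x).toFun y⟩

/-- The tangent map `Tf : TM → TN`. A tangent vector at `x` is represented by its coordinates in
the preferred chart at `x`, so that `TM` is `M × X` as a set. -/
def tangentMap (A : LCAtlas X M) (B : LCAtlas Y N) (f : M → N) (p : M × X) : N × Y :=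
  (f p.1, chartDeriv (A.chartAt p.1) (B.chartAt (f p.1)) f p.1 p.2)

/-- The chart `Tc` of `TM` belonging to a chart `c` of `M`. -/
def tangentChart (A : LCAtlas X M) (c : LCChart X M) : LCChart (X × X) (M × X) where
  source := {p | p.1 ∈ c.source}
  toFun p := (c.toFun p.1, chartDeriv (A.chartAt p.1) c (id : M → M) p.1 p.2)

/-- The tangent bundle `TM`: its charts are the `Tc`, which also define its topology. -/
def LCAtlas.tangent (A : LCAtlas X M) : LCAtlas (X × X) (M × X) where
  top := TopologicalSpace.generateFrom
    {W | ∃ c ∈ A.atlas, ∃ O : Set (X × X), IsOpen O ∧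
      W = (tangentChart A c).source ∩ (tangentChart A c).toFun ⁻¹' O}
  atlas := tangentChart A '' A.atlas
  chartAt p := tangentChart A (A.chartAt p.1)

end Manifolds

/-! ### The `C^∞`-topology -/

/-- The compact-open topology, generated by the sets `⌊C, W⌋ = {f | f(C) ⊆ W}`. -/
@[reducible]
def compactOpenTop {M : Type u} {N : Type v} (s : TopologicalSpace M) (t : TopologicalSpace N) :
    TopologicalSpace (M → N) :=
  TopologicalSpace.generateFrom
    {S | ∃ (C : Set M) (W : Set N), @IsCompact M s C ∧ IsOpen[t] W ∧ S = {f | MapsTo f C W}}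

/-- The initial topology with respect to `f ↦ T^k f`, where the space of maps from `T^k M` to
`T^k N` carries the compact-open topology. -/
@[reducible]
def jetTop : ℕ → ∀ {X : Type v} {M : Type (max u v)} {Y : Type w} {N : Type (max z w)}
    [AddCommGroup X] [Module ℝ X] [TopologicalSpace X]
    [AddCommGroup Y] [Module ℝ Y] [TopologicalSpace Y],
    LCAtlas X M → LCAtlas Y N → TopologicalSpace (M → N)
  | 0, _, _, _, _, _, _, _, _, _, _, A, B => compactOpenTop A.top B.top
  | k + 1, _, _, _, _, _, _, _, _, _, _, A, B =>
      TopologicalSpace.induced (tangentMap A B) (jetTop k A.tangent B.tangent)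

/-- The space `C^∞(M, N)` of smooth maps. -/
def SmoothMap {X : Type v} {M : Type (max u v)} {Y : Type w} {N : Type (max z w)}
    [AddCommGroup X] [Module ℝ X] [TopologicalSpace X]
    [AddCommGroup Y] [Module ℝ Y] [TopologicalSpace Y]
    (A : LCAtlas X M) (B : LCAtlas Y N) : Type (max u v z w) :=
  {f : M → N // MSmooth A B f}

/-- The `C^∞`-topology on `C^∞(M, N)`: the initial topology with respect to the inclusion
`f ↦ (T^k f)_k` into the product of the spaces `C(T^k M, T^k N)` with the compact-open topology. -/
instance smoothTop {X : Type v} {M : Type (max u v)} {Y : Type w} {N : Type (max z w)}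
    [AddCommGroup X] [Module ℝ X] [TopologicalSpace X]
    [AddCommGroup Y] [Module ℝ Y] [TopologicalSpace Y]
    (A : LCAtlas X M) (B : LCAtlas Y N) : TopologicalSpace (SmoothMap.{u, v, w, z} A B) :=
  TopologicalSpace.induced Subtype.val (⨅ k : ℕ, jetTop.{u, v, w, z} k A B)

/-! ### Lie groups modelled on locally convex spaces -/

section LieGroups

variable (E : Type u) [AddCommGroup E] [Module ℝ E] [TopologicalSpace E]
  (K : Type u) [Group K] [TopologicalSpace K] [ChartedSpace E K]

/-- The manifold structure of a group modelled on `E`. -/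
def groupAtlas : LCAtlas E K := ofCharted (id : E → E) K

/-- `K` is a Lie group modelled on `E`. -/
structure IsLCLieGroup : Prop where
  smoothAtlas : SmoothAtlas (groupAtlas E K)
  smooth_mul : MSmooth ((groupAtlas E K).prod (groupAtlas E K)) (groupAtlas E K)
    (fun p : K × K => p.1 * p.2)
  smooth_inv : MSmooth (groupAtlas E K) (groupAtlas E K) (fun k : K => k⁻¹)

variable {E}

/-- The adjoint action on the Lie algebra `T_1 K`, which is `E` through the preferred chart at `1`:
`Ad k` is the derivative of `g ↦ k g k⁻¹` at `1`. -/
def Ad (k : K) (x : E) : E :=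
  (tangentMap (groupAtlas E K) (groupAtlas E K) (fun g : K => k * g * k⁻¹) (1, x)).2

/-- The left invariant vector field with value `x` at `1`, in the preferred chart at `1`. -/
def leftField (x : E) (g : K) : E :=
  chartDeriv ((groupAtlas E K).chartAt 1) ((groupAtlas E K).chartAt 1) (fun h : K => g * h) 1 x

/-- The Lie bracket of `T_1 K`: the value at `1` of the bracket of the left invariant vector
fields, `[x, y] = d(y_l)(1).x - d(x_l)(1).y` in the preferred chart at `1`. -/
def lieBr (x y : E) : E :=
  chartDeriv ((groupAtlas E K).chartAt 1) ⟨univ, id⟩ (leftField K y) 1 x -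
    chartDeriv ((groupAtlas E K).chartAt 1) ⟨univ, id⟩ (leftField K x) 1 y

end LieGroups

/-! ### Principal bundles over finite-dimensional manifolds with corners -/

section Bundles

/-- The structure of an `n`-dimensional manifold with corners, modelled on `[0, ∞)^n`. -/
def cornerAtlas (n : ℕ) (M : Type u) [TopologicalSpace M] [ChartedSpace (EuclideanQuadrant n) M] :
    LCAtlas (EuclideanSpace ℝ (Fin n)) M :=
  ofCharted (fun x : EuclideanQuadrant n => x.1) M

variable (n : ℕ) (E : Type u) [AddCommGroup E] [Module ℝ E] [TopologicalSpace E]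
  (K : Type u) [Group K] [TopologicalSpace K] [ChartedSpace E K]
  {M : Type u} [TopologicalSpace M] [ChartedSpace (EuclideanQuadrant n) M]
  {P : Type u} [TopologicalSpace P] [ChartedSpace (EuclideanQuadrant n × E) P]
  [MulAction Kᵐᵒᵖ P]

/-- The structure of a manifold with corners modelled on `[0, ∞)^n × E`. -/
def totalAtlas (P : Type u) [TopologicalSpace P] [ChartedSpace (EuclideanQuadrant n × E) P] :
    LCAtlas (EuclideanSpace ℝ (Fin n) × E) P :=
  ofCharted (fun x : EuclideanQuadrant n × E => (x.1.1, x.2)) P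

/-- `π : P → M` is a smooth principal `K`-bundle; `p <• k` is the right action of `k` on `p`. -/
structure IsSmoothPrincipalBundle (π : P → M) : Prop where
  smoothAtlas : SmoothAtlas (totalAtlas n E P)
  smooth_proj : MSmooth (totalAtlas n E P) (cornerAtlas n M) π
  smooth_action : MSmooth ((totalAtlas n E P).prod (groupAtlas E K)) (totalAtlas n E P)
    (fun q : P × K => q.1 <• q.2)
  proj_action : ∀ (p : P) (k : K), π (p <• k) = π p
  locally_trivial : ∀ m : M, ∃ e : Bundle.Trivialization K π, m ∈ e.baseSet ∧
    MSmoothOn (totalAtlas n E P) ((cornerAtlas n M).prod (groupAtlas E K)) e e.source ∧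
    MSmoothOn ((cornerAtlas n M).prod (groupAtlas E K)) (totalAtlas n E P)
      e.toOpenPartialHomeomorph.symm e.target ∧
    ∀ p ∈ e.source, ∀ k : K, e (p <• k) = ((e p).1, (e p).2 * k)

/-- The gauge algebra `C^∞(P, 𝔨)^K`: smooth maps with `η (p k) = Ad(k⁻¹) η(p)`,
with the subspace topology of `C^∞(P, 𝔨)`. -/
def gaugeAlgebra (P : Type u) [TopologicalSpace P] [ChartedSpace (EuclideanQuadrant n × E) P]
    [MulAction Kᵐᵒᵖ P] : Set (SmoothMap.{u, u, u, u} (totalAtlas n E P) (selfAtlas E)) :=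
  {η | ∀ (p : P) (k : K), η.1 (p <• k) = Ad K k⁻¹ (η.1 p)}

/-- The total space of the adjoint bundle `Ad(P) = P ×_K 𝔨`: the quotient of `P × 𝔨` by the action
`(p, x) k = (p k, Ad(k⁻¹) x)`. -/
def AdBundle (P : Type u) [MulAction Kᵐᵒᵖ P] : Type u :=
  Quot fun a b : P × E => ∃ k : K, b = (a.1 <• k, Ad K k⁻¹ a.2)

variable {E}

/-- The class `[p, x]` in `Ad(P)`. -/
def AdBundle.mk (p : P) (x : E) : AdBundle E K P := Quot.mk _ (p, x)

variable (E)

/-- `a` is the bundle chart `[σ(m), x] ↦ (c(m), x)` of `Ad(P)` belonging to a smooth local section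
`σ : U → P` and a chart `c` of `M`. -/
def IsAdChart (π : P → M) (a : LCChart (EuclideanSpace ℝ (Fin n) × E) (AdBundle E K P)) : Prop :=
  ∃ (U : Set M) (σ : M → P), ∃ c ∈ (cornerAtlas n M).atlas,
    IsOpen U ∧ MSmoothOn (cornerAtlas n M) (totalAtlas n E P) σ U ∧ (∀ m ∈ U, π (σ m) = m) ∧
    a.source = {z | ∃ m ∈ U ∩ c.source, ∃ x : E, z = AdBundle.mk K (σ m) x} ∧
    ∀ m ∈ U ∩ c.source, ∀ x : E, a.toFun (AdBundle.mk K (σ m) x) = (c.toFun m, x)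

/-- The smooth structure of `Ad(P)`: the quotient topology and the bundle charts. -/
def adAtlas (π : P → M) : LCAtlas (EuclideanSpace ℝ (Fin n) × E) (AdBundle E K P) where
  top := instTopologicalSpaceQuot
  atlas := {a | IsAdChart n E K π a}
  chartAt z := Classical.epsilon fun a => IsAdChart n E K π a ∧ z ∈ a.source

/-- The space `S(Ad(P))` of smooth sections, with the subspace topology of `C^∞(M, Ad(P))`. -/
def adSections (π : P → M) : Set (SmoothMap.{u, 0, u, u} (cornerAtlas n M) (adAtlas n E K π)) :=
  {ξ | ∀ m : M, ∃ (p : P) (x : E), π p = m ∧ ξ.1 m = AdBundle.mk K p x}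

/-- A smooth closed trivialising system: an open cover `V` of `M`, structures of manifolds with
corners on the closures, for which the inclusions into `M` are smooth and which induce on the open
sets `V i` the same smooth structure as `M`, and smooth sections on the closures. -/
structure ClosedTrivSystem (π : P → M) (I : Type w) where
  V : I → Set M
  isOpen_V : ∀ i, IsOpen (V i)
  cover : ⋃ i, V i = univ
  charts : ∀ i, ChartedSpace (EuclideanQuadrant n) (closure (V i))
  smoothAtlas : ∀ i, SmoothAtlas (cornerAtlas n (closure (V i)))
  smooth_incl : ∀ i, MSmooth (cornerAtlas n (closure (V i))) (cornerAtlas n M) Subtype.val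
  smooth_incl_open : ∀ i, MSmooth ((cornerAtlas n M).restrict (V i))
    (cornerAtlas n (closure (V i))) (Set.inclusion subset_closure)
  σ : ∀ i, closure (V i) → P
  smooth_σ : ∀ i, MSmooth (cornerAtlas n (closure (V i))) (totalAtlas n E P) (σ i)
  proj_σ : ∀ i m, π (σ i m) = m

attribute [instance] ClosedTrivSystem.charts

variable {n E} {π : P → M} {I : Type w}

/-- The space of families `η_i ∈ C^∞(V̄_i, 𝔨)` with `η_i(m) = Ad(k_ij(m)) η_j(m)` on `V̄_i ∩ V̄_j`,
where `k = k_ij(m)` is given by `σ_i(m) k = σ_j(m)`; topologised in the product. -/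
def closedFamilies (𝒱 : ClosedTrivSystem n E π I) :
    Set (∀ i, SmoothMap.{u, 0, u, u} (cornerAtlas n (closure (𝒱.V i))) (selfAtlas E)) :=
  {η | ∀ (i j : I) (m : M) (hi : m ∈ closure (𝒱.V i)) (hj : m ∈ closure (𝒱.V j)) (k : K),
    𝒱.σ i ⟨m, hi⟩ <• k = 𝒱.σ j ⟨m, hj⟩ → (η i).1 ⟨m, hi⟩ = Ad K k ((η j).1 ⟨m, hj⟩)}

/-- The same for the underlying open trivialising system: families `η_i ∈ C^∞(V_i, 𝔨)` with
`η_i(m) = Ad(k_ij(m)) η_j(m)` on `V_i ∩ V_j`. -/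
def openFamilies (𝒱 : ClosedTrivSystem n E π I) :
    Set (∀ i, SmoothMap.{u, 0, u, u} ((cornerAtlas n M).restrict (𝒱.V i)) (selfAtlas E)) :=
  {η | ∀ (i j : I) (m : M) (hi : m ∈ 𝒱.V i) (hj : m ∈ 𝒱.V j) (k : K),
    𝒱.σ i ⟨m, subset_closure hi⟩ <• k = 𝒱.σ j ⟨m, subset_closure hj⟩ →
      (η i).1 ⟨m, hi⟩ = Ad K k ((η j).1 ⟨m, hj⟩)}

end Bundles

/-! ### Locally convex Lie algebras -/

/-- A (Hausdorff) locally convex Lie algebra: the topology is a locally convex vector space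
topology and the bracket is (jointly) continuous. -/
structure IsLCLieAlgebra (L : Type*) [TopologicalSpace L] [LieRing L] [LieAlgebra ℝ L] : Prop where
  topologicalAddGroup : IsTopologicalAddGroup L
  continuousSMul : ContinuousSMul ℝ L
  locallyConvex : LocallyConvexSpace ℝ L
  t2 : T2Space L
  continuous_bracket : Continuous fun p : L × L => ⁅p.1, p.2⁆

/-- The Lie algebra operations of `L` are the pointwise ones, where `ev a j` is the value of the
`E`-valued function `a` at `j`, and `br` is the bracket of `E`. -/
structure PointwiseLie {L J E : Type*} [LieRing L] [LieAlgebra ℝ L] [AddCommGroup E] [Module ℝ E]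
    (br : E → E → E) (ev : L → J → E) : Prop where
  add : ∀ a b j, ev (a + b) j = ev a j + ev b j
  smul : ∀ (r : ℝ) a j, ev (r • a) j = r • ev a j
  lie : ∀ a b j, ev ⁅a, b⁆ j = br (ev a j) (ev b j)

/-- The Lie algebra operations on a space `L` of sections of `Ad(P)` are the fibrewise ones:
`[p, x] + [p, y] = [p, x + y]`, `r [p, x] = [p, r x]`, `⁅[p, x], [p, y]⁆ = [p, [x, y]]`. -/
structure FibrewiseLie {L E M P : Type*} [LieRing L] [LieAlgebra ℝ L]
    [AddCommGroup E] [Module ℝ E] {F : Type*} (mk : P → E → F) (π : P → M)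
    (br : E → E → E) (ev : L → M → F) : Prop where
  add : ∀ a b p x y, ev a (π p) = mk p x → ev b (π p) = mk p y →
    ev (a + b) (π p) = mk p (x + y)
  smul : ∀ (r : ℝ) a p x, ev a (π p) = mk p x → ev (r • a) (π p) = mk p (r • x)
  lie : ∀ a b p x y, ev a (π p) = mk p x → ev b (π p) = mk p y →
    ev ⁅a, b⁆ (π p) = mk p (br x y)

end

end LCGeom

open LCGeom

set_option linter.unusedSectionVars false

namespace LCGeom

/-! All four spaces encode the same datum: an equivariant function on `P`, recorded by its values
along local sections. If `s` is a smooth section over `U` and δ(p, q) denotes the group element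
carrying p to q in a fibre, then an equivariant η satisfies η(p) = Ad(δ(s(π p), p)⁻¹) η(s(π p)) over
`U`. A family of functions on the base that transforms by Ad of the transition elements therefore
glues to a unique η. A section of Ad(P) becomes such a family through its coordinates with respect
to local sections. For a closed system the inverse passes through the open one: restrict to the sets
V_i, glue, and evaluate along the σ_i; this returns the original family because V_i is dense in its
closure and E is Hausdorff.

Every map involved is built from composition with a fixed smooth map, pairing, and restriction to an
open cover. These operations are continuous for the C^∞-topology because T^k is functorial and
commutes with products up to a smooth rearrangement, because continuous images of compact sets are
compact, and because a compact subset of a Hausdorff space covered by open sets is a finite union of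
compact pieces subordinate to the cover. `JetCont` states this continuity for families of maps over
a parameter space and on a subset of the source, so that it can be localised; `exists_glue` combines
its rules and yields every nontrivial inverse, together with its continuity.

The Lie algebra structure is built only on the gauge algebra and is transported along the
homeomorphisms. Its topology is locally convex, being initial with respect to linear maps into
spaces with the compact-open topology. For the bracket one needs that the bracket of T_1 K is
continuous and bilinear, satisfies the Jacobi identity and is preserved by Ad. In the chart at 1 it
is the antisymmetrised mixed second derivative b(x, y) of the multiplication. Differentiating the
statement that conjugation permutes the left invariant fields gives `Ad_lieBr`; differentiating (k g
k⁻¹) k = k g gives that the derivative of k ↦ Ad(k) x at 1 is z ↦ [z, x]; differentiating Ad(k)[x,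
y] = [Ad(k) x, Ad(k) y] then gives Jacobi.

All of this rests on a calculus valid on sets with boundary. Its core is `HasDiff.strict`:
difference quotients converge jointly in base point, direction and step size, also at boundary
points. The proof combines a mean value theorem obtained from Hahn–Banach with an approximation from
the interior. -/

/-- Hausdorff locally convex spaces. -/
class LCS (X : Type*) [AddCommGroup X] [Module ℝ X] [TopologicalSpace X] : Prop
    extends IsTopologicalAddGroup X, ContinuousSMul ℝ X, LocallyConvexSpace ℝ X, T2Space X

/-! ### First derivatives on sets with boundary: mean value theorem, chain rule, linearity -/

section Calculus

variable {X : Type u} {Y : Type v} {Z : Type w}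
  [AddCommGroup X] [Module ℝ X] [TopologicalSpace X]
  [AddCommGroup Y] [Module ℝ Y] [TopologicalSpace Y]
  [AddCommGroup Z] [Module ℝ Z] [TopologicalSpace Z]

instance LCS.prod [LCS X] [LCS Y] : LCS (X × Y) where

/-- A relatively open subset of a convex set with nonempty interior. -/
def Good (S : Set X) : Prop :=
  ∃ O C : Set X, IsOpen O ∧ Convex ℝ C ∧ (interior C).Nonempty ∧ S = O ∩ C

lemma _root_.IsOpen.good [Nonempty X] {S : Set X} (h : IsOpen S) : Good S :=
  ⟨S, univ, h, convex_univ, by simp, by simp⟩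

lemma Good.inter {S O : Set X} (h : Good S) (hO : IsOpen O) : Good (O ∩ S) := by
  obtain ⟨O', C, h1, h2, h3, rfl⟩ := h
  exact ⟨O ∩ O', C, hO.inter h1, h2, h3, by rw [inter_assoc]⟩

lemma Good.prod {S : Set X} {T : Set Y} (hS : Good S) (hT : Good T) : Good (S ×ˢ T) := by
  obtain ⟨O, C, h1, h2, h3, rfl⟩ := hS
  obtain ⟨O', C', h1', h2', h3', rfl⟩ := hT
  exact ⟨O ×ˢ O', C ×ˢ C', h1.prod h1', h2.prod h2', by rw [interior_prod_eq]; exact h3.prod h3',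
    by rw [prod_inter_prod]⟩

lemma Good.prod_univ {S : Set X} (hS : Good S) : Good (S ×ˢ (univ : Set Y)) :=
  hS.prod (IsOpen.good isOpen_univ)

/-- A convex set with nonempty interior lies in the closure of its interior, and this survives
intersection with an open set. It is the density that makes differentials unique. -/
lemma Good.subset_closure [LCS X] {S : Set X} (hS : Good S) : S ⊆ closure (interior S) := by
  obtain ⟨O, C, h1, h2, h3, rfl⟩ := hS
  rw [interior_inter, h1.interior_eq]
  intro x hx
  have := h2.closure_interior_eq_closure_of_nonempty_interior h3
  exact h1.inter_closure ⟨hx.1, this ▸ _root_.subset_closure hx.2⟩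

/-- `df` is the differential of the `C¹` map `f` on `S`. -/
structure HasDiff (S : Set X) (f : X → Y) (df : X × X → Y) : Prop where
  cont : ContinuousOn f S
  lim : ∀ x ∈ interior S, ∀ v : X,
    Tendsto (fun h : ℝ => h⁻¹ • (f (x + h • v) - f x)) (𝓝[≠] 0) (𝓝 (df (x, v)))
  dcont : ContinuousOn df (S ×ˢ (univ : Set X))

lemma exists_closed_convex_nhds [LCS Y] {y : Y} {Q : Set Y} (hQ : Q ∈ 𝓝 y) :
    ∃ Q' ∈ 𝓝 y, IsClosed Q' ∧ Convex ℝ Q' ∧ Q' ⊆ Q := by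
  obtain ⟨Q1, ⟨h1, h1c⟩, h1s⟩ := (closed_nhds_basis y).mem_iff.1 hQ
  obtain ⟨Q2, ⟨h2, h2c⟩, h2s⟩ := (LocallyConvexSpace.convex_basis (𝕜 := ℝ) y).mem_iff.1 h1
  exact ⟨closure Q2, mem_of_superset h2 subset_closure, isClosed_closure, h2c.closure,
    (closure_minimal h2s h1c).trans h1s⟩

/-- Continuous functionals along lines reduce everything to derivatives in one real variable. -/
lemma HasDiff.hasDerivAt {S : Set X} {f : X → Y} {df : X × X → Y} (hf : HasDiff S f df)
    (l : Y →L[ℝ] ℝ) {a w : X} {t : ℝ} (ht : a + t • w ∈ interior S) :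
    HasDerivAt (fun t : ℝ => l (f (a + t • w))) (l (df (a + t • w, w))) t := by
  rw [hasDerivAt_iff_tendsto_slope_zero]
  refine ((l.continuous.tendsto _).comp (hf.lim _ ht w)).congr fun r => ?_
  simp [add_smul, add_assoc]

/-- Mean value theorem in Hahn–Banach form. A slope outside the closed convex set would be strictly
separated from it by a functional `l`, but the scalar mean value theorem makes `l` of the slope
equal to `l` of some derivative on the segment, which lies in the set. -/
lemma HasDiff.slope_mem [LCS Y] {S : Set X} {f : X → Y} {df : X × X → Y} (hf : HasDiff S f df)
    {Q : Set Y} (hQc : IsClosed Q) (hQ : Convex ℝ Q) {a w : X} {h : ℝ} (hh : 0 < h)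
    (hS : ∀ t ∈ Icc 0 h, a + t • w ∈ interior S)
    (hd : ∀ t ∈ Icc 0 h, df (a + t • w, w) ∈ Q) :
    h⁻¹ • (f (a + h • w) - f a) ∈ Q := by
  by_contra hn
  obtain ⟨l, s, h1, h2⟩ := geometric_hahn_banach_closed_point hQ hQc hn
  have hder : ∀ t ∈ Icc 0 h,
      HasDerivAt (fun t : ℝ => l (f (a + t • w))) (l (df (a + t • w, w))) t :=
    fun t ht => hf.hasDerivAt l (hS t ht)
  obtain ⟨t, ht, he⟩ := exists_hasDerivAt_eq_slope (fun t : ℝ => l (f (a + t • w)))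
    (fun t => l (df (a + t • w, w))) hh (fun t ht => (hder t ht).continuousAt.continuousWithinAt)
    (fun t ht => hder t (Ioo_subset_Icc_self ht))
  have h3 := h1 _ (hd t (Ioo_subset_Icc_self ht))
  rw [he] at h3
  simp only [zero_smul, add_zero, sub_zero, map_smul, map_sub, smul_eq_mul] at h2 h3
  rw [div_eq_inv_mul] at h3
  linarith

/-- Near `y` the set is convex and the derivatives stay in a prescribed closed convex neighbourhood
`Q`, so slopes over interior segments lie in `Q` by the mean value theorem. Segments touching the
boundary are limits of interior ones, and `Q` is closed. The uniformity in base point and direction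
is what the chain rule and additivity need. -/
lemma HasDiff.strict [LCS X] [LCS Y] {S : Set X} {f : X → Y} {df : X × X → Y} (hS : Good S)
    (hf : HasDiff S f df) {y : X} (hy : y ∈ S) (w : X) :
    Tendsto (fun q : ℝ × X × X => q.1⁻¹ • (f (q.2.1 + q.1 • q.2.2) - f q.2.1))
      (𝓝[{q | q.1 ≠ 0 ∧ q.2.1 ∈ S ∧ q.2.1 + q.1 • q.2.2 ∈ S}] (0, y, w)) (𝓝 (df (y, w))) := by
  intro Q0 hQ0
  obtain ⟨Q, hQ, hQc, hQv, hQs⟩ := exists_closed_convex_nhds hQ0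
  obtain ⟨O, C, hO, hC, ⟨c, hc⟩, rfl⟩ := hS
  have hm := hf.dcont (y, w) ⟨hy, mem_univ _⟩ hQ
  rw [mem_map, mem_nhdsWithin_iff_exists_mem_nhds_inter] at hm
  obtain ⟨U, hU, hUs⟩ := hm
  rw [nhds_prod_eq, mem_prod_iff] at hU
  obtain ⟨N1, hN1, W1, hW1, h1⟩ := hU
  obtain ⟨N2, ⟨h2, h2c⟩, h2s⟩ := (LocallyConvexSpace.convex_basis (𝕜 := ℝ) y).mem_iff.1
    (inter_mem hN1 (hO.mem_nhds hy.1))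
  set N := interior N2 with hN
  have hNo : IsOpen N := isOpen_interior
  have hNc : Convex ℝ N := h2c.interior
  have hNy : N ∈ 𝓝 y := interior_mem_nhds.2 h2
  have hNO : N ⊆ O := fun x hx => (h2s (interior_subset hx)).2
  set W := interior W1
  have hWo : IsOpen W := isOpen_interior
  have hWw : W ∈ 𝓝 w := interior_mem_nhds.2 hW1
  have hdQ : ∀ z ∈ N ∩ C, ∀ w' ∈ W, df (z, w') ∈ Q := fun z hz w' hw' =>
    hUs ⟨h1 ⟨(h2s (interior_subset hz.1)).1, interior_subset hw'⟩, ⟨hNO hz.1, hz.2⟩, mem_univ _⟩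
  have hint : N ∩ interior C ⊆ interior (O ∩ C) := by
    rw [interior_inter, hO.interior_eq]
    exact inter_subset_inter_left _ hNO
  have slope_mem_interior : ∀ a ∈ N ∩ interior C, ∀ w' ∈ W, ∀ h : ℝ, 0 < h → a + h • w' ∈ N ∩ interior C →
      h⁻¹ • (f (a + h • w') - f a) ∈ Q := by
    intro a ha w' hw' h hh hb
    have hseg : ∀ t ∈ Icc 0 h, a + t • w' ∈ N ∩ interior C := by
      intro t ht
      have := (hNc.inter hC.interior).add_smul_mem ha hb (t := t / h)
        ⟨div_nonneg ht.1 hh.le, (div_le_one hh).2 ht.2⟩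
      rwa [smul_smul, div_mul_cancel₀ _ hh.ne'] at this
    exact hf.slope_mem hQc hQv hh (fun t ht => hint (hseg t ht))
      fun t ht => hdQ _ ⟨(hseg t ht).1, interior_subset (hseg t ht).2⟩ _ hw'
  have slope_mem : ∀ a ∈ N ∩ C, ∀ w' ∈ W, ∀ h : ℝ, 0 < h → a + h • w' ∈ N ∩ C →
      h⁻¹ • (f (a + h • w') - f a) ∈ Q := by
    intro a ha w' hw' h hh hb
    -- Contracting towards the interior point `c` moves every point of `C` into the interior of `C`.
    have hap : ∀ b ∈ N ∩ C, Tendsto (fun ε : ℝ => b + ε • (c - b)) (𝓝[>] 0)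
        (𝓝[N ∩ interior C] b) := by
      intro b hb
      have h0 : Tendsto (fun ε : ℝ => b + ε • (c - b)) (𝓝[>] 0) (𝓝 b) := by
        have : Continuous fun ε : ℝ => b + ε • (c - b) := by fun_prop
        simpa using (this.tendsto 0).mono_left nhdsWithin_le_nhds
      refine tendsto_nhdsWithin_iff.2 ⟨h0, ?_⟩
      filter_upwards [h0 (hNo.mem_nhds hb.1), Ioo_mem_nhdsGT (show (0 : ℝ) < 1 by norm_num)]
        with ε h3 h4
      refine ⟨h3, ?_⟩
      have := hC.combo_interior_self_mem_interior hc hb.2 h4.1 (sub_nonneg.2 h4.2.le) (by ring)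
      convert this using 1
      module
    have hfb : ∀ b ∈ N ∩ C, Tendsto (fun ε : ℝ => f (b + ε • (c - b))) (𝓝[>] 0) (𝓝 (f b)) :=
      fun b hb => (hf.cont b ⟨hNO hb.1, hb.2⟩).tendsto.comp ((hap b hb).mono_right
        (nhdsWithin_mono _ fun x hx => ⟨hNO hx.1, interior_subset hx.2⟩))
    refine hQc.mem_of_tendsto (((hfb _ hb).sub (hfb _ ha)).const_smul h⁻¹) ?_
    have hw0 : Tendsto (fun ε : ℝ => (1 - ε) • w') (𝓝[>] 0) (𝓝 w') := by
      have : Continuous fun ε : ℝ => (1 - ε) • w' := by fun_prop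
      simpa using (this.tendsto 0).mono_left nhdsWithin_le_nhds
    filter_upwards [(hap _ ha) self_mem_nhdsWithin, (hap _ hb) self_mem_nhdsWithin,
      hw0 (hWo.mem_nhds hw')] with ε e1 e2 e3
    -- The contraction maps the segment to a segment with the same step `h`, whose direction is only
    -- scaled by 1 - ε and so remains in the open set `W`.
    have e4 : a + h • w' + ε • (c - (a + h • w')) = a + ε • (c - a) + h • ((1 - ε) • w') := by
      module
    rw [mem_preimage] at e1 e2 e3
    rw [e4] at e2 ⊢
    exact slope_mem_interior _ e1 _ e3 h hh e2
  have hcont : Tendsto (fun q : ℝ × X × X => q.2.1 + q.1 • q.2.2) (𝓝 (0, y, w)) (𝓝 y) := by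
    have : Continuous fun q : ℝ × X × X => q.2.1 + q.1 • q.2.2 := by fun_prop
    simpa using this.tendsto (0, y, w)
  have hcont1 : Tendsto (fun q : ℝ × X × X => q.2.1) (𝓝 (0, y, w)) (𝓝 y) :=
    (by fun_prop : Continuous fun q : ℝ × X × X => q.2.1).tendsto _
  have hcont2 : Tendsto (fun q : ℝ × X × X => q.2.2) (𝓝 (0, y, w)) (𝓝 w) :=
    (by fun_prop : Continuous fun q : ℝ × X × X => q.2.2).tendsto _
  rw [mem_map]
  filter_upwards [nhdsWithin_le_nhds (hcont hNy), nhdsWithin_le_nhds (hcont1 hNy),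
    nhdsWithin_le_nhds (hcont2 hWw), self_mem_nhdsWithin] with q q1 q2 q3 q4
  rw [mem_preimage] at q1 q2 q3 ⊢
  apply hQs
  -- For negative step the slope is the slope of the reversed segment, starting at the other end
  -- point.
  rcases lt_or_gt_of_ne q4.1 with hneg | hpos
  · have := slope_mem _ ⟨q1, q4.2.2.2⟩ _ q3 (-q.1) (neg_pos.2 hneg) (by simpa using ⟨q2, q4.2.1.2⟩)
    convert this using 1
    rw [neg_smul, add_neg_cancel_right, inv_neg, neg_smul, ← smul_neg, neg_sub]
  · exact slope_mem _ ⟨q2, q4.2.1.2⟩ _ q3 _ hpos ⟨q1, q4.2.2.2⟩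

variable [LCS X] [LCS Y] [LCS Z]

lemma tendsto_line (x v : X) : Tendsto (fun h : ℝ => x + h • v) (𝓝[≠] 0) (𝓝 x) := by
  have : Continuous fun h : ℝ => x + h • v := by fun_prop
  simpa using (this.tendsto 0).mono_left nhdsWithin_le_nhds

lemma HasDiff.unique {S : Set X} {f : X → Y} {df dg : X × X → Y} (hS : Good S)
    (hf : HasDiff S f df) (hg : HasDiff S f dg) : EqOn df dg (S ×ˢ (univ : Set X)) := by
  have h : EqOn df dg (interior (S ×ˢ (univ : Set X))) := by
    rw [interior_prod_eq]
    exact fun p hp => tendsto_nhds_unique (hf.lim p.1 hp.1 p.2) (hg.lim p.1 hp.1 p.2)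
  exact h.of_subset_closure hf.dcont hg.dcont interior_subset hS.prod_univ.subset_closure

/-- On the interior `df` is the directional derivative, and by continuity it is the value of the
extension by limits. Any witness for the existential in `IsCk` may thus be replaced by the canonical
`differential`. -/
lemma HasDiff.differential_eq {S : Set X} {f : X → Y} {df : X × X → Y}
    (hS : Good S) (hf : HasDiff S f df) : EqOn (differential S f) df (S ×ˢ (univ : Set X)) := by
  intro p hp
  have hcl := hS.prod_univ.subset_closure hp
  rw [interior_prod_eq, interior_univ] at hcl
  refine extendFrom_eq hcl ?_
  have h1 : Tendsto df (𝓝[interior S ×ˢ univ] p) (𝓝 (df p)) :=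
    (hf.dcont p hp).mono_left (nhdsWithin_mono _ (prod_mono interior_subset Subset.rfl))
  refine h1.congr' ?_
  filter_upwards [self_mem_nhdsWithin] with q hq
  exact ((hf.lim q.1 hq.1 q.2).limUnder_eq).symm

lemma slope_eventuallyEq {S : Set X} {f g : X → Y} (h : EqOn f g S) {x : X} (hx : x ∈ interior S)
    (v : X) : (fun t : ℝ => t⁻¹ • (f (x + t • v) - f x)) =ᶠ[𝓝[≠] 0]
      fun t : ℝ => t⁻¹ • (g (x + t • v) - g x) := by
  filter_upwards [tendsto_line x v (isOpen_interior.mem_nhds hx)] with t ht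
  rw [h (interior_subset ht), h (interior_subset hx)]

lemma HasDiff.congr {S : Set X} {f g : X → Y} {df dg : X × X → Y} (hf : HasDiff S f df)
    (h : EqOn f g S) (h' : EqOn df dg (S ×ˢ (univ : Set X))) : HasDiff S g dg where
  cont := hf.cont.congr h.symm
  dcont := hf.dcont.congr h'.symm
  lim x hx v := by
    rw [← h' (show (x, v) ∈ S ×ˢ (univ : Set X) from ⟨interior_subset hx, mem_univ _⟩)]
    exact (hf.lim x hx v).congr' (slope_eventuallyEq h hx v)

lemma differential_congr {S : Set X} {f g : X → Y} (h : EqOn f g S) :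
    differential S f = differential S g := by
  funext p
  have : map (dirDeriv f) (𝓝[interior S ×ˢ univ] p) = map (dirDeriv g) (𝓝[interior S ×ˢ univ] p) := by
    refine map_congr ?_
    filter_upwards [self_mem_nhdsWithin] with q hq
    unfold dirDeriv limUnder
    rw [map_congr (slope_eventuallyEq h hq.1 q.2)]
  unfold differential extendFrom limUnder
  rw [this]

/-- The differential is a limit at the given point, so it sees only a neighbourhood. No smoothness
is needed for this. -/
lemma differential_inter {S O : Set X} (f : X → Y) (hO : IsOpen O) {x : X} (hx : x ∈ O) (v : X) :
    differential (O ∩ S) f (x, v) = differential S f (x, v) := by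
  have : 𝓝[interior (O ∩ S) ×ˢ univ] (x, v) = 𝓝[interior S ×ˢ univ] (x, v) := by
    rw [interior_inter, hO.interior_eq]
    have : (O ∩ interior S) ×ˢ (univ : Set X) =
        (O ×ˢ (univ : Set X)) ∩ (interior S ×ˢ (univ : Set X)) := by
      rw [prod_inter_prod, univ_inter]
    rw [this]
    exact nhdsWithin_inter_of_mem (nhdsWithin_le_nhds
      ((hO.prod (isOpen_univ (X := X))).mem_nhds (show (x, v) ∈ _ from ⟨hx, mem_univ _⟩)))
  unfold differential extendFrom limUnder
  rw [this]

lemma HasDiff.mono {S S' : Set X} {f : X → Y} {df : X × X → Y} (hf : HasDiff S f df)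
    (h : S' ⊆ S) : HasDiff S' f df where
  cont := hf.cont.mono h
  lim x hx := hf.lim x (interior_mono h hx)
  dcont := hf.dcont.mono (prod_mono h Subset.rfl)

/-- The slope of `g ∘ f` is the slope of `g` at `f x` in the moving direction given by the slope of
`f`. Since `f` may send interior points of `S` to boundary points of `T`, strict differentiability
of `g` on all of `T` is used. -/
lemma HasDiff.comp {S : Set X} {T : Set Y} {f : X → Y} {df : X × X → Y} {g : Y → Z}
    {dg : Y × Y → Z} (hT : Good T) (hg : HasDiff T g dg) (hf : HasDiff S f df)
    (h : MapsTo f S T) : HasDiff S (g ∘ f) (fun p => dg (f p.1, df p)) where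
  cont := hg.cont.comp hf.cont h
  dcont := hg.dcont.comp ((hf.cont.comp continuousOn_fst fun p hp => hp.1).prodMk hf.dcont)
    fun p hp => ⟨h hp.1, mem_univ _⟩
  lim x hx v := by
    have h1 := hg.strict hT (h (interior_subset hx)) (df (x, v))
    have h2 : Tendsto (fun t : ℝ => (t, f x, t⁻¹ • (f (x + t • v) - f x))) (𝓝[≠] 0)
        (𝓝[{q | q.1 ≠ 0 ∧ q.2.1 ∈ T ∧ q.2.1 + q.1 • q.2.2 ∈ T}] (0, f x, df (x, v))) := by
      refine tendsto_nhdsWithin_iff.2 ⟨(tendsto_id.mono_left nhdsWithin_le_nhds).prodMk_nhds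
        (tendsto_const_nhds.prodMk_nhds (hf.lim x hx v)), ?_⟩
      filter_upwards [self_mem_nhdsWithin, tendsto_line x v (isOpen_interior.mem_nhds hx)]
        with t ht ht'
      refine ⟨ht, h (interior_subset hx), ?_⟩
      rw [smul_inv_smul₀ ht, add_sub_cancel]
      exact h (interior_subset ht')
    refine (h1.comp h2).congr' ?_
    filter_upwards [self_mem_nhdsWithin] with t ht
    simp only [Function.comp]
    rw [smul_inv_smul₀ ht, add_sub_cancel]

lemma HasDiff.prodMk {S : Set X} {f : X → Y} {df : X × X → Y} {g : X → Z} {dg : X × X → Z}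
    (hf : HasDiff S f df) (hg : HasDiff S g dg) :
    HasDiff S (fun x => (f x, g x)) (fun p => (df p, dg p)) where
  cont := hf.cont.prodMk hg.cont
  lim x hx v := (hf.lim x hx v).prodMk_nhds (hg.lim x hx v)
  dcont := hf.dcont.prodMk hg.dcont

lemma HasDiff.linear (S : Set X) (L : X →L[ℝ] Y) : HasDiff S L (fun p => L p.2) where
  cont := L.continuous.continuousOn
  lim x _ v := by
    refine tendsto_const_nhds.congr' ?_
    filter_upwards [self_mem_nhdsWithin] with t ht
    simp [inv_smul_smul₀ (show t ≠ 0 from ht)]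
  dcont := (L.continuous.comp continuous_snd).continuousOn

lemma HasDiff.const (S : Set X) (y : Y) : HasDiff S (fun _ => y) (fun _ => (0 : Y)) where
  cont := continuousOn_const
  lim x _ v := by simp
  dcont := continuousOn_const

/-- The slope along `v + w` is the slope along `v` at `x` plus the slope along `w` at the moving
base point `x + t • v`; strictness handles the latter at interior points, and density of the
interior does the rest. -/
lemma HasDiff.map_add {S : Set X} {f : X → Y} {df : X × X → Y} (hS : Good S) (hf : HasDiff S f df)
    {x : X} (hx : x ∈ S) (v w : X) : df (x, v + w) = df (x, v) + df (x, w) := by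
  have key : EqOn (fun x => df (x, v + w)) (fun x => df (x, v) + df (x, w)) (interior S) := by
    intro x hx
    have h1 := hf.strict hS (interior_subset hx) w
    have h2 : Tendsto (fun t : ℝ => (t, x + t • v, w)) (𝓝[≠] 0)
        (𝓝[{q | q.1 ≠ 0 ∧ q.2.1 ∈ S ∧ q.2.1 + q.1 • q.2.2 ∈ S}] (0, x, w)) := by
      refine tendsto_nhdsWithin_iff.2 ⟨(tendsto_id.mono_left nhdsWithin_le_nhds).prodMk_nhds
        ((tendsto_line x v).prodMk_nhds tendsto_const_nhds), ?_⟩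
      filter_upwards [self_mem_nhdsWithin, tendsto_line x v (isOpen_interior.mem_nhds hx),
        tendsto_line x (v + w) (isOpen_interior.mem_nhds hx)] with t ht ht1 ht2
      refine ⟨ht, interior_subset ht1, ?_⟩
      simp only [add_assoc, ← smul_add]
      exact interior_subset ht2
    refine tendsto_nhds_unique (hf.lim x hx (v + w)) ?_
    refine ((hf.lim x hx v).add (h1.comp h2)).congr fun t => ?_
    simp only [Function.comp, ← smul_add, add_assoc]
    congr 1
    abel
  have hc : ∀ u : X, ContinuousOn (fun x => df (x, u)) S := fun u =>
    hf.dcont.comp (by fun_prop) fun x hx => ⟨hx, mem_univ _⟩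
  exact key.of_subset_closure (hc _) ((hc _).add (hc _)) interior_subset hS.subset_closure hx

/-- A continuous additive map between real topological vector spaces is linear. -/
lemma HasDiff.exists_linear {S : Set X} {f : X → Y} {df : X × X → Y} (hS : Good S)
    (hf : HasDiff S f df) {x : X} (hx : x ∈ S) : ∃ L : X →L[ℝ] Y, ∀ v, L v = df (x, v) :=
  ⟨(AddMonoidHom.mk' (fun v => df (x, v)) (hf.map_add hS hx)).toRealLinearMap
    (by
      have : ContinuousOn (fun v => df (x, v)) univ :=
        hf.dcont.comp (by fun_prop) fun v _ => ⟨hx, mem_univ _⟩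
      exact continuousOn_univ.1 this), fun _ => rfl⟩

/-- The slope differs from the claimed differential by t • β v.1 v.2, which tends to zero. -/
lemma HasDiff.bilinear (β : X →ₗ[ℝ] Y →ₗ[ℝ] Z) (hβ : Continuous fun p : X × Y => β p.1 p.2) :
    HasDiff univ (fun p : X × Y => β p.1 p.2) (fun q => β q.1.1 q.2.2 + β q.2.1 q.1.2) where
  cont := hβ.continuousOn
  dcont := by
    refine Continuous.continuousOn (Continuous.add ?_ ?_)
    · exact hβ.comp (by fun_prop : Continuous fun q : (X × Y) × (X × Y) => (q.1.1, q.2.2))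
    · exact hβ.comp (by fun_prop : Continuous fun q : (X × Y) × (X × Y) => (q.2.1, q.1.2))
  lim x _ v := by
    have h : Tendsto (fun t : ℝ => β x.1 v.2 + β v.1 x.2 + t • β v.1 v.2) (𝓝[≠] 0)
        (𝓝 (β x.1 v.2 + β v.1 x.2)) := tendsto_line _ _
    refine h.congr' ?_
    filter_upwards [self_mem_nhdsWithin] with t ht
    have ht : t ≠ 0 := ht
    simp only [Prod.fst_add, Prod.snd_add, Prod.smul_fst, Prod.smul_snd, _root_.map_add, map_smul,
      LinearMap.add_apply, LinearMap.smul_apply]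
    rw [eq_inv_smul_iff₀ ht]
    simp only [smul_add]
    abel

end Calculus

/-! ### Maps of class C^k and smooth maps -/

section Ck

variable {X : Type u} {Y : Type v} {Z : Type w}
  [AddCommGroup X] [Module ℝ X] [TopologicalSpace X]
  [AddCommGroup Y] [Module ℝ Y] [TopologicalSpace Y]
  [AddCommGroup Z] [Module ℝ Z] [TopologicalSpace Z] [LCS X] [LCS Y] [LCS Z]

lemma isCk_succ {k : ℕ} {S : Set X} {f : X → Y} :
    IsCk (k + 1) S f ↔ ∃ df, HasDiff S f df ∧ IsCk k (S ×ˢ (univ : Set X)) df :=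
  ⟨fun ⟨h, df, h1, h2, h3⟩ => ⟨df, ⟨h, h1, h2⟩, h3⟩, fun ⟨df, h, h3⟩ =>
    ⟨h.cont, df, h.lim, h.dcont, h3⟩⟩

lemma IsCk.of_succ {k : ℕ} {S : Set X} {f : X → Y} (h : IsCk (k + 1) S f) : IsCk k S f := by
  induction k generalizing X Y with
  | zero => exact h.1
  | succ k ih =>
    obtain ⟨df, h1, h2⟩ := isCk_succ.1 h
    exact isCk_succ.2 ⟨df, h1, ih h2⟩

lemma IsCk.mono {k : ℕ} {S S' : Set X} {f : X → Y} (h : IsCk k S f) (hS : S' ⊆ S) :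
    IsCk k S' f := by
  induction k generalizing X Y with
  | zero => exact ContinuousOn.mono h hS
  | succ k ih =>
    obtain ⟨df, h1, h2⟩ := isCk_succ.1 h
    exact isCk_succ.2 ⟨df, h1.mono hS, ih h2 (prod_mono hS Subset.rfl)⟩

lemma IsCk.const (k : ℕ) (S : Set X) (y : Y) : IsCk k S (fun _ => y) := by
  induction k generalizing X Y with
  | zero => exact continuousOn_const
  | succ k ih => exact isCk_succ.2 ⟨_, HasDiff.const S y, ih _ _⟩

lemma IsCk.linear (k : ℕ) (S : Set X) (L : X →L[ℝ] Y) : IsCk k S L := by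
  induction k generalizing X Y with
  | zero => exact L.continuous.continuousOn
  | succ k ih => exact isCk_succ.2 ⟨_, HasDiff.linear S L, ih _ (L.comp (.snd ℝ X X))⟩

lemma IsCk.prodMk {k : ℕ} {S : Set X} {f : X → Y} {g : X → Z} (hf : IsCk k S f) (hg : IsCk k S g) :
    IsCk k S (fun x => (f x, g x)) := by
  induction k generalizing X Y Z with
  | zero => exact ContinuousOn.prodMk hf hg
  | succ k ih =>
    obtain ⟨df, h1, h2⟩ := isCk_succ.1 hf
    obtain ⟨dg, h3, h4⟩ := isCk_succ.1 hg
    exact isCk_succ.2 ⟨_, h1.prodMk h3, ih h2 h4⟩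

lemma IsCk.congr {k : ℕ} {S : Set X} {f g : X → Y} (h : IsCk k S f) (hfg : EqOn f g S) :
    IsCk k S g := by
  cases k with
  | zero => exact ContinuousOn.congr h hfg.symm
  | succ k =>
    obtain ⟨df, h1, h2⟩ := isCk_succ.1 h
    exact isCk_succ.2 ⟨df, h1.congr hfg fun _ _ => rfl, h2⟩

lemma IsCk.hasDiff {k : ℕ} {S : Set X} {f : X → Y} (hS : Good S) (h : IsCk (k + 1) S f) :
    HasDiff S f (differential S f) := by
  obtain ⟨df, h1, h2⟩ := isCk_succ.1 h
  exact h1.congr (fun _ _ => rfl) (h1.differential_eq hS).symm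

lemma IsCk.differential {k : ℕ} {S : Set X} {f : X → Y} (hS : Good S) (h : IsCk (k + 1) S f) :
    IsCk k (S ×ˢ (univ : Set X)) (differential S f) := by
  obtain ⟨df, h1, h2⟩ := isCk_succ.1 h
  exact h2.congr (h1.differential_eq hS).symm

/-- Proved separately because the general chain rule composes `f` with a projection in its inductive
step. Here the induction closes at once, as the differential of a linear map is linear. -/
lemma IsCk.comp_linear {k : ℕ} {S : Set X} {S' : Set Z} {f : X → Y} (hS : Good S)
    (hf : IsCk k S f) (L : Z →L[ℝ] X) (h : MapsTo L S' S) : IsCk k S' (f ∘ L) := by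
  induction k generalizing X Y Z with
  | zero => exact ContinuousOn.comp hf L.continuous.continuousOn h
  | succ k ih =>
    obtain ⟨df, h1, h2⟩ := isCk_succ.1 hf
    exact isCk_succ.2 ⟨_, h1.comp hS (HasDiff.linear S' L) h,
      ih (L := L.prodMap L) hS.prod_univ h2 fun p hp => ⟨h hp.1, mem_univ _⟩⟩

/-- The differential of the composite is `dg` after p ↦ (f p.1, df p), a composite of maps one
degree less regular, to which the induction hypothesis applies. -/
lemma IsCk.comp {k : ℕ} {S : Set X} {T : Set Y} {f : X → Y} {g : Y → Z} (hS : Good S) (hT : Good T)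
    (hg : IsCk k T g) (hf : IsCk k S f) (h : MapsTo f S T) : IsCk k S (g ∘ f) := by
  induction k generalizing X Y Z with
  | zero => exact ContinuousOn.comp hg hf h
  | succ k ih =>
    obtain ⟨df, h1, h2⟩ := isCk_succ.1 hf
    obtain ⟨dg, h3, h4⟩ := isCk_succ.1 hg
    refine isCk_succ.2 ⟨_, h3.comp hT h1 h, ?_⟩
    have h5 : IsCk k (T ×ˢ univ) dg := h4
    have h1' : IsCk k S f := hf.of_succ
    refine ih (g := dg) (f := fun p => (f p.1, df p)) (T := T ×ˢ univ) hS.prod_univ hT.prod_univ h5 ?_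
      fun p hp => ⟨h hp.1, mem_univ _⟩
    exact (h1'.comp_linear hS (.fst ℝ X X) fun p hp => hp.1).prodMk h2

/-- The local differentials glue without any compatibility check, since each of them is the
restriction of the single function `differential S f`. -/
lemma IsCk.of_local {k : ℕ} {S : Set X} {f : X → Y} (hS : Good S)
    (h : ∀ x ∈ S, ∃ O, IsOpen O ∧ x ∈ O ∧ IsCk k (O ∩ S) f) : IsCk k S f := by
  induction k generalizing X Y with
  | zero =>
    intro x hx
    obtain ⟨O, h1, h2, h3⟩ := h x hx
    exact (continuousWithinAt_inter' (nhdsWithin_le_nhds (h1.mem_nhds h2))).1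
      (inter_comm O S ▸ ContinuousOn.continuousWithinAt h3 ⟨h2, hx⟩)
  | succ k ih =>
    refine isCk_succ.2 ⟨LCGeom.differential S f, ⟨?_, ?_, ?_⟩, ?_⟩
    · intro x hx
      obtain ⟨O, h1, h2, h3⟩ := h x hx
      exact (continuousWithinAt_inter' (nhdsWithin_le_nhds (h1.mem_nhds h2))).1
        (inter_comm O S ▸ (h3.hasDiff (hS.inter h1)).cont x ⟨h2, hx⟩)
    · intro x hx v
      obtain ⟨O, h1, h2, h3⟩ := h x (interior_subset hx)
      rw [← differential_inter f h1 h2]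
      refine (h3.hasDiff (hS.inter h1)).lim x ?_ v
      rw [interior_inter, h1.interior_eq]
      exact ⟨h2, hx⟩
    · intro p hp
      obtain ⟨O, h1, h2, h3⟩ := h p.1 hp.1
      have h4 : (O ∩ S) ×ˢ (univ : Set X) = (S ×ˢ univ) ∩ (O ×ˢ univ) := by
        rw [prod_inter_prod, univ_inter, inter_comm]
      have h5 := (h3.hasDiff (hS.inter h1)).dcont.congr (g := LCGeom.differential S f) fun q hq =>
        (differential_inter f h1 hq.1.1 q.2).symm
      rw [h4] at h5
      refine (continuousWithinAt_inter' (nhdsWithin_le_nhds ?_)).1 (h5 p ⟨hp, h2, mem_univ _⟩)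
      exact (h1.prod (isOpen_univ (X := X))).mem_nhds ⟨h2, mem_univ _⟩
    · refine ih hS.prod_univ fun p hp => ?_
      obtain ⟨O, h1, h2, h3⟩ := h p.1 hp.1
      refine ⟨O ×ˢ univ, h1.prod isOpen_univ, ⟨h2, mem_univ _⟩, ?_⟩
      have h4 : (O ×ˢ univ) ∩ (S ×ˢ (univ : Set X)) = (O ∩ S) ×ˢ univ := by
        rw [prod_inter_prod, univ_inter]
      rw [h4]
      exact (h3.differential (hS.inter h1)).congr fun q hq => differential_inter f h1 hq.1.1 q.2

/-- The differential of β is the sum of β composed with two linear maps, so regularity passes from k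
to k + 1. -/
lemma IsCk.bilinear (k : ℕ) (β : X →ₗ[ℝ] Y →ₗ[ℝ] Z)
    (hβ : Continuous fun p : X × Y => β p.1 p.2) : IsCk k univ fun p : X × Y => β p.1 p.2 := by
  have hu : Good (univ : Set (X × Y)) := IsOpen.good isOpen_univ
  have huZ : Good (univ : Set (Z × Z)) := IsOpen.good isOpen_univ
  induction k with
  | zero => exact hβ.continuousOn
  | succ k ih =>
    refine isCk_succ.2 ⟨_, HasDiff.bilinear β hβ, ?_⟩
    let L1 : (X × Y) × (X × Y) →L[ℝ] X × Y :=
      ((ContinuousLinearMap.fst ℝ X Y).comp (.fst ℝ _ _)).prod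
        ((ContinuousLinearMap.snd ℝ X Y).comp (.snd ℝ _ _))
    let L2 : (X × Y) × (X × Y) →L[ℝ] X × Y :=
      ((ContinuousLinearMap.fst ℝ X Y).comp (.snd ℝ _ _)).prod
        ((ContinuousLinearMap.snd ℝ X Y).comp (.fst ℝ _ _))
    have h1 := ih.comp (IsOpen.good isOpen_univ) hu (IsCk.linear k univ L1) (mapsTo_univ _ _)
    have h2 := ih.comp (IsOpen.good isOpen_univ) hu (IsCk.linear k univ L2) (mapsTo_univ _ _)
    have h3 := (IsCk.linear k univ (ContinuousLinearMap.fst ℝ Z Z + .snd ℝ Z Z)).comp (IsOpen.good isOpen_univ) huZ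
      (h1.prodMk h2) (mapsTo_univ _ _)
    rw [univ_prod_univ]
    exact h3

/-! Smooth maps -/

variable {S : Set X} {T : Set Y} {f : X → Y} {g : Y → Z}

lemma IsSmoothOn.continuousOn (h : IsSmoothOn S f) : ContinuousOn f S := h 0

lemma IsSmoothOn.mono {S' : Set X} (h : IsSmoothOn S f) (hS : S' ⊆ S) : IsSmoothOn S' f :=
  fun k => (h k).mono hS

lemma IsSmoothOn.congr {g : X → Y} (h : IsSmoothOn S f) (hfg : EqOn f g S) : IsSmoothOn S g :=
  fun k => (h k).congr hfg

lemma IsSmoothOn.const (S : Set X) (y : Y) : IsSmoothOn S (fun _ => y) := fun k => .const k S y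

lemma IsSmoothOn.linear (S : Set X) (L : X →L[ℝ] Y) : IsSmoothOn S L := fun k => .linear k S L

lemma IsSmoothOn.prodMk {g : X → Z} (hf : IsSmoothOn S f) (hg : IsSmoothOn S g) :
    IsSmoothOn S (fun x => (f x, g x)) := fun k => (hf k).prodMk (hg k)

lemma IsSmoothOn.comp (hS : Good S) (hT : Good T) (hg : IsSmoothOn T g) (hf : IsSmoothOn S f)
    (h : MapsTo f S T) : IsSmoothOn S (g ∘ f) := fun k => (hg k).comp hS hT (hf k) h

lemma IsSmoothOn.of_local (hS : Good S)
    (h : ∀ x ∈ S, ∃ O, IsOpen O ∧ x ∈ O ∧ IsSmoothOn (O ∩ S) f) : IsSmoothOn S f :=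
  fun _ => .of_local hS fun x hx =>
    let ⟨O, h1, h2, h3⟩ := h x hx
    ⟨O, h1, h2, h3 _⟩

lemma IsSmoothOn.hasDiff (hS : Good S) (h : IsSmoothOn S f) :
    HasDiff S f (LCGeom.differential S f) := (h 1).hasDiff hS

lemma IsSmoothOn.differential (hS : Good S) (h : IsSmoothOn S f) :
    IsSmoothOn (S ×ˢ (univ : Set X)) (LCGeom.differential S f) := fun k => (h (k + 1)).differential hS

lemma IsSmoothOn.bilinear (β : X →ₗ[ℝ] Y →ₗ[ℝ] Z)
    (hβ : Continuous fun p : X × Y => β p.1 p.2) : IsSmoothOn univ fun p : X × Y => β p.1 p.2 :=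
  fun k => .bilinear k β hβ

lemma differential_comp (hS : Good S) (hT : Good T) (hg : IsSmoothOn T g) (hf : IsSmoothOn S f)
    (h : MapsTo f S T) {x : X} (hx : x ∈ S) (v : X) :
    differential S (g ∘ f) (x, v) = differential T g (f x, differential S f (x, v)) :=
  ((hg.hasDiff hT).comp hT (hf.hasDiff hS) h).differential_eq hS ⟨hx, mem_univ _⟩

lemma differential_linear (hS : Good S) (L : X →L[ℝ] Y) {x : X} (hx : x ∈ S) (v : X) :
    differential S L (x, v) = L v :=
  (HasDiff.linear S L).differential_eq hS (show (x, v) ∈ _ from ⟨hx, mem_univ _⟩)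

lemma differential_id (hS : Good S) {x : X} (hx : x ∈ S) (v : X) :
    differential S id (x, v) = v :=
  differential_linear hS (.id ℝ X) hx v

lemma differential_const (hS : Good S) (y : Y) {x : X} (hx : x ∈ S) (v : X) :
    differential S (fun _ => y) (x, v) = 0 :=
  (HasDiff.const S y).differential_eq hS (show (x, v) ∈ _ from ⟨hx, mem_univ _⟩)

lemma differential_prodMk {g : X → Z} (hS : Good S) (hf : IsSmoothOn S f) (hg : IsSmoothOn S g)
    {x : X} (hx : x ∈ S) (v : X) :
    differential S (fun x => (f x, g x)) (x, v) = (differential S f (x, v), differential S g (x, v)) :=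
  ((hf.hasDiff hS).prodMk (hg.hasDiff hS)).differential_eq hS ⟨hx, mem_univ _⟩

end Ck

/-! Symmetry of second derivatives -/

section Schwarz

variable {X : Type u} {Y : Type v} [AddCommGroup X] [Module ℝ X] [TopologicalSpace X]
  [AddCommGroup Y] [Module ℝ Y] [TopologicalSpace Y] [LCS X] [LCS Y]

/-- Two scalar mean value theorems: first for the difference s ↦ f(x + h w + s v) - f(x + s v), then
for the differential in direction `v` along t ↦ x + s v + t w. -/
lemma HasDiff.second_difference {S : Set X} {f : X → Y} {df : X × X → Y}
    {ddf : (X × X) × (X × X) → Y} (hf : HasDiff S f df) (hdf : HasDiff (S ×ˢ univ) df ddf)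
    (l : Y →L[ℝ] ℝ) {x v w : X} {h : ℝ} (hh : 0 < h)
    (hS : ∀ s ∈ Icc 0 h, ∀ t ∈ Icc 0 h, x + s • v + t • w ∈ interior S) :
    ∃ s ∈ Icc 0 h, ∃ t ∈ Icc 0 h,
      l (f (x + h • v + h • w)) - l (f (x + h • v)) - l (f (x + h • w)) + l (f x) =
        h * (h * l (ddf ((x + s • v + t • w, v), (w, 0)))) := by
  have h0 : (0 : ℝ) ∈ Icc 0 h := ⟨le_rfl, hh.le⟩
  have hhm : h ∈ Icc 0 h := ⟨hh.le, le_rfl⟩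
  have hd : ∀ s ∈ Icc 0 h, HasDerivAt
      (fun s : ℝ => l (f (x + h • w + s • v)) - l (f (x + s • v)))
      (l (df (x + h • w + s • v, v)) - l (df (x + s • v, v))) s := by
    intro s hs
    refine (hf.hasDerivAt l ?_).sub (hf.hasDerivAt l ?_)
    · rw [add_right_comm]; exact hS s hs h hhm
    · simpa using hS s hs 0 h0
  obtain ⟨s, hs, he⟩ := exists_hasDerivAt_eq_slope _ _ hh
    (fun t ht => (hd t ht).continuousAt.continuousWithinAt)
    (fun t ht => hd t (Ioo_subset_Icc_self ht))
  have hs := Ioo_subset_Icc_self hs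
  have hd2 : ∀ t ∈ Icc 0 h, HasDerivAt
      (fun t : ℝ => l (df ((x + s • v, v) + t • (w, (0 : X)))))
      (l (ddf ((x + s • v, v) + t • (w, (0 : X)), (w, 0)))) t := by
    intro t ht
    refine hdf.hasDerivAt l ?_
    rw [interior_prod_eq]
    exact ⟨by simpa using hS s hs t ht, by simp⟩
  obtain ⟨t, ht, he2⟩ := exists_hasDerivAt_eq_slope _ _ hh
    (fun t ht => (hd2 t ht).continuousAt.continuousWithinAt)
    (fun t ht => hd2 t (Ioo_subset_Icc_self ht))
  refine ⟨s, hs, t, Ioo_subset_Icc_self ht, ?_⟩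
  have e3 : ((x + s • v, v) + t • (w, (0 : X)) : X × X) = (x + s • v + t • w, v) := by simp
  rw [e3] at he2
  rw [he2]
  simp only [sub_zero, zero_smul, add_zero, Prod.smul_mk, Prod.mk_add_mk, smul_zero] at he ⊢
  rw [mul_div_cancel₀ _ hh.ne', add_right_comm x (s • v), he, mul_div_cancel₀ _ hh.ne',
    add_right_comm x (h • v)]
  ring

/-- The second difference is symmetric in `v` and `w`, and divided by h² it is a value of either
mixed derivative at a point near `x`. If the two mixed derivatives at `x` differed, a functional
would separate them, and by continuity their values near `x` would lie in disjoint sets. -/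
lemma HasDiff.symmetric {S : Set X} {f : X → Y} {df : X × X → Y}
    {ddf : (X × X) × (X × X) → Y} (hf : HasDiff S f df) (hdf : HasDiff (S ×ˢ univ) df ddf)
    {x : X} (hx : x ∈ interior S) (v w : X) : ddf ((x, v), (w, 0)) = ddf ((x, w), (v, 0)) := by
  by_contra hne
  obtain ⟨l, hl⟩ := geometric_hahn_banach_point_point (E := Y) hne
  obtain ⟨U, V, hU, hV, h1, h2, hUV⟩ := t2_separation hl.ne
  have hG : ∀ a b : X, Tendsto (fun q : ℝ × ℝ => l (ddf ((x + q.1 • a + q.2 • b, a), (b, 0))))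
      (𝓝 (0, 0)) (𝓝 (l (ddf ((x, a), (b, 0))))) := by
    intro a b
    refine (l.continuous.tendsto _).comp ?_
    have h3 : ContinuousAt ddf ((x, a), (b, 0)) := by
      refine hdf.dcont.continuousAt (mem_interior_iff_mem_nhds.1 ?_)
      rw [interior_prod_eq, interior_prod_eq]
      exact ⟨⟨hx, by simp⟩, by simp⟩
    have h4 : Continuous fun q : ℝ × ℝ => ((x + q.1 • a + q.2 • b, a), (b, (0 : X))) := by fun_prop
    refine h3.tendsto.comp ?_
    simpa using h4.tendsto (0, 0)
  have hin : ∀ a b : X, Tendsto (fun q : ℝ × ℝ => x + q.1 • a + q.2 • b) (𝓝 (0, 0)) (𝓝 x) := by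
    intro a b
    have h4 : Continuous fun q : ℝ × ℝ => x + q.1 • a + q.2 • b := by fun_prop
    simpa using h4.tendsto (0, 0)
  have hev := ((hG v w).eventually (hU.mem_nhds h1)).and
    (((hG w v).eventually (hV.mem_nhds h2)).and
    (((hin v w).eventually (isOpen_interior.mem_nhds hx)).and
    ((hin w v).eventually (isOpen_interior.mem_nhds hx))))
  rw [nhds_prod_eq] at hev
  obtain ⟨A, hA, B, hB, hAB⟩ := eventually_prod_iff.1 hev
  obtain ⟨δ, hδ, hδs⟩ := Metric.eventually_nhds_iff.1 (hA.and hB)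
  have hbox : ∀ s ∈ Icc 0 (δ / 2), A s ∧ B s := by
    intro s hs
    apply hδs
    rw [Real.dist_eq, sub_zero, abs_of_nonneg hs.1]
    linarith [hs.2]
  -- Half of δ is taken because the parameters range over a closed interval whereas the
  -- neighbourhood is an open ball.
  have hpos : 0 < δ / 2 := by linarith
  have hall : ∀ s ∈ Icc 0 (δ / 2), ∀ t ∈ Icc 0 (δ / 2), _ := fun s hs t ht =>
    hAB (hbox s hs).1 (hbox t ht).2
  obtain ⟨s, hs, t, ht, e1⟩ := hf.second_difference hdf l hpos
    fun s hs t ht => (hall s hs t ht).2.2.1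
  obtain ⟨s', hs', t', ht', e2⟩ := hf.second_difference hdf l hpos
    fun s hs t ht => (hall s hs t ht).2.2.2
  have e3 : l (ddf ((x + s • v + t • w, v), (w, 0))) =
      l (ddf ((x + s' • w + t' • v, w), (v, 0))) := by
    have : δ / 2 * (δ / 2 * l (ddf ((x + s • v + t • w, v), (w, 0)))) =
        δ / 2 * (δ / 2 * l (ddf ((x + s' • w + t' • v, w), (v, 0)))) := by
      rw [← e1, ← e2, add_right_comm x]
      ring
    exact mul_left_cancel₀ hpos.ne' (mul_left_cancel₀ hpos.ne' this)
  have m1 := (hall s hs t ht).1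
  have m2 := (hall s' hs' t' ht').2.1
  exact disjoint_left.1 hUV m1 (e3 ▸ m2)

end Schwarz

/-! ### Manifolds with boundary, derivatives in charts, and the tangent bundle -/

section Mfd

variable {X : Type*} {M : Type*} {Y : Type*} {N : Type*} {Z : Type*} {Q : Type*}
  [AddCommGroup X] [Module ℝ X] [TopologicalSpace X]
  [AddCommGroup Y] [Module ℝ Y] [TopologicalSpace Y]
  [AddCommGroup Z] [Module ℝ Z] [TopologicalSpace Z] [LCS X] [LCS Y] [LCS Z]

/-- `A` is the atlas of a smooth manifold (with corners). -/
structure LCAtlas.IsMfd (A : LCAtlas X M) : Prop where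
  isOpen_preimage : ∀ c ∈ A.atlas, ∀ O, IsOpen O → IsOpen[A.top] (c.source ∩ c.toFun ⁻¹' O)
  exists_open : ∀ c ∈ A.atlas, ∀ U, IsOpen[A.top] U →
    ∃ O, IsOpen O ∧ c.source ∩ U = c.source ∩ c.toFun ⁻¹' O
  injOn : ∀ c ∈ A.atlas, InjOn c.toFun c.source
  good : ∀ c ∈ A.atlas, Good (c.toFun '' c.source)
  smooth : SmoothAtlas A
  chartAt_mem : ∀ x, A.chartAt x ∈ A.atlas
  mem_chartAt : ∀ x, x ∈ (A.chartAt x).source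

variable {A : LCAtlas X M} {B : LCAtlas Y N} {C : LCAtlas Z Q} {f : M → N} {g : N → Q}
  {U : Set M} {V : Set N} {c : LCChart X M} {c' : LCChart Y N} {c'' : LCChart Z Q}

lemma rep_apply (hc : InjOn c.toFun c.source) (f : M → N) {x : M} (hx : x ∈ c.source) :
    rep c c' f (c.toFun x) = c'.toFun (f x) := by
  have h : ∃ y, y ∈ c.source ∧ c.toFun y = c.toFun x := ⟨x, hx, rfl⟩
  rw [rep, dif_pos h, hc h.choose_spec.1 hx h.choose_spec.2]

namespace LCAtlas.IsMfd

lemma isOpen_source (hA : A.IsMfd) (hc : c ∈ A.atlas) : IsOpen[A.top] c.source := by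
  simpa using hA.isOpen_preimage c hc univ isOpen_univ

/-- One open set of the model space cuts out `U` simultaneously in all subsets of the chart domain.
This turns shrinking a domain in the manifold into intersecting with an open set, where the locality
lemmas for `differential` and `IsSmoothOn` apply. -/
lemma exists_image_inter (hA : A.IsMfd) (hc : c ∈ A.atlas) (hU : IsOpen[A.top] U) :
    ∃ O, IsOpen O ∧ (∀ T ⊆ c.source, c.toFun '' (T ∩ U) = O ∩ c.toFun '' T) ∧
      ∀ x ∈ c.source, (c.toFun x ∈ O ↔ x ∈ U) := by
  obtain ⟨O, hO, h⟩ := hA.exists_open c hc U hU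
  have h2 : ∀ x ∈ c.source, (c.toFun x ∈ O ↔ x ∈ U) := fun x hx =>
    ⟨fun h3 => (h.symm.subset ⟨hx, h3⟩).2, fun h3 => (h.subset ⟨hx, h3⟩).2⟩
  refine ⟨O, hO, fun T hT => ?_, h2⟩
  ext y
  constructor
  · rintro ⟨x, ⟨hx, hxU⟩, rfl⟩
    exact ⟨(h2 x (hT hx)).2 hxU, x, hx, rfl⟩
  · rintro ⟨hy, x, hx, rfl⟩
    exact ⟨x, ⟨hx, (h2 x (hT hx)).1 hy⟩, rfl⟩

lemma good_image (hA : A.IsMfd) (hc : c ∈ A.atlas) (hU : IsOpen[A.top] U) (h : U ⊆ c.source) :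
    Good (c.toFun '' U) := by
  obtain ⟨O, hO, h1, -⟩ := hA.exists_image_inter hc hU
  rw [← inter_eq_self_of_subset_right h, h1 _ Subset.rfl]
  exact (hA.good c hc).inter hO

end LCAtlas.IsMfd

open LCAtlas

lemma MSmoothOn.isOpen_inter_preimage (hf : MSmoothOn A B f U) (hU : IsOpen[A.top] U)
    (hV : IsOpen[B.top] V) : IsOpen[A.top] (U ∩ f ⁻¹' V) :=
  @ContinuousOn.isOpen_inter_preimage M N A.top B.top f U V hf.1 hU hV

lemma MSmoothOn.rep_smooth (hf : MSmoothOn A B f U) (hc : c ∈ A.atlas) (hc' : c' ∈ B.atlas)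
    {T : Set M} (h1 : T ⊆ c.source) (h2 : T ⊆ U) (h3 : MapsTo f T c'.source) :
    IsSmoothOn (c.toFun '' T) (rep c c' f) :=
  (hf.2 c hc c' hc').mono (image_mono fun _ hx => ⟨⟨h1 hx, h2 hx⟩, h3 hx⟩)

lemma MSmoothOn.mono (hf : MSmoothOn A B f U) {U' : Set M} (h : U' ⊆ U) : MSmoothOn A B f U' :=
  ⟨@ContinuousOn.mono M N A.top B.top f U U' hf.1 h, fun _ hc _ hc' =>
    hf.rep_smooth hc hc' (fun _ hx => hx.1.1) (fun _ hx => h hx.1.2) fun _ hx => hx.2⟩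

lemma MSmooth.mSmoothOn (hf : MSmooth A B f) (U : Set M) : MSmoothOn A B f U :=
  MSmoothOn.mono hf (subset_univ _)

lemma image_inter_preimage_congr {f g : M → N} (h : EqOn f g U) :
    c.source ∩ U ∩ f ⁻¹' c'.source = c.source ∩ U ∩ g ⁻¹' c'.source := by
  ext x
  refine and_congr_right fun hx => ?_
  rw [mem_preimage, mem_preimage, h hx.2]

lemma MSmoothOn.congr (hA : A.IsMfd) (hf : MSmoothOn A B f U) {g : M → N} (h : EqOn f g U) :
    MSmoothOn A B g U := by
  refine ⟨@ContinuousOn.congr M N A.top B.top f g U hf.1 h.symm, fun c hc c' hc' => ?_⟩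
  rw [← image_inter_preimage_congr h]
  refine (hf.2 c hc c' hc').congr ?_
  rintro _ ⟨x, hx, rfl⟩
  rw [rep_apply (hA.injOn c hc) _ hx.1.1, rep_apply (hA.injOn c hc) _ hx.1.1, h hx.1.2]

lemma rep_comp_eqOn (hA : A.IsMfd) (hB : B.IsMfd) (hc : c ∈ A.atlas) (hc' : c' ∈ B.atlas)
    (f : M → N) (g : N → Q) {T : Set M} (h1 : T ⊆ c.source) (h2 : MapsTo f T c'.source) :
    EqOn (rep c' c'' g ∘ rep c c' f) (rep c c'' (g ∘ f)) (c.toFun '' T) := by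
  rintro _ ⟨x, hx, rfl⟩
  rw [Function.comp, rep_apply (hA.injOn c hc) _ (h1 hx), rep_apply (hB.injOn c' hc') _ (h2 hx),
    rep_apply (hA.injOn c hc) _ (h1 hx), Function.comp]

lemma rep_mapsTo (hA : A.IsMfd) (hc : c ∈ A.atlas) {f : M → N}
    {T : Set M} {T' : Set N} (h1 : T ⊆ c.source) (h : MapsTo f T T') :
    MapsTo (rep c c' f) (c.toFun '' T) (c'.toFun '' T') := by
  rintro _ ⟨x, hx, rfl⟩
  rw [rep_apply (hA.injOn c hc) _ (h1 hx)]
  exact ⟨f x, h hx, rfl⟩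

lemma rep_comp_smooth (hA : A.IsMfd) (hB : B.IsMfd) (hc : c ∈ A.atlas) (hc' : c' ∈ B.atlas)
    {f : M → N} {g : N → Q} {T : Set M} {T' : Set N} (hT : IsOpen[A.top] T)
    (hT' : IsOpen[B.top] T') (h1 : T ⊆ c.source) (h2 : T' ⊆ c'.source) (h : MapsTo f T T')
    (hf : IsSmoothOn (c.toFun '' T) (rep c c' f))
    (hg : IsSmoothOn (c'.toFun '' T') (rep c' c'' g)) :
    IsSmoothOn (c.toFun '' T) (rep c c'' (g ∘ f)) :=
  (hg.comp (hA.good_image hc hT h1) (hB.good_image hc' hT' h2) hf (rep_mapsTo hA hc h1 h)).congr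
    (rep_comp_eqOn hA hB hc hc' f g h1 (h.mono_right h2))

lemma SmoothAtlas.rep_smooth (hA : SmoothAtlas A) {c c' : LCChart X M} (hc : c ∈ A.atlas)
    (hc' : c' ∈ A.atlas) {T : Set M} (h1 : T ⊆ c.source) (h2 : T ⊆ c'.source) :
    IsSmoothOn (c.toFun '' T) (rep c c' (id : M → M)) :=
  (hA c hc c' hc').mono (image_mono fun _ hx => ⟨h1 hx, h2 hx⟩)

lemma continuousOn_of_local (hA : A.IsMfd) (hB : B.IsMfd)
    (h : ∀ x ∈ U, ∃ c ∈ A.atlas, ∃ c' ∈ B.atlas, ∃ T, IsOpen[A.top] T ∧ x ∈ T ∧ T ⊆ c.source ∧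
      MapsTo f T c'.source ∧ ContinuousOn (rep c c' f) (c.toFun '' T)) :
    @ContinuousOn M N A.top B.top f U := by
  let := A.top
  let := B.top
  intro x hx
  obtain ⟨c, hc, c', hc', T, hT, hxT, hTc, hTc', hs⟩ := h x hx
  refine ContinuousAt.continuousWithinAt ?_
  intro W hW
  obtain ⟨W', hWW, hWo, hxW⟩ := mem_nhds_iff.1 hW
  obtain ⟨O, hO, hOc⟩ := hB.exists_open c' hc' W' hWo
  have h1 : rep c c' f (c.toFun x) ∈ O := by
    rw [rep_apply (hA.injOn c hc) _ (hTc hxT)]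
    exact (hOc.subset ⟨hTc' hxT, hxW⟩).2
  have h2 := hs _ ⟨x, hxT, rfl⟩ (hO.mem_nhds h1)
  rw [mem_map, mem_nhdsWithin] at h2
  obtain ⟨O1, hO1, hxO1, hsub⟩ := h2
  have h3 : IsOpen (T ∩ (c.source ∩ c.toFun ⁻¹' O1)) :=
    hT.inter (hA.isOpen_preimage c hc O1 hO1)
  rw [mem_map]
  refine mem_of_superset (h3.mem_nhds ⟨hxT, hTc hxT, hxO1⟩) fun y hy => hWW ?_
  have h4 : rep c c' f (c.toFun y) ∈ O := hsub ⟨hy.2.2, y, hy.1, rfl⟩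
  rw [rep_apply (hA.injOn c hc) _ (hTc hy.1)] at h4
  exact (hOc.symm.subset ⟨hTc' hy.1, h4⟩).2

/-- Smoothness may be tested in one pair of charts around each point: in any other pair the
representation is locally this one composed with two smooth chart changes, and smoothness is local.
-/
lemma mSmoothOn_of_local (hA : A.IsMfd) (hB : B.IsMfd) (hU : IsOpen[A.top] U)
    (h : ∀ x ∈ U, ∃ c ∈ A.atlas, ∃ c' ∈ B.atlas, ∃ T, IsOpen[A.top] T ∧ x ∈ T ∧ T ⊆ c.source ∧
      MapsTo f T c'.source ∧ IsSmoothOn (c.toFun '' T) (rep c c' f)) : MSmoothOn A B f U := by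
  have hcont : @ContinuousOn M N A.top B.top f U := continuousOn_of_local hA hB fun x hx => by
    obtain ⟨c, hc, c', hc', T, h1, h2, h3, h4, h5⟩ := h x hx
    exact ⟨c, hc, c', hc', T, h1, h2, h3, h4, h5.continuousOn⟩
  refine ⟨hcont, fun d hd d' hd' => ?_⟩
  let := A.top
  let := B.top
  have ho : IsOpen (d.source ∩ U ∩ f ⁻¹' d'.source) := by
    rw [inter_assoc]
    exact (hA.isOpen_source hd).inter
      (hcont.isOpen_inter_preimage hU (hB.isOpen_source hd'))
  refine .of_local (hA.good_image hd ho fun x hx => hx.1.1) ?_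
  rintro _ ⟨x, hx, rfl⟩
  obtain ⟨c, hc, c', hc', T, hT, hxT, hTc, hTc', hs⟩ := h x hx.1.2
  obtain ⟨O, hO, hO1, hO2⟩ := hA.exists_image_inter hd hT
  refine ⟨O, hO, (hO2 x hx.1.1).2 hxT, ?_⟩
  rw [← hO1 _ fun x hx => hx.1.1]
  set T' := d.source ∩ U ∩ f ⁻¹' d'.source ∩ T with hT'
  have hT'o : IsOpen T' := ho.inter hT
  have hTT : T' ⊆ T := inter_subset_right
  have s1 : IsSmoothOn (d.toFun '' T') (rep d c id) :=
    hA.smooth.rep_smooth hd hc (fun x hx => hx.1.1.1) (hTT.trans hTc)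
  have s2 := rep_comp_smooth hA hA hd hc hT'o hT (fun x hx => hx.1.1.1) hTc
    (fun x hx => hTT hx) s1 hs
  have s3 : IsSmoothOn (c'.toFun '' (c'.source ∩ d'.source)) (rep c' d' id) :=
    hB.smooth.rep_smooth hc' hd' inter_subset_left inter_subset_right
  exact rep_comp_smooth hA hB hd hc' hT'o ((hB.isOpen_source hc').inter (hB.isOpen_source hd'))
    (fun x hx => hx.1.1.1) inter_subset_left (fun x hx => ⟨hTc' (hTT hx), hx.1.2⟩) s2 s3

lemma MSmoothOn.comp (hA : A.IsMfd) (hB : B.IsMfd) (hC : C.IsMfd) (hU : IsOpen[A.top] U)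
    (hV : IsOpen[B.top] V) (hg : MSmoothOn B C g V) (hf : MSmoothOn A B f U) (h : MapsTo f U V) :
    MSmoothOn A C (g ∘ f) U := by
  let := A.top
  let := B.top
  let := C.top
  refine mSmoothOn_of_local hA hC hU fun x hx => ?_
  set c := A.chartAt x
  set c' := B.chartAt (f x)
  set c'' := C.chartAt (g (f x))
  have hc := hA.chartAt_mem x
  have hc' := hB.chartAt_mem (f x)
  have hc'' := hC.chartAt_mem (g (f x))
  have o1 : IsOpen (V ∩ g ⁻¹' c''.source) := hg.isOpen_inter_preimage hV (hC.isOpen_source hc'')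
  have o2 : IsOpen (c'.source ∩ (V ∩ g ⁻¹' c''.source)) := (hB.isOpen_source hc').inter o1
  have o3 : IsOpen (U ∩ f ⁻¹' (c'.source ∩ (V ∩ g ⁻¹' c''.source))) :=
    hf.isOpen_inter_preimage hU o2
  refine ⟨c, hc, c'', hc'', _, (hA.isOpen_source hc).inter o3,
    ⟨hA.mem_chartAt x, hx, hB.mem_chartAt _, h hx, hC.mem_chartAt _⟩, inter_subset_left,
    fun y hy => hy.2.2.2.2, ?_⟩
  exact rep_comp_smooth hA hB hc hc' ((hA.isOpen_source hc).inter o3) o2 inter_subset_left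
    inter_subset_left (fun y hy => hy.2.2)
    (hf.rep_smooth hc hc' inter_subset_left (fun y hy => hy.2.1) fun y hy => hy.2.2.1)
    (hg.rep_smooth hc' hc'' inter_subset_left (fun y hy => hy.2.1) fun y hy => hy.2.2)

lemma mSmooth_id (hA : A.IsMfd) : MSmooth A A (id : M → M) := by
  let := A.top
  refine mSmoothOn_of_local hA hA isOpen_univ fun x _ => ⟨_, hA.chartAt_mem x, _, hA.chartAt_mem x,
    _, hA.isOpen_source (hA.chartAt_mem x), hA.mem_chartAt x, Subset.rfl, mapsTo_id _, ?_⟩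
  exact hA.smooth.rep_smooth (hA.chartAt_mem x) (hA.chartAt_mem x) Subset.rfl Subset.rfl

/-! Derivatives in charts -/

lemma chartDeriv_eq_differential (hA : A.IsMfd) (hc : c ∈ A.atlas) (hU : IsOpen[A.top] U) {x : M}
    (hxc : x ∈ c.source) (hx : x ∈ U) (v : X) : chartDeriv c c' f x v =
      differential (c.toFun '' (c.source ∩ U ∩ f ⁻¹' c'.source)) (rep c c' f) (c.toFun x, v) := by
  obtain ⟨O, hO, hO1, hO2⟩ := hA.exists_image_inter hc hU
  rw [inter_right_comm, hO1 _ inter_subset_left, differential_inter _ hO ((hO2 x hxc).2 hx)]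
  rfl

lemma chartDeriv_congr (hA : A.IsMfd) (hc : c ∈ A.atlas) (hU : IsOpen[A.top] U) {x : M}
    (hxc : x ∈ c.source) (hx : x ∈ U) {f g : M → N} (h : EqOn f g U) (v : X) :
    chartDeriv c c' f x v = chartDeriv c c' g x v := by
  rw [chartDeriv_eq_differential hA hc hU hxc hx, chartDeriv_eq_differential hA hc hU hxc hx,
    image_inter_preimage_congr h]
  refine congrFun (differential_congr ?_) _
  rintro _ ⟨y, hy, rfl⟩
  rw [rep_apply (hA.injOn c hc) _ hy.1.1, rep_apply (hA.injOn c hc) _ hy.1.1, h hy.1.2]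

/-- The derivative of a smooth map, computed on an open set that is mapped into a chart. -/
lemma chartDeriv_eq_differential' (hA : A.IsMfd) (hc : c ∈ A.atlas) (hU : IsOpen[A.top] U) {x : M}
    (hU1 : U ⊆ c.source) (hU2 : MapsTo f U c'.source) (hx : x ∈ U) (v : X) :
    chartDeriv c c' f x v = differential (c.toFun '' U) (rep c c' f) (c.toFun x, v) := by
  rw [chartDeriv_eq_differential hA hc hU (hU1 hx) hx]
  congr
  exact (inter_subset_left.trans inter_subset_right).antisymm fun y hy => ⟨⟨hU1 hy, hy⟩, hU2 hy⟩

/-- The chain rule after shrinking the domains until each map sends its domain into the next chart;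
locality guarantees that the shrinking leaves the derivatives unchanged. -/
lemma chartDeriv_comp (hA : A.IsMfd) (hB : B.IsMfd) (hC : C.IsMfd) (hU : IsOpen[A.top] U)
    (hV : IsOpen[B.top] V) (hg : MSmoothOn B C g V) (hf : MSmoothOn A B f U)
    (hc : c ∈ A.atlas) (hc' : c' ∈ B.atlas) (hc'' : c'' ∈ C.atlas) {x : M} (hxU : x ∈ U)
    (hxV : f x ∈ V) (hx : x ∈ c.source) (hx' : f x ∈ c'.source) (hx'' : g (f x) ∈ c''.source)
    (v : X) : chartDeriv c c'' (g ∘ f) x v = chartDeriv c' c'' g (f x) (chartDeriv c c' f x v) := by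
  let := A.top
  let := B.top
  let := C.top
  have o1 : IsOpen (V ∩ g ⁻¹' c''.source) := hg.isOpen_inter_preimage hV (hC.isOpen_source hc'')
  have o2 : IsOpen (c'.source ∩ (V ∩ g ⁻¹' c''.source)) := (hB.isOpen_source hc').inter o1
  have o3 : IsOpen (U ∩ f ⁻¹' (c'.source ∩ (V ∩ g ⁻¹' c''.source))) :=
    hf.isOpen_inter_preimage hU o2
  have o4 : IsOpen (c.source ∩ (U ∩ f ⁻¹' (c'.source ∩ (V ∩ g ⁻¹' c''.source)))) :=
    (hA.isOpen_source hc).inter o3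
  have hm : x ∈ c.source ∩ (U ∩ f ⁻¹' (c'.source ∩ (V ∩ g ⁻¹' c''.source))) :=
    ⟨hx, hxU, hx', hxV, hx''⟩
  rw [chartDeriv_eq_differential' (f := g ∘ f) hA hc o4 inter_subset_left
      (fun y hy => hy.2.2.2.2) hm,
    chartDeriv_eq_differential' hB hc' o2 inter_subset_left (fun y hy => hy.2.2) hm.2.2,
    chartDeriv_eq_differential' hA hc o4 inter_subset_left (fun y hy => hy.2.2.1) hm,
    ← differential_congr (rep_comp_eqOn hA hB hc hc' f g inter_subset_left fun y hy => hy.2.2.1),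
    differential_comp (hA.good_image hc o4 inter_subset_left)
      (hB.good_image hc' o2 inter_subset_left)
      (hg.rep_smooth hc' hc'' inter_subset_left (fun y hy => hy.2.1) fun y hy => hy.2.2)
      (hf.rep_smooth hc hc' inter_subset_left (fun y hy => hy.2.1) fun y hy => hy.2.2.1)
      (rep_mapsTo hA hc inter_subset_left fun y hy => hy.2.2) ⟨x, hm, rfl⟩,
    rep_apply (hA.injOn c hc) _ hx]

lemma chartDeriv_id_self (hA : A.IsMfd) (hc : c ∈ A.atlas) {x : M} (hx : x ∈ c.source) (v : X) :
    chartDeriv c c (id : M → M) x v = v := by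
  rw [chartDeriv_eq_differential' hA hc (hA.isOpen_source hc) Subset.rfl (mapsTo_id _) hx,
    ← differential_congr (f := id), differential_id (hA.good c hc) ⟨x, hx, rfl⟩]
  rintro _ ⟨y, hy, rfl⟩
  rw [rep_apply (hA.injOn c hc) _ hy]
  rfl

lemma chartDeriv_id_trans (hA : A.IsMfd) {c c' c'' : LCChart X M} (hc : c ∈ A.atlas)
    (hc' : c' ∈ A.atlas) (hc'' : c'' ∈ A.atlas) {x : M} (hx : x ∈ c.source) (hx' : x ∈ c'.source)
    (hx'' : x ∈ c''.source) (v : X) : chartDeriv c' c'' (id : M → M) x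
      (chartDeriv c c' (id : M → M) x v) = chartDeriv c c'' (id : M → M) x v :=
  (chartDeriv_comp hA hA hA (@isOpen_univ _ A.top) (@isOpen_univ _ A.top) (mSmooth_id hA)
    (mSmooth_id hA) hc hc' hc'' (mem_univ x) (mem_univ _) hx hx' hx'' v).symm

lemma chartDeriv_exists_linear (hA : A.IsMfd) (hB : B.IsMfd) (hU : IsOpen[A.top] U)
    (hf : MSmoothOn A B f U) (hc : c ∈ A.atlas) (hc' : c' ∈ B.atlas) {x : M} (hxU : x ∈ U)
    (hx : x ∈ c.source) (hx' : f x ∈ c'.source) :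
    ∃ L : X →L[ℝ] Y, ∀ v, L v = chartDeriv c c' f x v := by
  let := A.top
  let := B.top
  have o : IsOpen (c.source ∩ (U ∩ f ⁻¹' c'.source)) :=
    (hA.isOpen_source hc).inter (hf.isOpen_inter_preimage hU (hB.isOpen_source hc'))
  have hm : x ∈ c.source ∩ (U ∩ f ⁻¹' c'.source) := ⟨hx, hxU, hx'⟩
  have hg := hA.good_image hc o inter_subset_left
  obtain ⟨L, hL⟩ := ((hf.rep_smooth hc hc' inter_subset_left (fun y hy => hy.2.1)
    fun y hy => hy.2.2).hasDiff hg).exists_linear hg ⟨x, hm, rfl⟩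
  refine ⟨L, fun v => ?_⟩
  rw [hL, chartDeriv_eq_differential' hA hc o inter_subset_left (fun y hy => hy.2.2) hm]

lemma tangentMap_comp (hA : A.IsMfd) (hB : B.IsMfd) (hC : C.IsMfd) (hU : IsOpen[A.top] U)
    (hV : IsOpen[B.top] V) (hg : MSmoothOn B C g V) (hf : MSmoothOn A B f U) {p : M × X}
    (hxU : p.1 ∈ U) (hxV : f p.1 ∈ V) :
    tangentMap A C (g ∘ f) p = tangentMap B C g (tangentMap A B f p) :=
  Prod.ext rfl (chartDeriv_comp hA hB hC hU hV hg hf (hA.chartAt_mem _) (hB.chartAt_mem _)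
    (hC.chartAt_mem _) hxU hxV (hA.mem_chartAt _) (hB.mem_chartAt _) (hC.mem_chartAt _) _)

lemma tangentMap_congr (hA : A.IsMfd) (hU : IsOpen[A.top] U) {f g : M → N} (h : EqOn f g U)
    {p : M × X} (hp : p.1 ∈ U) : tangentMap A B f p = tangentMap A B g p := by
  unfold tangentMap
  rw [h hp, chartDeriv_congr hA (hA.chartAt_mem _) hU (hA.mem_chartAt _) hp h]

lemma tangentMap_id (hA : A.IsMfd) : tangentMap A A (id : M → M) = id :=
  funext fun _ => Prod.ext rfl (chartDeriv_id_self hA (hA.chartAt_mem _) (hA.mem_chartAt _) _)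

/-! The tangent bundle -/

/-- Tangent vectors are stored in preferred charts, but in any charts `Tc` and `Tc'` the tangent map
reads as the derivative in `c` and `c'`: both sides are the derivative from the preferred chart to
`c'`, factored once through the preferred chart at `f p.1` and once through `c`. -/
lemma tangentChart_tangentMap (hA : A.IsMfd) (hB : B.IsMfd) (hU : IsOpen[A.top] U)
    (hf : MSmoothOn A B f U) (hc : c ∈ A.atlas) (hc' : c' ∈ B.atlas) {p : M × X} (hpU : p.1 ∈ U)
    (hp : p.1 ∈ c.source) (hp' : f p.1 ∈ c'.source) :
    (tangentChart B c').toFun (tangentMap A B f p) =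
      (c'.toFun (f p.1), chartDeriv c c' f p.1 ((tangentChart A c).toFun p).2) := by
  refine Prod.ext rfl ?_
  have h1 := chartDeriv_comp hA hB hB hU (@isOpen_univ _ B.top) (mSmooth_id hB) hf
    (hA.chartAt_mem p.1) (hB.chartAt_mem (f p.1)) hc' hpU (mem_univ _) (hA.mem_chartAt _)
    (hB.mem_chartAt _) hp' p.2
  have h2 := chartDeriv_comp hA hA hB (@isOpen_univ _ A.top) hU hf (mSmooth_id hA)
    (hA.chartAt_mem p.1) hc hc' (mem_univ _) hpU (hA.mem_chartAt _) hp hp' p.2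
  exact h1.symm.trans h2

lemma tangentChart_image (hA : A.IsMfd) (hc : c ∈ A.atlas) (hU : U ⊆ c.source) :
    (tangentChart A c).toFun '' (U ×ˢ univ) = (c.toFun '' U) ×ˢ univ := by
  ext ⟨y, w⟩
  constructor
  · rintro ⟨p, hp, h⟩
    obtain ⟨rfl, -⟩ := Prod.mk.inj h
    exact ⟨⟨p.1, hp.1, rfl⟩, mem_univ _⟩
  · rintro ⟨⟨x, hx, rfl⟩, -⟩
    refine ⟨(x, chartDeriv c (A.chartAt x) id x w), ⟨hx, mem_univ _⟩, Prod.ext rfl ?_⟩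
    exact (chartDeriv_id_trans hA hc (hA.chartAt_mem x) hc (hU hx) (hA.mem_chartAt x) (hU hx)
      w).trans (chartDeriv_id_self hA hc (hU hx) w)

lemma tangentChart_source (c : LCChart X M) : (tangentChart A c).source = c.source ×ˢ univ := by
  ext p
  simp [tangentChart]

lemma tangentChart_injOn (hA : A.IsMfd) (hc : c ∈ A.atlas) :
    InjOn (tangentChart A c).toFun (tangentChart A c).source := by
  rintro ⟨x, v⟩ hx ⟨y, w⟩ hy h
  obtain ⟨h1, h2⟩ := Prod.mk.inj h
  obtain rfl : x = y := hA.injOn c hc hx hy h1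
  have h3 := congrArg (chartDeriv c (A.chartAt x) id x) h2
  have hx : x ∈ c.source := hx
  simp only at h3
  rw [chartDeriv_id_trans hA (hA.chartAt_mem x) hc (hA.chartAt_mem x) (hA.mem_chartAt x) hx
    (hA.mem_chartAt x), chartDeriv_id_trans hA (hA.chartAt_mem x) hc (hA.chartAt_mem x)
    (hA.mem_chartAt x) hx (hA.mem_chartAt x), chartDeriv_id_self hA (hA.chartAt_mem x)
    (hA.mem_chartAt x), chartDeriv_id_self hA (hA.chartAt_mem x) (hA.mem_chartAt x)] at h3
  rw [h3]

/-- In tangent charts `Tf` is the pair (f, df), which reduces smoothness of `Tf` to that of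
`differential`. -/
lemma rep_tangentMap (hA : A.IsMfd) (hB : B.IsMfd) (hU : IsOpen[A.top] U)
    (hf : MSmoothOn A B f U) (hc : c ∈ A.atlas) (hc' : c' ∈ B.atlas) {T : Set M}
    (hT : IsOpen[A.top] T) (h1 : T ⊆ c.source) (h2 : T ⊆ U) (h3 : MapsTo f T c'.source) :
    EqOn (fun q : X × X => (rep c c' f q.1, differential (c.toFun '' T) (rep c c' f) q))
      (rep (tangentChart A c) (tangentChart B c') (tangentMap A B f)) ((c.toFun '' T) ×ˢ univ) := by
  rw [← tangentChart_image hA hc h1]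
  rintro _ ⟨p, hp, rfl⟩
  rw [rep_apply (tangentChart_injOn hA hc) _ (h1 hp.1),
    tangentChart_tangentMap hA hB hU hf hc hc' (h2 hp.1) (h1 hp.1) (h3 hp.1),
    chartDeriv_eq_differential' hA hc hT h1 h3 hp.1]
  exact Prod.ext (rep_apply (hA.injOn c hc) _ (h1 hp.1)) rfl

lemma rep_tangentMap_smooth (hA : A.IsMfd) (hB : B.IsMfd) (hU : IsOpen[A.top] U)
    (hf : MSmoothOn A B f U) (hc : c ∈ A.atlas) (hc' : c' ∈ B.atlas) {T : Set M}
    (hT : IsOpen[A.top] T) (h1 : T ⊆ c.source) (h2 : T ⊆ U) (h3 : MapsTo f T c'.source) :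
    IsSmoothOn ((tangentChart A c).toFun '' (T ×ˢ univ))
      (rep (tangentChart A c) (tangentChart B c') (tangentMap A B f)) := by
  rw [tangentChart_image hA hc h1]
  have hg := hA.good_image hc hT h1
  have hs := hf.rep_smooth hc hc' h1 h2 h3
  exact ((hs.comp hg.prod_univ hg (.linear _ (.fst ℝ X X)) fun q hq => hq.1).prodMk
    (hs.differential hg)).congr (rep_tangentMap hA hB hU hf hc hc' hT h1 h2 h3)

/-- The topology of the tangent bundle is generated by all tangent charts together, so one has to
see that sets generated by another chart are relatively open in this one. For a generator this is
continuity of the chart change, which is the tangent map of the identity; the operations generating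
a topology are then followed by induction. -/
lemma tangent_exists_open (hA : A.IsMfd) (hc : c ∈ A.atlas) {W : Set (M × X)}
    (hW : IsOpen[A.tangent.top] W) : ∃ O, IsOpen O ∧
      (tangentChart A c).source ∩ W = (tangentChart A c).source ∩ (tangentChart A c).toFun ⁻¹' O := by
  let := A.top
  induction hW with
  | basic W hW =>
    obtain ⟨c', hc', O', hO', rfl⟩ := hW
    set T := c.source ∩ c'.source with hTdef
    have hT : IsOpen T := (hA.isOpen_source hc).inter (hA.isOpen_source hc')
    obtain ⟨O, hO, hO1, hO2⟩ := hA.exists_image_inter hc (hA.isOpen_source hc')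
    have hs := (rep_tangentMap_smooth hA hA isOpen_univ (mSmooth_id hA) hc hc' hT inter_subset_left
      (subset_univ _) (fun x hx => hx.2)).continuousOn
    rw [tangentChart_image hA hc inter_subset_left, hO1 _ Subset.rfl, tangentMap_id hA] at hs
    obtain ⟨O1, hO1o, hO1e⟩ := (continuousOn_iff'.1 hs) O' hO'
    -- `O1` comes from continuity of the chart change on the overlap; `O` confines the base point to
    -- the domain of `c'`.
    refine ⟨O1 ∩ (O ×ˢ univ), hO1o.inter (hO.prod isOpen_univ), ?_⟩
    ext p
    have key : p.1 ∈ c.source → p.1 ∈ c'.source → ((tangentChart A c').toFun p ∈ O' ↔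
        (tangentChart A c).toFun p ∈ O1) := by
      intro h1 h2
      have h3 : (tangentChart A c).toFun p ∈ (O ∩ c.toFun '' c.source) ×ˢ (univ : Set X) :=
        ⟨⟨(hO2 _ h1).2 h2, p.1, h1, rfl⟩, mem_univ _⟩
      have h4 := Set.ext_iff.1 hO1e ((tangentChart A c).toFun p)
      simp only [mem_inter_iff, mem_preimage, h3, and_true] at h4
      rw [← h4, rep_apply (tangentChart_injOn hA hc) _ h1]
      rfl
    constructor
    · rintro ⟨h1, h2, h3⟩
      exact ⟨h1, (key h1 h2).1 h3, (hO2 _ h1).2 h2, mem_univ _⟩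
    · rintro ⟨h1, h2, h3, -⟩
      have h4 := (hO2 _ h1).1 h3
      exact ⟨h1, h4, (key h1 h4).2 h2⟩
  | univ => exact ⟨univ, isOpen_univ, by simp⟩
  | inter s t _ _ hs ht =>
    obtain ⟨O1, h1, e1⟩ := hs
    obtain ⟨O2, h2, e2⟩ := ht
    exact ⟨O1 ∩ O2, h1.inter h2, by rw [inter_inter_distrib_left, e1, e2, preimage_inter,
      ← inter_inter_distrib_left]⟩
  | sUnion S _ hS =>
    choose! O h1 h2 using hS
    refine ⟨⋃ s ∈ S, O s, isOpen_biUnion h1, ?_⟩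
    rw [sUnion_eq_biUnion, inter_iUnion₂, preimage_iUnion₂, inter_iUnion₂]
    exact iUnion₂_congr h2

lemma isOpen_tangentChart_inter (hc : c ∈ A.atlas) {O : Set (X × X)} (hO : IsOpen O) :
    IsOpen[A.tangent.top] ((tangentChart A c).source ∩ (tangentChart A c).toFun ⁻¹' O) :=
  TopologicalSpace.isOpen_generateFrom_of_mem ⟨c, hc, O, hO, rfl⟩

lemma isOpen_tangent (hA : A.IsMfd) (hU : IsOpen[A.top] U) :
    IsOpen[A.tangent.top] (U ×ˢ (univ : Set X)) := by
  let := A.tangent.top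
  have : U ×ˢ (univ : Set X) = ⋃ c ∈ A.atlas, (tangentChart A c).source ∩ U ×ˢ univ := by
    ext p
    refine ⟨fun h => mem_iUnion₂.2 ⟨_, hA.chartAt_mem p.1, hA.mem_chartAt p.1, h⟩, fun h => ?_⟩
    obtain ⟨_, _, _, h⟩ := mem_iUnion₂.1 h
    exact h
  rw [this]
  refine isOpen_biUnion fun c hc => ?_
  obtain ⟨O, hO, h⟩ := hA.exists_open c hc U hU
  convert isOpen_tangentChart_inter (A := A) hc (hO.prod (isOpen_univ (X := X))) using 1
  ext p
  have := Set.ext_iff.1 h p.1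
  simp only [mem_inter_iff, mem_preimage] at this
  simpa [tangentChart] using this

lemma LCAtlas.IsMfd.tangent (hA : A.IsMfd) : A.tangent.IsMfd where
  isOpen_preimage := by
    rintro _ ⟨c, hc, rfl⟩ O hO
    exact isOpen_tangentChart_inter hc hO
  exists_open := by
    rintro _ ⟨c, hc, rfl⟩ W hW
    exact tangent_exists_open hA hc hW
  injOn := by
    rintro _ ⟨c, hc, rfl⟩
    exact tangentChart_injOn hA hc
  good := by
    rintro _ ⟨c, hc, rfl⟩
    rw [tangentChart_source, tangentChart_image hA hc Subset.rfl]
    exact (hA.good c hc).prod_univ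
  smooth := by
    rintro _ ⟨c, hc, rfl⟩ _ ⟨c', hc', rfl⟩
    let := A.top
    have := rep_tangentMap_smooth hA hA isOpen_univ (mSmooth_id hA) hc hc'
      ((hA.isOpen_source hc).inter (hA.isOpen_source hc')) inter_subset_left
      (subset_univ _) (fun x hx => hx.2)
    rw [tangentMap_id hA] at this
    rw [tangentChart_source, tangentChart_source, prod_inter_prod, univ_inter]
    exact this
  chartAt_mem p := ⟨_, hA.chartAt_mem p.1, rfl⟩
  mem_chartAt p := hA.mem_chartAt p.1

lemma MSmoothOn.tangentMap (hA : A.IsMfd) (hB : B.IsMfd) (hU : IsOpen[A.top] U)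
    (hf : MSmoothOn A B f U) :
    MSmoothOn A.tangent B.tangent (tangentMap A B f) (U ×ˢ (univ : Set X)) := by
  let := A.top
  refine mSmoothOn_of_local hA.tangent hB.tangent (isOpen_tangent hA hU) fun p hp => ?_
  have hc := hA.chartAt_mem p.1
  have hc' := hB.chartAt_mem (f p.1)
  have o : IsOpen ((A.chartAt p.1).source ∩ (U ∩ f ⁻¹' (B.chartAt (f p.1)).source)) :=
    (hA.isOpen_source hc).inter (hf.isOpen_inter_preimage hU (hB.isOpen_source hc'))
  refine ⟨_, ⟨_, hc, rfl⟩, _, ⟨_, hc', rfl⟩, _, isOpen_tangent hA o,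
    ⟨⟨hA.mem_chartAt _, hp.1, hB.mem_chartAt _⟩, mem_univ _⟩, fun q hq => hq.1.1,
    fun q hq => hq.1.2.2, ?_⟩
  exact rep_tangentMap_smooth hA hB hU hf hc hc' o inter_subset_left (fun q hq => hq.2.1)
    fun q hq => hq.2.2

/-- Vectors over different points are separated in the base, vectors over the same point in a
tangent chart. Hausdorffness is needed on every iterated tangent bundle to split compact sets there.
-/
lemma tangent_t2 (hA : A.IsMfd) (h : @T2Space M A.top) : @T2Space (M × X) A.tangent.top := by
  let := A.top
  let := A.tangent.top
  refine ⟨fun p q hpq => ?_⟩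
  by_cases hx : p.1 = q.1
  · set c := A.chartAt p.1
    have hc := hA.chartAt_mem p.1
    have hp : p ∈ (tangentChart A c).source := hA.mem_chartAt p.1
    have hq : q.1 ∈ c.source := hx ▸ hA.mem_chartAt p.1
    have hne : (tangentChart A c).toFun p ≠ (tangentChart A c).toFun q := fun h =>
      hpq (tangentChart_injOn hA hc hp hq h)
    obtain ⟨O, O', h1, h2, h3, h4, h5⟩ := t2_separation hne
    exact ⟨_, _, isOpen_tangentChart_inter hc h1, isOpen_tangentChart_inter hc h2, ⟨hp, h3⟩,
      ⟨hq, h4⟩, (h5.preimage _).mono inter_subset_right inter_subset_right⟩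
  · obtain ⟨O, O', h1, h2, h3, h4, h5⟩ := t2_separation hx
    exact ⟨O ×ˢ univ, O' ×ˢ univ, isOpen_tangent hA h1, isOpen_tangent hA h2, ⟨h3, mem_univ _⟩,
      ⟨h4, mem_univ _⟩, h5.set_prod_left _ _⟩

end Mfd

/-! ### Vector spaces, products, open submanifolds and charted spaces as manifolds -/

section Examples

variable {X : Type*} {M : Type*} {Y : Type*} {N : Type*} {Z : Type*} {Q : Type*}
  [AddCommGroup X] [Module ℝ X] [TopologicalSpace X]
  [AddCommGroup Y] [Module ℝ Y] [TopologicalSpace Y]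
  [AddCommGroup Z] [Module ℝ Z] [TopologicalSpace Z] [LCS X] [LCS Y] [LCS Z]
  {A : LCAtlas X M} {B : LCAtlas Y N} {C : LCAtlas Z Q} {f : M → N} {g : M → Q}
  {U : Set M} {V : Set N} {c : LCChart X M} {b : LCChart Y N} {d : LCChart Z Q}

instance LCS.of_normedSpace {X : Type*} [NormedAddCommGroup X] [NormedSpace ℝ X] : LCS X where

/-! Vector spaces -/

lemma selfAtlas_isMfd (X : Type*) [AddCommGroup X] [Module ℝ X] [TopologicalSpace X] [LCS X] :
    (selfAtlas X).IsMfd where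
  isOpen_preimage := by
    rintro _ rfl O hO
    rw [univ_inter]
    exact hO
  exists_open := by
    rintro _ rfl U hU
    exact ⟨U, hU, rfl⟩
  injOn := by
    rintro _ rfl
    exact injOn_id _
  good := by
    rintro _ rfl
    simpa using IsOpen.good (X := X) isOpen_univ
  smooth := by
    rintro _ rfl _ rfl
    refine (IsSmoothOn.linear _ (.id ℝ X)).congr fun x _ => ?_
    exact (rep_apply (c := (⟨univ, id⟩ : LCChart X X)) (c' := (⟨univ, id⟩ : LCChart X X))
      (injOn_id _) _ (mem_univ x)).symm
  chartAt_mem _ := rfl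
  mem_chartAt _ := mem_univ _

/-- An equality of atlases, because the derivative of the identity in the single chart is the
identity. Iterated tangent maps of vector-valued functions are thereby again vector-valued
functions. -/
lemma selfAtlas_tangent : (selfAtlas X).tangent = selfAtlas (X × X) := by
  have h : tangentChart (selfAtlas X) ⟨univ, id⟩ = ⟨univ, id⟩ := by
    have h2 : (fun p : X × X => (p.1, chartDeriv ((selfAtlas X).chartAt p.1) ⟨univ, id⟩
        (id : X → X) p.1 p.2)) = id :=
      funext fun p => Prod.ext rfl (chartDeriv_id_self (selfAtlas_isMfd X) rfl (mem_univ _) _)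
    unfold tangentChart
    simp only [id] at h2 ⊢
    rw [h2]
    rfl
  have h3 : (selfAtlas X).tangent = ⟨(selfAtlas X).tangent.top, tangentChart (selfAtlas X) ''
    {⟨univ, id⟩}, fun _ => tangentChart (selfAtlas X) ⟨univ, id⟩⟩ := rfl
  have h4 : (selfAtlas X).tangent.top = instTopologicalSpaceProd := by
    refine Eq.trans ?_ (TopologicalSpace.generateFrom_setOfPred_isOpen _)
    show TopologicalSpace.generateFrom _ = _
    congr 1
    ext W
    constructor
    · rintro ⟨_, rfl, O, hO, rfl⟩
      rw [h]
      simpa using hO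
    · intro hW
      refine ⟨_, rfl, W, hW, ?_⟩
      rw [h]
      simp
  rw [h3, h4, h, image_singleton, h]
  rfl

lemma mSmoothOn_selfAtlas {f : X → Y} {S : Set X} (hS : IsOpen S) (hf : IsSmoothOn S f) :
    MSmoothOn (selfAtlas X) (selfAtlas Y) f S := by
  refine mSmoothOn_of_local (selfAtlas_isMfd X) (selfAtlas_isMfd Y) hS fun x hx =>
    ⟨_, rfl, _, rfl, S, hS, hx, subset_univ _, mapsTo_univ _ _, ?_⟩
  simp only [id, image_id']
  refine hf.congr fun y _ => ?_
  exact (rep_apply (c := (⟨univ, id⟩ : LCChart X X)) (c' := (⟨univ, id⟩ : LCChart Y Y))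
    (injOn_id _) _ (mem_univ y)).symm

/-! Products -/

/-- The product of two charts. -/
def LCChart.prod (b : LCChart Y N) (d : LCChart Z Q) : LCChart (Y × Z) (N × Q) :=
  ⟨b.source ×ˢ d.source, Prod.map b.toFun d.toFun⟩

lemma LCChart.prod_mem (hb : b ∈ B.atlas) (hd : d ∈ C.atlas) : b.prod d ∈ (B.prod C).atlas :=
  ⟨b, hb, d, hd, rfl⟩

lemma LCChart.prod_injOn (hb : InjOn b.toFun b.source) (hd : InjOn d.toFun d.source) :
    InjOn (b.prod d).toFun (b.prod d).source := fun _ hp _ hq h =>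
  Prod.ext (hb hp.1 hq.1 (congrArg Prod.fst h)) (hd hp.2 hq.2 (congrArg Prod.snd h))

lemma LCChart.prod_image (S : Set N) (T : Set Q) :
    (b.prod d).toFun '' (S ×ˢ T) = (b.toFun '' S) ×ˢ (d.toFun '' T) :=
  prodMap_image_prod _ _ _ _

lemma LCAtlas.IsMfd.prod (hB : B.IsMfd) (hC : C.IsMfd) : (B.prod C).IsMfd where
  isOpen_preimage := by
    rintro _ ⟨b, hb, d, hd, rfl⟩ O hO
    let := B.top
    let := C.top
    refine isOpen_iff_forall_mem_open.2 fun p hp => ?_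
    obtain ⟨O1, O2, h1, h2, h3, h4, h5⟩ := isOpen_prod_iff.1 hO _ _ hp.2
    refine ⟨_, ?_, (hB.isOpen_preimage b hb O1 h1).prod (hC.isOpen_preimage d hd O2 h2),
      ⟨hp.1.1, h3⟩, hp.1.2, h4⟩
    exact fun q hq => ⟨⟨hq.1.1, hq.2.1⟩, h5 ⟨hq.1.2, hq.2.2⟩⟩
  exists_open := by
    rintro _ ⟨b, hb, d, hd, rfl⟩ W hW
    let := B.top
    let := C.top
    -- The union of all open boxes whose pullback lies in `W`; taking all of them avoids choosing
    -- one for each point.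
    refine ⟨⋃ O ∈ {O : Set Y × Set Z | IsOpen O.1 ∧ IsOpen O.2 ∧
      (b.source ∩ b.toFun ⁻¹' O.1) ×ˢ (d.source ∩ d.toFun ⁻¹' O.2) ⊆ W}, O.1 ×ˢ O.2,
      isOpen_biUnion fun O hO => hO.1.prod hO.2.1, ?_⟩
    ext ⟨x, y⟩
    refine and_congr_right fun hp => ⟨fun hpW => ?_, fun hpW => ?_⟩
    · obtain ⟨U1, U2, h1, h2, h3, h4, h5⟩ := isOpen_prod_iff.1 hW _ _ hpW
      obtain ⟨O1, hO1, e1⟩ := hB.exists_open b hb U1 h1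
      obtain ⟨O2, hO2, e2⟩ := hC.exists_open d hd U2 h2
      refine mem_iUnion₂.2 ⟨(O1, O2), ⟨hO1, hO2, ?_⟩, (e1.subset ⟨hp.1, h3⟩).2,
        (e2.subset ⟨hp.2, h4⟩).2⟩
      rw [← e1, ← e2]
      exact fun q hq => h5 ⟨hq.1.2, hq.2.2⟩
    · obtain ⟨O, ⟨-, -, h⟩, hm⟩ := mem_iUnion₂.1 hpW
      exact h ⟨⟨hp.1, hm.1⟩, hp.2, hm.2⟩
  injOn := by
    rintro _ ⟨b, hb, d, hd, rfl⟩
    exact LCChart.prod_injOn (hB.injOn b hb) (hC.injOn d hd)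
  good := by
    rintro _ ⟨b, hb, d, hd, rfl⟩
    rw [prodMap_image_prod]
    exact (hB.good b hb).prod (hC.good d hd)
  smooth := by
    rintro _ ⟨b, hb, d, hd, rfl⟩ _ ⟨b', hb', d', hd', rfl⟩
    simp only [prod_inter_prod]
    rw [prodMap_image_prod]
    let := B.top
    let := C.top
    have g1 := hB.good_image hb ((hB.isOpen_source hb).inter (hB.isOpen_source hb'))
      inter_subset_left
    have g2 := hC.good_image hd ((hC.isOpen_source hd).inter (hC.isOpen_source hd'))
      inter_subset_left
    have s1 := (hB.smooth b hb b' hb').comp (g1.prod g2) g1 (.linear _ (.fst ℝ Y Z))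
      fun q hq => hq.1
    have s2 := (hC.smooth d hd d' hd').comp (g1.prod g2) g2 (.linear _ (.snd ℝ Y Z))
      fun q hq => hq.2
    refine (s1.prodMk s2).congr ?_
    rintro ⟨_, _⟩ ⟨⟨x, hx, rfl⟩, ⟨y, hy, rfl⟩⟩
    refine Eq.trans ?_ (rep_apply (c := b.prod d) (c' := b'.prod d')
      (LCChart.prod_injOn (hB.injOn b hb) (hC.injOn d hd)) (id : N × Q → N × Q)
      (x := (x, y)) ⟨hx.1, hy.1⟩).symm
    exact Prod.ext (rep_apply (hB.injOn b hb) _ hx.1) (rep_apply (hC.injOn d hd) _ hy.1)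
  chartAt_mem p := LCChart.prod_mem (hB.chartAt_mem _) (hC.chartAt_mem _)
  mem_chartAt p := ⟨hB.mem_chartAt _, hC.mem_chartAt _⟩

lemma rep_fst (hB : B.IsMfd) (hC : C.IsMfd) (hb : b ∈ B.atlas) (hd : d ∈ C.atlas) {S : Set (N × Q)}
    (hS : S ⊆ (b.prod d).source) :
    EqOn (ContinuousLinearMap.fst ℝ Y Z) (rep (b.prod d) b Prod.fst) ((b.prod d).toFun '' S) := by
  rintro _ ⟨p, hp, rfl⟩
  rw [rep_apply (LCChart.prod_injOn (hB.injOn b hb) (hC.injOn d hd)) _ (hS hp)]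
  rfl

lemma rep_snd (hB : B.IsMfd) (hC : C.IsMfd) (hb : b ∈ B.atlas) (hd : d ∈ C.atlas) {S : Set (N × Q)}
    (hS : S ⊆ (b.prod d).source) :
    EqOn (ContinuousLinearMap.snd ℝ Y Z) (rep (b.prod d) d Prod.snd) ((b.prod d).toFun '' S) := by
  rintro _ ⟨p, hp, rfl⟩
  rw [rep_apply (LCChart.prod_injOn (hB.injOn b hb) (hC.injOn d hd)) _ (hS hp)]
  rfl

lemma mSmooth_fst (hB : B.IsMfd) (hC : C.IsMfd) : MSmooth (B.prod C) B (Prod.fst : N × Q → N) := by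
  let := B.top
  let := C.top
  refine mSmoothOn_of_local (hB.prod hC) hB (@isOpen_univ _ (B.prod C).top) fun p _ => ?_
  have hb := hB.chartAt_mem p.1
  have hd := hC.chartAt_mem p.2
  exact ⟨_, LCChart.prod_mem hb hd, _, hb, _,
    (hB.prod hC).isOpen_source (LCChart.prod_mem hb hd), ⟨hB.mem_chartAt _, hC.mem_chartAt _⟩,
    Subset.rfl, fun q hq => hq.1, (IsSmoothOn.linear _ _).congr (rep_fst hB hC hb hd Subset.rfl)⟩

lemma mSmooth_snd (hB : B.IsMfd) (hC : C.IsMfd) : MSmooth (B.prod C) C (Prod.snd : N × Q → Q) := by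
  let := B.top
  let := C.top
  refine mSmoothOn_of_local (hB.prod hC) hC (@isOpen_univ _ (B.prod C).top) fun p _ => ?_
  have hb := hB.chartAt_mem p.1
  have hd := hC.chartAt_mem p.2
  exact ⟨_, LCChart.prod_mem hb hd, _, hd, _,
    (hB.prod hC).isOpen_source (LCChart.prod_mem hb hd), ⟨hB.mem_chartAt _, hC.mem_chartAt _⟩,
    Subset.rfl, fun q hq => hq.2, (IsSmoothOn.linear _ _).congr (rep_snd hB hC hb hd Subset.rfl)⟩

lemma chartDeriv_fst (hB : B.IsMfd) (hC : C.IsMfd) (hb : b ∈ B.atlas) (hd : d ∈ C.atlas) {p : N × Q}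
    (h1 : p.1 ∈ b.source) (h2 : p.2 ∈ d.source) (v : Y × Z) :
    chartDeriv (b.prod d) b Prod.fst p v = v.1 := by
  have hbd := LCChart.prod_mem hb hd
  rw [chartDeriv_eq_differential' (hB.prod hC) hbd ((hB.prod hC).isOpen_source hbd) Subset.rfl
    (fun q hq => hq.1) ⟨h1, h2⟩, ← differential_congr (rep_fst hB hC hb hd Subset.rfl)]
  exact differential_linear ((hB.prod hC).good _ hbd) (.fst ℝ Y Z) ⟨p, ⟨h1, h2⟩, rfl⟩ v

lemma chartDeriv_snd (hB : B.IsMfd) (hC : C.IsMfd) (hb : b ∈ B.atlas) (hd : d ∈ C.atlas) {p : N × Q}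
    (h1 : p.1 ∈ b.source) (h2 : p.2 ∈ d.source) (v : Y × Z) :
    chartDeriv (b.prod d) d Prod.snd p v = v.2 := by
  have hbd := LCChart.prod_mem hb hd
  rw [chartDeriv_eq_differential' (hB.prod hC) hbd ((hB.prod hC).isOpen_source hbd) Subset.rfl
    (fun q hq => hq.2) ⟨h1, h2⟩, ← differential_congr (rep_snd hB hC hb hd Subset.rfl)]
  exact differential_linear ((hB.prod hC).good _ hbd) (.snd ℝ Y Z) ⟨p, ⟨h1, h2⟩, rfl⟩ v

lemma rep_prodMk (hA : A.IsMfd) (hc : c ∈ A.atlas) (f : M → N) (g : M → Q) {S : Set M}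
    (hS : S ⊆ c.source) : EqOn (fun x => (rep c b f x, rep c d g x))
      (rep c (b.prod d) fun x => (f x, g x)) (c.toFun '' S) := by
  rintro _ ⟨x, hx, rfl⟩
  rw [rep_apply (hA.injOn c hc) _ (hS hx)]
  exact Prod.ext (rep_apply (hA.injOn c hc) _ (hS hx)) (rep_apply (hA.injOn c hc) _ (hS hx))

lemma exists_isOpen_mapsTo_charts (hA : A.IsMfd) (hB : B.IsMfd) (hC : C.IsMfd)
    (hU : IsOpen[A.top] U) (hf : MSmoothOn A B f U) (hg : MSmoothOn A C g U) (hc : c ∈ A.atlas)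
    (hb : b ∈ B.atlas) (hd : d ∈ C.atlas) {x : M} (hxU : x ∈ U) (hxc : x ∈ c.source)
    (hxb : f x ∈ b.source) (hxd : g x ∈ d.source) : ∃ T, IsOpen[A.top] T ∧ x ∈ T ∧ T ⊆ c.source ∧
      T ⊆ U ∧ MapsTo f T b.source ∧ MapsTo g T d.source := by
  let := A.top
  refine ⟨c.source ∩ ((U ∩ f ⁻¹' b.source) ∩ (U ∩ g ⁻¹' d.source)), (hA.isOpen_source hc).inter
    ((hf.isOpen_inter_preimage hU (hB.isOpen_source hb)).inter
    (hg.isOpen_inter_preimage hU (hC.isOpen_source hd))), ⟨hxc, ⟨hxU, hxb⟩, hxU, hxd⟩,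
    inter_subset_left, fun y hy => hy.2.1.1, fun y hy => hy.2.1.2, fun y hy => hy.2.2.2⟩

lemma MSmoothOn.prodMk (hA : A.IsMfd) (hB : B.IsMfd) (hC : C.IsMfd) (hU : IsOpen[A.top] U)
    (hf : MSmoothOn A B f U) (hg : MSmoothOn A C g U) :
    MSmoothOn A (B.prod C) (fun x => (f x, g x)) U := by
  refine mSmoothOn_of_local hA (hB.prod hC) hU fun x hx => ?_
  have hc := hA.chartAt_mem x
  have hb := hB.chartAt_mem (f x)
  have hd := hC.chartAt_mem (g x)
  obtain ⟨T, h1, h2, h3, h4, h5, h6⟩ := exists_isOpen_mapsTo_charts hA hB hC hU hf hg hc hb hd hx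
    (hA.mem_chartAt _) (hB.mem_chartAt _) (hC.mem_chartAt _)
  exact ⟨_, hc, _, LCChart.prod_mem hb hd, T, h1, h2, h3, fun y hy => ⟨h5 hy, h6 hy⟩,
    ((hf.rep_smooth hc hb h3 h4 h5).prodMk (hg.rep_smooth hc hd h3 h4 h6)).congr
      (rep_prodMk hA hc f g h3)⟩

lemma chartDeriv_prodMk (hA : A.IsMfd) (hB : B.IsMfd) (hC : C.IsMfd) (hU : IsOpen[A.top] U)
    (hf : MSmoothOn A B f U) (hg : MSmoothOn A C g U) (hc : c ∈ A.atlas)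
    (hb : b ∈ B.atlas) (hd : d ∈ C.atlas) {x : M} (hxU : x ∈ U) (hxc : x ∈ c.source)
    (hxb : f x ∈ b.source) (hxd : g x ∈ d.source) (v : X) :
    chartDeriv c (b.prod d) (fun x => (f x, g x)) x v =
      (chartDeriv c b f x v, chartDeriv c d g x v) := by
  obtain ⟨T, h1, h2, h3, h4, h5, h6⟩ := exists_isOpen_mapsTo_charts hA hB hC hU hf hg hc hb hd hxU
    hxc hxb hxd
  rw [chartDeriv_eq_differential' (c' := b.prod d) (f := fun x => (f x, g x)) hA hc h1 h3
      (fun y hy => ⟨h5 hy, h6 hy⟩) h2,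
    chartDeriv_eq_differential' hA hc h1 h3 h5 h2, chartDeriv_eq_differential' hA hc h1 h3 h6 h2,
    ← differential_congr (rep_prodMk hA hc f g h3),
    differential_prodMk (hA.good_image hc h1 h3) (hf.rep_smooth hc hb h3 h4 h5)
      (hg.rep_smooth hc hd h3 h4 h6) ⟨x, h2, rfl⟩]

lemma mSmooth_const (hA : A.IsMfd) (hB : B.IsMfd) (y : N) : MSmooth A B (fun _ : M => y) := by
  refine mSmoothOn_of_local hA hB (@isOpen_univ _ A.top) fun x _ => ⟨_, hA.chartAt_mem x, _,
    hB.chartAt_mem y, _, hA.isOpen_source (hA.chartAt_mem x), hA.mem_chartAt x, Subset.rfl,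
    fun _ _ => hB.mem_chartAt y, ?_⟩
  refine (IsSmoothOn.const _ ((B.chartAt y).toFun y)).congr ?_
  rintro _ ⟨z, hz, rfl⟩
  rw [rep_apply (hA.injOn _ (hA.chartAt_mem x)) _ hz]

lemma chartDeriv_const (hA : A.IsMfd) (hc : c ∈ A.atlas) {x : M} (hx : x ∈ c.source) {y : N}
    (hy : y ∈ b.source) (v : X) : chartDeriv c b (fun _ : M => y) x v = 0 := by
  rw [chartDeriv_eq_differential' hA hc (hA.isOpen_source hc) Subset.rfl (fun _ _ => hy) hx,
    ← differential_congr (f := fun _ => b.toFun y), differential_const (hA.good c hc) _ ⟨x, hx, rfl⟩]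
  rintro _ ⟨z, hz, rfl⟩
  rw [rep_apply (hA.injOn _ hc) _ hz]

/-- The canonical map `TN × TQ → T(N × Q)`. -/
def tangentShuffle (p : (N × Y) × (Q × Z)) : (N × Q) × (Y × Z) :=
  ((p.1.1, p.2.1), (p.1.2, p.2.2))

lemma chartDeriv_prod_id (hB : B.IsMfd) (hC : C.IsMfd) {b' : LCChart Y N} {d' : LCChart Z Q}
    (hb : b ∈ B.atlas) (hb' : b' ∈ B.atlas) (hd : d ∈ C.atlas) (hd' : d' ∈ C.atlas) {p : N × Q}
    (h1 : p.1 ∈ b.source) (h1' : p.1 ∈ b'.source) (h2 : p.2 ∈ d.source) (h2' : p.2 ∈ d'.source)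
    (v : Y × Z) : chartDeriv (b.prod d) (b'.prod d') id p v =
      (chartDeriv b b' id p.1 v.1, chartDeriv d d' id p.2 v.2) := by
  have hbd := LCChart.prod_mem hb hd
  have o1 := @isOpen_univ _ B.top
  have o2 := @isOpen_univ _ C.top
  have o3 := @isOpen_univ _ (B.prod C).top
  refine (chartDeriv_prodMk (hB.prod hC) hB hC o3 (mSmooth_fst hB hC) (mSmooth_snd hB hC) hbd hb' hd'
    (mem_univ p) ⟨h1, h2⟩ h1' h2' v).trans (Prod.ext ?_ ?_)
  · refine (chartDeriv_comp (hB.prod hC) hB hB o3 o1 (mSmooth_id hB) (mSmooth_fst hB hC) hbd hb hb'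
      (mem_univ p) (mem_univ _) ⟨h1, h2⟩ h1 h1' v).trans ?_
    rw [chartDeriv_fst hB hC hb hd h1 h2]
  · refine (chartDeriv_comp (hB.prod hC) hC hC o3 o2 (mSmooth_id hC) (mSmooth_snd hB hC) hbd hd hd'
      (mem_univ p) (mem_univ _) ⟨h1, h2⟩ h2 h2' v).trans ?_
    rw [chartDeriv_snd hB hC hb hd h1 h2]

/-- TN × TQ and T(N × Q) are different types, and the canonical map is only a permutation of
coordinates in charts. It is needed in the inductive step for jets of pairs. -/
lemma tangentShuffle_mSmooth (hB : B.IsMfd) (hC : C.IsMfd) :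
    MSmooth (B.tangent.prod C.tangent) (B.prod C).tangent
      (tangentShuffle : (N × Y) × (Q × Z) → (N × Q) × (Y × Z)) := by
  have hT := hB.tangent.prod hC.tangent
  refine mSmoothOn_of_local hT (hB.prod hC).tangent (@isOpen_univ _ (B.tangent.prod C.tangent).top)
    fun p _ => ?_
  have hb := hB.chartAt_mem p.1.1
  have hd := hC.chartAt_mem p.2.1
  have hTb : tangentChart B (B.chartAt p.1.1) ∈ B.tangent.atlas := ⟨_, hb, rfl⟩
  have hTd : tangentChart C (C.chartAt p.2.1) ∈ C.tangent.atlas := ⟨_, hd, rfl⟩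
  have hbd := LCChart.prod_mem hTb hTd
  refine ⟨_, hbd, _, ⟨_, LCChart.prod_mem hb hd, rfl⟩, _, hT.isOpen_source hbd,
    ⟨hB.mem_chartAt _, hC.mem_chartAt _⟩, Subset.rfl, fun q hq => hq, ?_⟩
  let L : (Y × Y) × (Z × Z) →L[ℝ] (Y × Z) × (Y × Z) :=
    (((ContinuousLinearMap.fst ℝ Y Y).prodMap (.fst ℝ Z Z))).prod
      (((ContinuousLinearMap.snd ℝ Y Y).prodMap (.snd ℝ Z Z)))
  refine (IsSmoothOn.linear _ L).congr ?_
  rintro _ ⟨q, hq, rfl⟩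
  rw [rep_apply (hT.injOn _ hbd) _ hq]
  exact Prod.ext rfl (chartDeriv_prod_id hB hC (hB.chartAt_mem _) hb (hC.chartAt_mem _) hd
    (p := (q.1.1, q.2.1)) (hB.mem_chartAt _) hq.1 (hC.mem_chartAt _) hq.2 (q.1.2, q.2.2)).symm

lemma tangentMap_prodMk (hA : A.IsMfd) (hB : B.IsMfd) (hC : C.IsMfd) (hU : IsOpen[A.top] U)
    (hf : MSmoothOn A B f U) (hg : MSmoothOn A C g U) {p : M × X} (hp : p.1 ∈ U) :
    tangentMap A (B.prod C) (fun x => (f x, g x)) p =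
      tangentShuffle (tangentMap A B f p, tangentMap A C g p) :=
  Prod.ext rfl (chartDeriv_prodMk hA hB hC hU hf hg (hA.chartAt_mem _) (hB.chartAt_mem _)
    (hC.chartAt_mem _) hp (hA.mem_chartAt _) (hB.mem_chartAt _) (hC.mem_chartAt _) _)

/-! Open submanifolds -/

/-- The restriction of a chart. -/
def LCChart.restrict (c : LCChart X M) (U : Set M) : LCChart X U :=
  ⟨Subtype.val ⁻¹' c.source, fun x => c.toFun x⟩

lemma LCChart.restrict_mem (hc : c ∈ A.atlas) (U : Set M) : c.restrict U ∈ (A.restrict U).atlas :=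
  ⟨c, hc, rfl⟩

lemma LCChart.restrict_injOn (hc : InjOn c.toFun c.source) (U : Set M) :
    InjOn (c.restrict U).toFun (c.restrict U).source :=
  fun _ hx _ hy h => Subtype.ext (hc hx hy h)

lemma LCChart.restrict_image (U : Set M) (T : Set M) :
    (c.restrict U).toFun '' (Subtype.val ⁻¹' T) = c.toFun '' (T ∩ U) := by
  ext y
  constructor
  · rintro ⟨x, hx, rfl⟩
    exact ⟨x, ⟨hx, x.2⟩, rfl⟩
  · rintro ⟨x, hx, rfl⟩
    exact ⟨⟨x, hx.2⟩, hx.1, rfl⟩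

lemma LCAtlas.IsMfd.restrict (hA : A.IsMfd) (hU : IsOpen[A.top] U) : (A.restrict U).IsMfd where
  isOpen_preimage := by
    rintro _ ⟨c, hc, rfl⟩ O hO
    exact ⟨_, hA.isOpen_preimage c hc O hO, rfl⟩
  exists_open := by
    rintro _ ⟨c, hc, rfl⟩ _ ⟨W, hW, rfl⟩
    obtain ⟨O, hO, h⟩ := hA.exists_open c hc W hW
    exact ⟨O, hO, congrArg (fun S => (Subtype.val ⁻¹' S : Set U)) h⟩
  injOn := by
    rintro _ ⟨c, hc, rfl⟩
    exact LCChart.restrict_injOn (hA.injOn c hc) U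
  good := by
    rintro _ ⟨c, hc, rfl⟩
    let := A.top
    have h := LCChart.restrict_image (c := c) U c.source
    refine h ▸ hA.good_image hc ((hA.isOpen_source hc).inter hU) inter_subset_left
  smooth := by
    rintro _ ⟨c, hc, rfl⟩ _ ⟨c', hc', rfl⟩
    have h := LCChart.restrict_image (c := c) U (c.source ∩ c'.source)
    have h2 : IsSmoothOn ((c.restrict U).toFun '' (Subtype.val ⁻¹' (c.source ∩ c'.source)))
        (rep c c' (id : M → M)) := by
      rw [h]
      exact hA.smooth.rep_smooth hc hc' (fun x hx => hx.1.1) fun x hx => hx.1.2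
    refine h2.congr ?_
    rintro _ ⟨x, hx, rfl⟩
    exact (rep_apply (hA.injOn c hc) _ hx.1).trans (rep_apply (c := c.restrict U)
      (c' := c'.restrict U) (LCChart.restrict_injOn (hA.injOn c hc) U) id hx.1).symm
  chartAt_mem x := ⟨_, hA.chartAt_mem _, rfl⟩
  mem_chartAt x := hA.mem_chartAt _

/-- In a chart of the ambient manifold and its restriction, such a map is represented by the
identity. Its values outside `U` play no role. -/
lemma mSmoothOn_retraction (hA : A.IsMfd) (hU : IsOpen[A.top] U) {r : M → U}
    (hr : ∀ x ∈ U, (r x : M) = x) : MSmoothOn A (A.restrict U) r U := by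
  let := A.top
  have hR := hA.restrict hU
  refine mSmoothOn_of_local hA hR hU fun x hx => ?_
  have hc := hA.chartAt_mem x
  have hc' := LCChart.restrict_mem hc U
  refine ⟨_, hc, _, hc', _, (hA.isOpen_source hc).inter hU, ⟨hA.mem_chartAt x, hx⟩,
    inter_subset_left, ?_, ?_⟩
  · intro y hy
    show (r y : M) ∈ (A.chartAt x).source
    rw [hr y hy.2]
    exact hy.1
  · refine (IsSmoothOn.linear _ (.id ℝ X)).congr ?_
    rintro _ ⟨y, hy, rfl⟩
    rw [rep_apply (hA.injOn _ hc) _ hy.1]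
    exact congrArg (A.chartAt x).toFun (hr y hy.2).symm

/-! Charted spaces -/

/-- Chart images are the traces of open sets on the convex set `range ι`, hence of the form required
by the calculus. Everything topological is inherited from the partial homeomorphisms and the
embedding. -/
lemma ofCharted_isMfd {H : Type*} [TopologicalSpace H] {ι : H → X} {M : Type*} [TopologicalSpace M]
    [ChartedSpace H M] (hι : Topology.IsEmbedding ι) (hconv : Convex ℝ (range ι))
    (hint : (interior (range ι)).Nonempty) (hs : SmoothAtlas (ofCharted ι M)) :
    (ofCharted ι M).IsMfd where
  isOpen_preimage := by
    rintro _ ⟨e, he, rfl⟩ O hO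
    exact e.isOpen_inter_preimage (hO.preimage hι.continuous)
  exists_open := by
    rintro _ ⟨e, he, rfl⟩ U hU
    have hU : IsOpen U := hU
    obtain ⟨O, hO, h⟩ := hι.isOpen_iff.1 (e.isOpen_image_source_inter hU)
    refine ⟨O, hO, ?_⟩
    ext x
    refine and_congr_right fun hx => ?_
    have h2 := Set.ext_iff.1 h (e x)
    refine Iff.trans ?_ h2.symm
    constructor
    · exact fun hxU => ⟨x, ⟨hx, hxU⟩, rfl⟩
    · rintro ⟨y, hy, hxy⟩
      rw [← e.injOn hy.1 hx hxy]
      exact hy.2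
  injOn := by
    rintro _ ⟨e, he, rfl⟩
    exact fun x hx y hy h => e.injOn hx hy (hι.injective h)
  good := by
    rintro _ ⟨e, he, rfl⟩
    obtain ⟨O, hO, h⟩ := hι.isOpen_iff.1 e.open_target
    refine ⟨O, range ι, hO, hconv, hint, ?_⟩
    have : (fun x => ι (e x)) '' e.source = ι '' e.target := by
      rw [← e.image_source_eq_target, image_image]
    show (fun x => ι (e x)) '' e.source = _
    rw [this, ← h, image_preimage_eq_inter_range]
  smooth := hs
  chartAt_mem x := ⟨_, chart_mem_atlas H x, rfl⟩
  mem_chartAt x := mem_chart_source H x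

end Examples

/-! ### The concrete model spaces: quadrant, E, and their product -/

section Model

lemma quadrant_convex (n : ℕ) :
    Convex ℝ (range (Subtype.val : EuclideanQuadrant n → EuclideanSpace ℝ (Fin n))) := by
  have h : range (Subtype.val : EuclideanQuadrant n → EuclideanSpace ℝ (Fin n)) =
      {x | ∀ i, 0 ≤ x i} := Subtype.range_val
  rw [h]
  intro x hx y hy a b ha hb _ i
  simpa using add_nonneg (mul_nonneg ha (hx i)) (mul_nonneg hb (hy i))

lemma quadrant_interior (n : ℕ) : (interior
    (range (Subtype.val : EuclideanQuadrant n → EuclideanSpace ℝ (Fin n)))).Nonempty := by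
  have h : range (Subtype.val : EuclideanQuadrant n → EuclideanSpace ℝ (Fin n)) =
      {x | ∀ i, 0 ≤ x i} := Subtype.range_val
  refine ⟨WithLp.toLp 2 fun _ => 1, mem_interior.2 ⟨{x | ∀ i, 0 < x i}, ?_, ?_, by simp⟩⟩
  · rw [h]
    exact fun x hx i => (hx i).le
  · simp only [ofPred_forall]
    exact isOpen_iInter_of_finite fun i => isOpen_lt continuous_const (by fun_prop)

variable {n : ℕ} {E : Type u} [AddCommGroup E] [Module ℝ E] [TopologicalSpace E] [LCS E]

lemma cornerAtlas_isMfd {M : Type u} [TopologicalSpace M] [ChartedSpace (EuclideanQuadrant n) M]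
    (h : SmoothAtlas (cornerAtlas n M)) : (cornerAtlas n M).IsMfd :=
  ofCharted_isMfd Topology.IsEmbedding.subtypeVal (quadrant_convex n) (quadrant_interior n) h

lemma groupAtlas_isMfd {K : Type u} [Group K] [TopologicalSpace K] [ChartedSpace E K]
    (h : SmoothAtlas (groupAtlas E K)) : (groupAtlas E K).IsMfd :=
  ofCharted_isMfd Topology.IsEmbedding.id (by rw [range_id]; exact convex_univ) (by simp) h

lemma totalAtlas_isMfd {P : Type u} [TopologicalSpace P] [ChartedSpace (EuclideanQuadrant n × E) P]
    (h : SmoothAtlas (totalAtlas n E P)) : (totalAtlas n E P).IsMfd := by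
  have hr : range (fun x : EuclideanQuadrant n × E => (x.1.1, x.2)) =
      range (Subtype.val : EuclideanQuadrant n → EuclideanSpace ℝ (Fin n)) ×ˢ (univ : Set E) := by
    rw [← range_id (α := E), ← range_prodMap]
    rfl
  refine ofCharted_isMfd (Topology.IsEmbedding.subtypeVal.prodMap Topology.IsEmbedding.id) ?_ ?_ h
  · rw [hr]
    exact (quadrant_convex n).prod convex_univ
  · rw [hr, interior_prod_eq]
    exact (quadrant_interior n).prod (by simp)

end Model

universe u₁ v₁ u₂ v₂ u₃ v₃

/-! ### Continuity of families of maps in the C^∞-topology -/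

section Jets

variable {T : Type*} [TopologicalSpace T]

/-- Continuity of the family `F` of maps with respect to the topology of compact convergence of
the `k`-jets on the subset `U`. -/
def JetCont : ℕ → ∀ {X : Type v₁} {M : Type (max u₁ v₁)} {Y : Type v₂} {N : Type (max u₂ v₂)}
    [AddCommGroup X] [Module ℝ X] [TopologicalSpace X]
    [AddCommGroup Y] [Module ℝ Y] [TopologicalSpace Y],
    LCAtlas X M → LCAtlas Y N → Set M → (T → M → N) → Prop
  | 0, _, M, _, _, _, _, _, _, _, _, A, B, U, F => ∀ C ⊆ U, @IsCompact M A.top C →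
      ∀ W, IsOpen[B.top] W → IsOpen {t | MapsTo (F t) C W}
  | k + 1, _, _, _, _, _, _, _, _, _, _, A, B, U, F =>
      JetCont k A.tangent B.tangent (U ×ˢ univ) fun t => tangentMap A B (F t)

variable {X : Type v₁} {M : Type (max u₁ v₁)} {Y : Type v₂} {N : Type (max u₂ v₂)}
  {Z : Type v₃} {Q : Type (max u₃ v₃)}
  [AddCommGroup X] [Module ℝ X] [TopologicalSpace X]
  [AddCommGroup Y] [Module ℝ Y] [TopologicalSpace Y]
  [AddCommGroup Z] [Module ℝ Z] [TopologicalSpace Z]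
  {A : LCAtlas X M} {B : LCAtlas Y N} {C : LCAtlas Z Q} {U : Set M} {V : Set N}
  {F : T → M → N} {k : ℕ}

/-- For the whole source the recursion in `JetCont` is the universal property of the recursively
induced topology. The version on a subset exists so that continuity can be checked on an open cover.
-/
lemma continuous_jetTop_iff : Continuous[_, jetTop.{u₁, v₁, v₂, u₂} k A B] F ↔
    JetCont.{u₁, v₁, u₂, v₂} k A B univ F := by
  induction k generalizing X M Y N with
  | zero =>
    refine continuous_generateFrom_iff.trans ⟨fun h C _ hC W hW => h _ ⟨C, W, hC, hW, rfl⟩, ?_⟩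
    rintro h _ ⟨C, W, hC, hW, rfl⟩
    exact h C (subset_univ _) hC W hW
  | succ k ih =>
    refine continuous_induced_rng.trans (ih.trans ?_)
    rw [JetCont, univ_prod_univ]
    rfl

lemma continuous_smoothMap_iff {F : T → SmoothMap.{u₁, v₁, v₂, u₂} A B} : Continuous F ↔
    ∀ k, JetCont.{u₁, v₁, u₂, v₂} k A B univ fun t => (F t).1 := by
  refine continuous_induced_rng.trans (continuous_iInf_rng.trans (forall_congr' fun k => ?_))
  exact continuous_jetTop_iff

lemma JetCont.mono (h : JetCont.{u₁, v₁, u₂, v₂} k A B U F) {U' : Set M} (hU : U' ⊆ U) :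
    JetCont.{u₁, v₁, u₂, v₂} k A B U' F := by
  induction k generalizing X M Y N with
  | zero => exact fun C hC => h C (hC.trans hU)
  | succ k ih => exact ih (U := U ×ˢ univ) h (prod_mono hU Subset.rfl)

lemma JetCont.comp_continuous {T' : Type*} [TopologicalSpace T'] {φ : T' → T} (hφ : Continuous φ)
    (h : JetCont.{u₁, v₁, u₂, v₂} k A B U F) :
    JetCont.{u₁, v₁, u₂, v₂} k A B U fun t => F (φ t) := by
  induction k generalizing X M Y N with
  | zero => exact fun C hC hc W hW => (h C hC hc W hW).preimage hφ
  | succ k ih => exact ih (F := fun t => tangentMap A B (F t)) h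

lemma jetCont_const (f : M → N) : JetCont.{u₁, v₁, u₂, v₂} k A B U fun _ : T => f := by
  induction k generalizing X M Y N with
  | zero => exact fun _ _ _ _ _ => isOpen_const
  | succ k ih => exact ih _

variable [LCS X] [LCS Y] [LCS Z]

lemma JetCont.congr (hA : A.IsMfd) (hU : IsOpen[A.top] U)
    (h : JetCont.{u₁, v₁, u₂, v₂} k A B U F) {G : T → M → N} (hFG : ∀ t, EqOn (F t) (G t) U) :
    JetCont.{u₁, v₁, u₂, v₂} k A B U G := by
  induction k generalizing X M Y N with
  | zero =>
    intro C hC hc W hW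
    have : {t | MapsTo (G t) C W} = {t | MapsTo (F t) C W} :=
      ext fun t => ((hFG t).mono hC).mapsTo_iff.symm
    rw [this]
    exact h C hC hc W hW
  | succ k ih =>
    exact ih hA.tangent (isOpen_tangent hA hU) h fun t p hp => tangentMap_congr hA hU (hFG t) hp.1

/-- For zero-jets, F(C) after `f` is F on the compact set f(C); higher jets follow from T(F ∘ f) =
TF ∘ Tf. -/
lemma JetCont.precomp (hA : A.IsMfd) (hB : B.IsMfd) (hC : C.IsMfd) (hU : IsOpen[A.top] U)
    (hV : IsOpen[B.top] V) {F : T → N → Q} {f : M → N} (hf : MSmoothOn A B f U) (hUV : MapsTo f U V)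
    (hF : ∀ t, MSmoothOn B C (F t) V) (h : JetCont.{u₂, v₂, u₃, v₃} k B C V F) :
    JetCont.{u₁, v₁, u₃, v₃} k A C U fun t => F t ∘ f := by
  induction k generalizing X M Y N Z Q with
  | zero =>
    intro S hS hSc W hW
    have h1 : @IsCompact N B.top (f '' S) := by
      let := A.top
      let := B.top
      exact hSc.image_of_continuousOn (ContinuousOn.mono hf.1 hS)
    simpa only [mapsTo_image_iff] using h (f '' S) (hUV.mono_left hS).image_subset h1 W hW
  | succ k ih =>
    have h1 := ih hA.tangent hB.tangent hC.tangent (isOpen_tangent hA hU) (isOpen_tangent hB hV)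
      (hf.tangentMap hA hB hU) (fun p hp => ⟨hUV hp.1, mem_univ _⟩)
      (fun t => (hF t).tangentMap hB hC hV) h
    exact h1.congr hA.tangent (isOpen_tangent hA hU) fun t p hp =>
      (tangentMap_comp hA hB hC hU hV (hF t) hf hp.1 (hUV hp.1)).symm

/-- For zero-jets, the condition that g ∘ F maps C into W says that F maps C into the open set V ∩
g⁻¹(W); higher jets follow from functoriality of T. -/
lemma JetCont.postcomp (hA : A.IsMfd) (hB : B.IsMfd) (hC : C.IsMfd) (hU : IsOpen[A.top] U)
    (hV : IsOpen[B.top] V) {g : N → Q} (hg : MSmoothOn B C g V) (hF : ∀ t, MSmoothOn A B (F t) U)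
    (hUV : ∀ t, MapsTo (F t) U V) (h : JetCont.{u₁, v₁, u₂, v₂} k A B U F) :
    JetCont.{u₁, v₁, u₃, v₃} k A C U fun t => g ∘ F t := by
  induction k generalizing X M Y N Z Q with
  | zero =>
    intro S hS hSc W hW
    convert h S hS hSc _ (hg.isOpen_inter_preimage hV hW) using 3 with t
    exact ⟨fun h x hx => ⟨hUV t (hS hx), h hx⟩, fun h x hx => (h hx).2⟩
  | succ k ih =>
    have h1 := ih hA.tangent hB.tangent hC.tangent (isOpen_tangent hA hU) (isOpen_tangent hB hV)
      (hg.tangentMap hB hC hV) (fun t => (hF t).tangentMap hA hB hU)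
      (fun t p hp => ⟨hUV t hp.1, mem_univ _⟩) h
    exact h1.congr hA.tangent (isOpen_tangent hA hU) fun t p hp =>
      (tangentMap_comp hA hB hC hU hV hg (hF t) hp.1 (hUV t hp.1)).symm

/-- A compact set mapped into an open subset of the product is split into finitely many compact
pieces, each mapped into a box inside that subset. The splitting uses that the source is Hausdorff.
-/
lemma JetCont.prodMk (hA : A.IsMfd) (hB : B.IsMfd) (hC : C.IsMfd) (hA2 : @T2Space M A.top)
    (hU : IsOpen[A.top] U) {G : T → M → Q} (hF : ∀ t, MSmoothOn A B (F t) U)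
    (hG : ∀ t, MSmoothOn A C (G t) U) (h : JetCont.{u₁, v₁, u₂, v₂} k A B U F)
    (h' : JetCont.{u₁, v₁, u₃, v₃} k A C U G) :
    JetCont.{u₁, v₁, max u₂ u₃, max v₂ v₃} k A (B.prod C) U fun t x => (F t x, G t x) := by
  induction k generalizing X M Y N Z Q with
  | zero =>
    intro S hS hSc W hW
    let := A.top
    let := B.top
    let := C.top
    have hS' : IsCompact S := hSc
    refine isOpen_iff_mem_nhds.2 fun t ht => ?_
    have hW : IsOpen W := hW
    have hloc : ∀ x ∈ S, ∃ O : Set M, IsOpen O ∧ x ∈ O ∧ ∃ W1 W2, IsOpen W1 ∧ IsOpen W2 ∧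
        W1 ×ˢ W2 ⊆ W ∧ MapsTo (F t) O W1 ∧ MapsTo (G t) O W2 := by
      intro x hx
      obtain ⟨W1, W2, h1, h2, h3, h4, h5⟩ := isOpen_prod_iff.1 hW _ _ (ht hx)
      exact ⟨_, ((hF t).isOpen_inter_preimage hU h1).inter ((hG t).isOpen_inter_preimage hU h2),
        ⟨⟨hS hx, h3⟩, hS hx, h4⟩, W1, W2, h1, h2, h5, fun y hy => hy.1.2, fun y hy => hy.2.2⟩
    choose! O hO hxO W1 W2 hW1 hW2 hWW hFO hGO using hloc
    obtain ⟨s, hsS, hs⟩ := hS'.elim_nhds_subcover O fun x hx => (hO x hx).mem_nhds (hxO x hx)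
    obtain ⟨K, hK1, hK2, hK3⟩ := hS'.finite_compact_cover s O (fun x hx => hO x (hsS x hx)) hs
    have hKS : ∀ x ∈ s, K x ⊆ S := fun x hx y hy => hK3 ▸ mem_biUnion hx hy
    have h1 : ∀ x ∈ s, {t | MapsTo (F t) (K x) (W1 x) ∧ MapsTo (G t) (K x) (W2 x)} ∈ 𝓝 t :=
      fun x hx => IsOpen.mem_nhds
        (IsOpen.inter (h _ ((hKS x hx).trans hS) (hK1 x) _ (hW1 x (hsS x hx)))
          (h' _ ((hKS x hx).trans hS) (hK1 x) _ (hW2 x (hsS x hx))))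
        ⟨(hFO x (hsS x hx)).mono_left (hK2 x), (hGO x (hsS x hx)).mono_left (hK2 x)⟩
    filter_upwards [(biInter_finset_mem s).2 h1] with t' ht' y hy
    rw [hK3] at hy
    obtain ⟨x, hx, hy⟩ := mem_iUnion₂.1 hy
    have h2 := mem_iInter₂.1 ht' x hx
    exact hWW x (hsS x hx) ⟨h2.1 hy, h2.2 hy⟩
  | succ k ih =>
    have h1 := ih hA.tangent hB.tangent hC.tangent (tangent_t2 hA hA2) (isOpen_tangent hA hU)
      (fun t => (hF t).tangentMap hA hB hU) (fun t => (hG t).tangentMap hA hC hU) h h'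
    -- The induction hypothesis concerns pairs of tangent maps; the shuffle turns them into the
    -- tangent map of the pair.
    have h2 := JetCont.postcomp.{u₁, v₁, max u₂ u₃, max v₂ v₃, max u₂ u₃, max v₂ v₃, _} hA.tangent
      (hB.tangent.prod hC.tangent) (hB.prod hC).tangent
      (isOpen_tangent hA hU) (@isOpen_univ _ (B.tangent.prod C.tangent).top)
      (tangentShuffle_mSmooth hB hC)
      (fun t => ((hF t).tangentMap hA hB hU).prodMk hA.tangent hB.tangent hC.tangent
        (isOpen_tangent hA hU) ((hG t).tangentMap hA hC hU)) (fun t => mapsTo_univ _ _) h1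
    exact JetCont.congr.{u₁, v₁, max u₂ u₃, max v₂ v₃, _} hA.tangent (isOpen_tangent hA hU) h2
      fun t p hp => (tangentMap_prodMk hA hB hC hU (hF t) (hG t) hp.1).symm

/-- A compact set covered by the `U i` is a finite union of compact sets each contained in one `U
i`, so convergence on compacta of the union is convergence on compacta of the members. -/
lemma JetCont.iUnion (hA : A.IsMfd) (hA2 : @T2Space M A.top) {ι : Type*} {U : ι → Set M}
    (hU : ∀ i, IsOpen[A.top] (U i)) (h : ∀ i, JetCont.{u₁, v₁, u₂, v₂} k A B (U i) F) :
    JetCont.{u₁, v₁, u₂, v₂} k A B (⋃ i, U i) F := by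
  induction k generalizing X M Y N with
  | zero =>
    intro S hS hSc W hW
    let := A.top
    have hS' : IsCompact S := hSc
    obtain ⟨s, hs⟩ := hS'.elim_finite_subcover U hU hS
    obtain ⟨K, hK1, hK2, hK3⟩ := hS'.finite_compact_cover s U (fun i _ => hU i) hs
    have h1 : {t | MapsTo (F t) S W} = ⋂ i ∈ s, {t | MapsTo (F t) (K i) W} := by
      ext t
      simp only [mem_iInter, hK3]
      exact ⟨fun h i hi x hx => h (mem_biUnion hi hx), fun h x hx =>
        let ⟨i, hi, hx⟩ := mem_iUnion₂.1 hx
        h i hi hx⟩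
    rw [h1]
    exact isOpen_biInter_finset fun i _ => h i _ (hK2 i) (hK1 i) W hW
  | succ k ih =>
    have h1 := ih hA.tangent (tangent_t2 hA hA2) (fun i => isOpen_tangent hA (hU i)) h
    rw [← iUnion_prod_const] at h1
    exact h1

end Jets

/-! ### Spaces of smooth vector-valued functions -/

section VectorValued

variable {X : Type v₁} {M : Type (max u₁ v₁)} {Y : Type v₂} {Z : Type v₃}
  [AddCommGroup X] [Module ℝ X] [TopologicalSpace X]
  [AddCommGroup Y] [Module ℝ Y] [TopologicalSpace Y]
  [AddCommGroup Z] [Module ℝ Z] [TopologicalSpace Z] [LCS X] [LCS Y] [LCS Z]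
  {A : LCAtlas X M}

lemma selfAtlas_prod : (selfAtlas Y).prod (selfAtlas Z) = selfAtlas (Y × Z) := by
  have h1 : (⟨univ ×ˢ univ, Prod.map id id⟩ : LCChart (Y × Z) (Y × Z)) = ⟨univ, id⟩ := by
    rw [univ_prod_univ, Prod.map_id]
  have h2 : ((selfAtlas Y).prod (selfAtlas Z)).atlas = {⟨univ, id⟩} := by
    rw [← h1]
    ext c
    constructor
    · rintro ⟨_, rfl, _, rfl, rfl⟩
      rfl
    · rintro rfl
      exact ⟨_, rfl, _, rfl, rfl⟩
  have h3 : (selfAtlas Y).prod (selfAtlas Z) = ⟨instTopologicalSpaceProd,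
    ((selfAtlas Y).prod (selfAtlas Z)).atlas, fun _ => ⟨univ ×ˢ univ, Prod.map id id⟩⟩ := rfl
  rw [h3, h2, h1]
  rfl

lemma tangentMap_linear (L : Y →L[ℝ] Z) (p : Y × Y) :
    tangentMap (selfAtlas Y) (selfAtlas Z) L p = (L p.1, L p.2) := by
  refine Prod.ext rfl ?_
  show chartDeriv ⟨univ, id⟩ ⟨univ, id⟩ L p.1 p.2 = L p.2
  rw [chartDeriv_eq_differential' (selfAtlas_isMfd Y) rfl (@isOpen_univ _ (selfAtlas Y).top)
    (subset_univ _) (mapsTo_univ _ _) (mem_univ p.1), ← differential_congr (f := L)]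
  · exact differential_linear ((selfAtlas_isMfd Y).good _ rfl) L ⟨p.1, mem_univ _, rfl⟩ _
  · rintro _ ⟨x, hx, rfl⟩
    exact (rep_apply (c := (⟨univ, id⟩ : LCChart Y Y)) (c' := (⟨univ, id⟩ : LCChart Z Z))
      (injOn_id _) L hx).symm

lemma MSmooth.linear_comp (hA : A.IsMfd) (L : Y →L[ℝ] Z) {f : M → Y}
    (hf : MSmooth A (selfAtlas Y) f) : MSmooth A (selfAtlas Z) (L ∘ f) :=
  MSmoothOn.comp hA (selfAtlas_isMfd Y) (selfAtlas_isMfd Z) (@isOpen_univ _ A.top) isOpen_univ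
    (mSmoothOn_selfAtlas isOpen_univ (.linear _ L)) hf (mapsTo_univ _ _)

lemma MSmooth.pair (hA : A.IsMfd) {f : M → Y} {g : M → Z} (hf : MSmooth A (selfAtlas Y) f)
    (hg : MSmooth A (selfAtlas Z) g) : MSmooth A (selfAtlas (Y × Z)) fun x => (f x, g x) := by
  rw [← selfAtlas_prod]
  exact MSmoothOn.prodMk hA (selfAtlas_isMfd Y) (selfAtlas_isMfd Z) (@isOpen_univ _ A.top) hf hg

lemma tangentMap_linear_comp (hA : A.IsMfd) (L : Y →L[ℝ] Z) {f : M → Y}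
    (hf : MSmooth A (selfAtlas Y) f) (p : M × X) : tangentMap A (selfAtlas Z) (L ∘ f) p =
      (L (tangentMap A (selfAtlas Y) f p).1, L (tangentMap A (selfAtlas Y) f p).2) := by
  rw [tangentMap_comp hA (selfAtlas_isMfd Y) (selfAtlas_isMfd Z) (@isOpen_univ _ A.top) isOpen_univ
    (mSmoothOn_selfAtlas isOpen_univ (.linear _ L)) hf (mem_univ _) (mem_univ _), tangentMap_linear]

lemma tangentMap_pair (hA : A.IsMfd) {f : M → Y} {g : M → Z} (hf : MSmooth A (selfAtlas Y) f)
    (hg : MSmooth A (selfAtlas Z) g) (p : M × X) :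
    tangentMap A (selfAtlas (Y × Z)) (fun x => (f x, g x)) p =
      tangentShuffle (tangentMap A (selfAtlas Y) f p, tangentMap A (selfAtlas Z) g p) := by
  rw [← selfAtlas_prod]
  exact tangentMap_prodMk hA (selfAtlas_isMfd Y) (selfAtlas_isMfd Z) (@isOpen_univ _ A.top) hf hg
    (mem_univ _)

variable (Y) in
/-- The space of smooth functions with values in a locally convex space. -/
def smoothSubmodule (hA : A.IsMfd) : Submodule ℝ (M → Y) where
  carrier := {f | MSmooth A (selfAtlas Y) f}
  add_mem' {f g} hf hg := by
    have h : MSmooth A (selfAtlas Y) (f + g) :=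
      (MSmooth.pair hA hf hg).linear_comp hA
        (ContinuousLinearMap.fst ℝ Y Y + ContinuousLinearMap.snd ℝ Y Y)
    exact h
  zero_mem' := mSmooth_const hA (selfAtlas_isMfd Y) 0
  smul_mem' r f hf := by
    have h : MSmooth A (selfAtlas Y) (r • f) := MSmooth.linear_comp hA (r • ContinuousLinearMap.id ℝ Y) hf
    exact h

variable (Y) in
/-- The tangent map as a linear map between spaces of smooth functions. -/
noncomputable def smoothTangent (hA : A.IsMfd) : smoothSubmodule Y hA →ₗ[ℝ] smoothSubmodule (Y × Y) hA.tangent where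
  toFun f := ⟨tangentMap A (selfAtlas Y) f.1, by
    have h := MSmoothOn.tangentMap hA (selfAtlas_isMfd Y) (@isOpen_univ _ A.top) f.2
    rw [selfAtlas_tangent, univ_prod_univ] at h
    exact h⟩
  map_add' f g := by
    refine Subtype.ext (funext fun p => ?_)
    refine (tangentMap_linear_comp hA
      (ContinuousLinearMap.fst ℝ Y Y + ContinuousLinearMap.snd ℝ Y Y) (MSmooth.pair hA f.2 g.2) p).trans ?_
    rw [tangentMap_pair hA f.2 g.2]
    rfl
  map_smul' r f := by
    refine Subtype.ext (funext fun p => ?_)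
    exact tangentMap_linear_comp hA (r • ContinuousLinearMap.id ℝ Y) f.2 p

/-- Locally convex vector space topologies, possibly non-Hausdorff. -/
def IsLCTop (V : Type*) [AddCommGroup V] [Module ℝ V] (t : TopologicalSpace V) : Prop :=
  @IsTopologicalAddGroup V t _ ∧ @ContinuousSMul ℝ V _ _ t ∧ @LocallyConvexSpace ℝ V _ _ _ _ t

lemma IsLCTop.induced {V W : Type*} [AddCommGroup V] [Module ℝ V] [AddCommGroup W] [Module ℝ W]
    {t : TopologicalSpace W} (h : IsLCTop W t) (φ : V →ₗ[ℝ] W) : IsLCTop V (t.induced φ) := by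
  obtain ⟨h1, h2, h3⟩ := h
  exact ⟨topologicalAddGroup_induced φ, continuousSMul_induced φ, .induced φ⟩

lemma IsLCTop.iInf {V ι : Type*} [AddCommGroup V] [Module ℝ V] {t : ι → TopologicalSpace V}
    (h : ∀ i, IsLCTop V (t i)) : IsLCTop V (⨅ i, t i) :=
  ⟨topologicalAddGroup_iInf fun i => (h i).1, continuousSMul_iInf fun i => (h i).2.1,
    have := fun i => (h i).1
    have := fun i => (h i).2.1
    .iInf fun i => (h i).2.2⟩

/-- The subbasis is the one of the compact-open topology on C(M, Y), which is already known to be a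
locally convex vector topology. -/
lemma induced_compactOpenTop_isLCTop (hA : A.IsMfd) : IsLCTop (smoothSubmodule Y hA)
    (TopologicalSpace.induced Subtype.val (compactOpenTop A.top (selfAtlas Y).top)) := by
  let := A.top
  let φ : smoothSubmodule Y hA →ₗ[ℝ] C(M, Y) :=
    { toFun f := ⟨f.1, continuousOn_univ.1 f.2.1⟩
      map_add' _ _ := rfl
      map_smul' _ _ := rfl }
  have h : IsLCTop C(M, Y) ContinuousMap.compactOpen :=
    ⟨inferInstance, inferInstance, inferInstance⟩
  convert h.induced φ using 1
  rw [compactOpenTop, ContinuousMap.compactOpen, induced_generateFrom_eq, induced_generateFrom_eq]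
  congr 1
  ext S
  constructor
  · rintro ⟨_, ⟨C, W, hC, hW, rfl⟩, rfl⟩
    exact ⟨_, ⟨C, hC, W, hW, rfl⟩, rfl⟩
  · rintro ⟨_, ⟨C, hC, W, hW, rfl⟩, rfl⟩
    exact ⟨_, ⟨C, W, hC, hW, rfl⟩, rfl⟩

lemma induced_jetTop_isLCTop (k : ℕ) (hA : A.IsMfd) : IsLCTop (smoothSubmodule Y hA)
    (TopologicalSpace.induced Subtype.val (jetTop.{u₁, v₁, v₂, v₂} k A (selfAtlas Y))) := by
  induction k generalizing X M Y with
  | zero => exact induced_compactOpenTop_isLCTop hA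
  | succ k ih =>
    -- The order k + 1 topology is the order k topology for functions on TM with values in Y × Y,
    -- pulled back along the linear map f ↦ Tf.
    have h := (ih (Y := Y × Y) hA.tangent).induced (smoothTangent Y hA)
    rw [induced_compose, ← selfAtlas_tangent] at h
    rw [jetTop, induced_compose]
    exact h

lemma induced_smooth_isLCTop (hA : A.IsMfd) : IsLCTop (smoothSubmodule Y hA)
    (TopologicalSpace.induced Subtype.val
      (⨅ k : ℕ, jetTop.{u₁, v₁, v₂, v₂} k A (selfAtlas Y))) := by
  rw [induced_iInf]
  exact .iInf fun k => induced_jetTop_isLCTop k hA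

end VectorValued

/-! ### Partial derivatives and derivatives along the fibre -/

section Partial

variable {X : Type*} {Y : Type*} {Z : Type*}
  [AddCommGroup X] [Module ℝ X] [TopologicalSpace X]
  [AddCommGroup Y] [Module ℝ Y] [TopologicalSpace Y]
  [AddCommGroup Z] [Module ℝ Z] [TopologicalSpace Z] [LCS X] [LCS Y] [LCS Z]

lemma HasDiff.eq_of_eqOn {S : Set X} {f g : X → Y} {df dg : X × X → Y} (hS : Good S)
    (hf : HasDiff S f df) (hg : HasDiff S g dg) (h : EqOn f g S) {x : X} (hx : x ∈ S) (v : X) :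
    df (x, v) = dg (x, v) :=
  (hf.congr h fun _ _ => rfl).unique hS hg ⟨hx, mem_univ _⟩

/-- `df` is linear in the direction, so its difference quotients in that variable are constant. -/
lemma HasDiff.vertical {S : Set X} {f : X → Y} {df : X × X → Y} {ddf : (X × X) × (X × X) → Y}
    (hS : Good S) (hf : HasDiff S f df) (hdf : HasDiff (S ×ˢ univ) df ddf) {x : X}
    (hx : x ∈ interior S) (v w : X) : ddf ((x, v), (0, w)) = df (x, w) := by
  have h1 := hdf.lim (x, v) (by rw [interior_prod_eq]; exact ⟨hx, by simp⟩) (0, w)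
  obtain ⟨L, hL⟩ := hf.exists_linear hS (interior_subset hx)
  refine tendsto_nhds_unique h1 (tendsto_const_nhds.congr' ?_)
  filter_upwards [self_mem_nhdsWithin] with t ht
  simp [← hL, inv_smul_smul₀ (show t ≠ 0 from ht)]

variable {M N Q : Type*} {A : LCAtlas X M} {B : LCAtlas Y N} {C : LCAtlas Z Q}
  {c : LCChart X M} {b : LCChart Y N} {d : LCChart Z Q}

/-- The chain rule for the smooth inclusion y ↦ (x, y), whose derivative is v ↦ (0, v). -/
lemma chartDeriv_partial_right (hA : A.IsMfd) (hB : B.IsMfd) (hC : C.IsMfd) {G : M × N → Q}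
    (hG : MSmooth (A.prod B) C G) (hc : c ∈ A.atlas) (hb : b ∈ B.atlas) (hd : d ∈ C.atlas)
    {x : M} {y : N} (hx : x ∈ c.source) (hy : y ∈ b.source) (hxy : G (x, y) ∈ d.source) (v : Y) :
    chartDeriv b d (fun y => G (x, y)) y v = chartDeriv (c.prod b) d G (x, y) (0, v) := by
  have o := @isOpen_univ _ B.top
  have s := MSmoothOn.prodMk hB hA hB o (mSmooth_const hB hA x) (mSmooth_id hB)
  refine (chartDeriv_comp hB (hA.prod hB) hC o (@isOpen_univ _ (A.prod B).top) hG s hb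
    (LCChart.prod_mem hc hb) hd (mem_univ y) (mem_univ _) hy ⟨hx, hy⟩ hxy v).trans ?_
  congr 1
  refine (chartDeriv_prodMk hB hA hB o (mSmooth_const hB hA x) (mSmooth_id hB) hb hc hb (mem_univ y)
    hy hx hy v).trans ?_
  rw [chartDeriv_const hB hb hy hx, chartDeriv_id_self hB hb hy]

lemma chartDeriv_partial_left (hA : A.IsMfd) (hB : B.IsMfd) (hC : C.IsMfd) {G : M × N → Q}
    (hG : MSmooth (A.prod B) C G) (hc : c ∈ A.atlas) (hb : b ∈ B.atlas) (hd : d ∈ C.atlas)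
    {x : M} {y : N} (hx : x ∈ c.source) (hy : y ∈ b.source) (hxy : G (x, y) ∈ d.source) (v : X) :
    chartDeriv c d (fun x => G (x, y)) x v = chartDeriv (c.prod b) d G (x, y) (v, 0) := by
  have o := @isOpen_univ _ A.top
  have s := MSmoothOn.prodMk hA hA hB o (mSmooth_id hA) (mSmooth_const hA hB y)
  refine (chartDeriv_comp hA (hA.prod hB) hC o (@isOpen_univ _ (A.prod B).top) hG s hc
    (LCChart.prod_mem hc hb) hd (mem_univ x) (mem_univ _) hx ⟨hx, hy⟩ hxy v).trans ?_
  congr 1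
  refine (chartDeriv_prodMk hA hA hB o (mSmooth_id hA) (mSmooth_const hA hB y) hc hc hb (mem_univ x)
    hx hx hy v).trans ?_
  rw [chartDeriv_const hA hc hx hy, chartDeriv_id_self hA hc hx]

end Partial

/-! ### Lie groups -/

section LieGroup

variable {E : Type u} [AddCommGroup E] [Module ℝ E] [TopologicalSpace E] [LCS E]
  {K : Type u} [Group K] [TopologicalSpace K] [ChartedSpace E K]

namespace IsLCLieGroup

variable (hK : IsLCLieGroup E K)
include hK

lemma isMfd : (groupAtlas E K).IsMfd := groupAtlas_isMfd hK.smoothAtlas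

lemma isTopologicalGroup : IsTopologicalGroup K where
  continuous_mul := continuousOn_univ.1 hK.smooth_mul.1
  continuous_inv := continuousOn_univ.1 hK.smooth_inv.1

/-- Charts into the Hausdorff space E are injective, so K is T0, and a T0 topological group is
Hausdorff. -/
lemma t2Space : T2Space K := by
  have := hK.isTopologicalGroup
  have : T0Space K := by
    refine (t0Space_iff_inseparable K).2 fun x y hxy => ?_
    have hc := hK.isMfd.chartAt_mem x
    have hx := hK.isMfd.mem_chartAt x
    have hy := (hxy.mem_open_iff (hK.isMfd.isOpen_source hc)).1 hx
    by_contra hne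
    obtain ⟨O, O', h1, h2, h3, h4, h5⟩ := t2_separation fun h => hne (hK.isMfd.injOn _ hc hx hy h)
    have := (hxy.mem_open_iff (hK.isMfd.isOpen_preimage _ hc O h1)).1 ⟨hx, h3⟩
    exact disjoint_left.1 h5 this.2 h4
  infer_instance

variable {X M : Type*} [AddCommGroup X] [Module ℝ X] [TopologicalSpace X] [LCS X]
  {A : LCAtlas X M} {f g : M → K} {U : Set M}

lemma mSmoothOn_mul (hA : A.IsMfd) (hU : IsOpen[A.top] U) (hf : MSmoothOn A (groupAtlas E K) f U)
    (hg : MSmoothOn A (groupAtlas E K) g U) :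
    MSmoothOn A (groupAtlas E K) (fun x => f x * g x) U :=
  MSmoothOn.comp hA (hK.isMfd.prod hK.isMfd) hK.isMfd hU
    (@isOpen_univ _ ((groupAtlas E K).prod (groupAtlas E K)).top) hK.smooth_mul
    (hf.prodMk hA hK.isMfd hK.isMfd hU hg) (mapsTo_univ _ _)

lemma mSmoothOn_inv (hA : A.IsMfd) (hU : IsOpen[A.top] U) (hf : MSmoothOn A (groupAtlas E K) f U) :
    MSmoothOn A (groupAtlas E K) (fun x => (f x)⁻¹) U :=
  MSmoothOn.comp hA hK.isMfd hK.isMfd hU (@isOpen_univ _ (groupAtlas E K).top) hK.smooth_inv hf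
    (mapsTo_univ _ _)

lemma mSmooth_conj₂ : MSmooth ((groupAtlas E K).prod (groupAtlas E K)) (groupAtlas E K)
    (fun p : K × K => p.1 * p.2 * p.1⁻¹) := by
  have h := hK.isMfd
  have o := @isOpen_univ _ ((groupAtlas E K).prod (groupAtlas E K)).top
  exact hK.mSmoothOn_mul (h.prod h) o
    (hK.mSmoothOn_mul (h.prod h) o (mSmooth_fst h h) (mSmooth_snd h h))
    (hK.mSmoothOn_inv (h.prod h) o (mSmooth_fst h h))

lemma mSmooth_conj (k : K) : MSmooth (groupAtlas E K) (groupAtlas E K)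
    (fun g : K => k * g * k⁻¹) := by
  have h := hK.isMfd
  have o := @isOpen_univ _ (groupAtlas E K).top
  exact hK.mSmoothOn_mul h o (hK.mSmoothOn_mul h o (mSmooth_const h h k) (mSmooth_id h))
    (mSmooth_const h h _)

lemma mSmooth_mul_left (k : K) : MSmooth (groupAtlas E K) (groupAtlas E K)
    (fun g : K => k * g) := by
  have h := hK.isMfd
  have o := @isOpen_univ _ (groupAtlas E K).top
  exact hK.mSmoothOn_mul h o (mSmooth_const h h k) (mSmooth_id h)

lemma mSmooth_mul_right (k : K) : MSmooth (groupAtlas E K) (groupAtlas E K)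
    (fun g : K => g * k) := by
  have h := hK.isMfd
  have o := @isOpen_univ _ (groupAtlas E K).top
  exact hK.mSmoothOn_mul h o (mSmooth_id h) (mSmooth_const h h k)

omit hK

variable (E K) in
/-- The preferred chart at the identity. -/
noncomputable def oneChart : LCChart E K := (groupAtlas E K).chartAt 1

include hK

lemma oneChart_mem : oneChart E K ∈ (groupAtlas E K).atlas := hK.isMfd.chartAt_mem 1

lemma one_mem : (1 : K) ∈ (oneChart E K).source := hK.isMfd.mem_chartAt 1

lemma isOpen_image (U : Set K) (hU : IsOpen U) (h : U ⊆ (oneChart E K).source) :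
    IsOpen ((oneChart E K).toFun '' U) :=
  (chartAt E (1 : K)).isOpen_image_of_subset_source hU h

omit hK in
-- Conjugation fixes 1, so the preferred chart at the image point is again the chart at 1.
lemma Ad_eq (k : K) (x : E) :
    Ad K k x = chartDeriv (oneChart E K) (oneChart E K) (fun g : K => k * g * k⁻¹) 1 x := by
  have h : (groupAtlas E K).chartAt (k * 1 * k⁻¹) = oneChart E K := by
    rw [mul_one, mul_inv_cancel]
    rfl
  unfold Ad tangentMap
  simp only [h]
  rfl

lemma exists_Ad_linear (k : K) : ∃ L : E →L[ℝ] E, ∀ x, L x = Ad K k x := by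
  obtain ⟨L, hL⟩ := chartDeriv_exists_linear hK.isMfd hK.isMfd (@isOpen_univ _ (groupAtlas E K).top)
    (hK.mSmooth_conj k) hK.oneChart_mem hK.oneChart_mem (mem_univ 1) hK.one_mem
    (by simpa using hK.one_mem)
  exact ⟨L, fun x => by rw [hL, Ad_eq]⟩

lemma Ad_add (k : K) (x y : E) : Ad K k (x + y) = Ad K k x + Ad K k y := by
  obtain ⟨L, hL⟩ := hK.exists_Ad_linear k
  simp only [← hL, map_add]

lemma Ad_sub (k : K) (x y : E) : Ad K k (x - y) = Ad K k x - Ad K k y := by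
  obtain ⟨L, hL⟩ := hK.exists_Ad_linear k
  simp only [← hL, map_sub]

lemma Ad_smul (k : K) (r : ℝ) (x : E) : Ad K k (r • x) = r • Ad K k x := by
  obtain ⟨L, hL⟩ := hK.exists_Ad_linear k
  simp only [← hL, map_smul]

lemma Ad_one (x : E) : Ad K 1 x = x := by
  have : (fun g : K => 1 * g * 1⁻¹) = id := by
    funext g
    simp
  rw [Ad_eq, this, chartDeriv_id_self hK.isMfd hK.oneChart_mem hK.one_mem]

lemma Ad_mul (k l : K) (x : E) : Ad K (k * l) x = Ad K k (Ad K l x) := by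
  have h : (fun g : K => k * l * g * (k * l)⁻¹) = (fun g => k * g * k⁻¹) ∘ fun g => l * g * l⁻¹ := by
    funext g
    simp [mul_assoc]
  have h1 : l * 1 * l⁻¹ = 1 := by simp
  have o := @isOpen_univ _ (groupAtlas E K).top
  rw [Ad_eq, Ad_eq, Ad_eq, h, chartDeriv_comp hK.isMfd hK.isMfd hK.isMfd o o (hK.mSmooth_conj k)
    (hK.mSmooth_conj l) hK.oneChart_mem hK.oneChart_mem hK.oneChart_mem (mem_univ _) (mem_univ _)
    hK.one_mem (by rw [h1]; exact hK.one_mem) (by rw [h1]; simpa using hK.one_mem), h1]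

lemma Ad_inv_Ad (k : K) (x : E) : Ad K k⁻¹ (Ad K k x) = x := by
  rw [← hK.Ad_mul, inv_mul_cancel, hK.Ad_one]

lemma Ad_Ad_inv (k : K) (x : E) : Ad K k (Ad K k⁻¹ x) = x := by
  rw [← hK.Ad_mul, mul_inv_cancel, hK.Ad_one]

/-- The adjoint action is smooth. -/
lemma mSmooth_Ad : MSmooth ((groupAtlas E K).prod (selfAtlas E)) (selfAtlas E)
    (fun p : K × E => Ad K p.1 p.2) := by
  have hG := hK.isMfd
  have hGG := hG.prod hG
  have hE := selfAtlas_isMfd E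
  have hGE := hG.prod hE
  have := hK.isTopologicalGroup
  refine mSmoothOn_of_local hGE hE (@isOpen_univ _ ((groupAtlas E K).prod (selfAtlas E)).top) ?_
  rintro ⟨k₀, x₀⟩ -
  set c := (groupAtlas E K).chartAt k₀
  have hc : c ∈ (groupAtlas E K).atlas := hG.chartAt_mem k₀
  set φ := oneChart E K
  have hφ := hK.oneChart_mem
  have hcφ := LCChart.prod_mem hc hφ
  have hself : (⟨univ, id⟩ : LCChart E E) ∈ (selfAtlas E).atlas := rfl
  have hcE := LCChart.prod_mem hc hself
  set T : Set (K × K) := (c.prod φ).source ∩ (univ ∩ (fun p : K × K => p.1 * p.2 * p.1⁻¹) ⁻¹' φ.source)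
  have hT : IsOpen[((groupAtlas E K).prod (groupAtlas E K)).top] T :=
    IsOpen.inter (hGG.isOpen_source hcφ) (hK.mSmooth_conj₂.isOpen_inter_preimage
      (@isOpen_univ _ ((groupAtlas E K).prod (groupAtlas E K)).top) (hG.isOpen_source hφ))
  have hm : ∀ k ∈ c.source, (k, (1 : K)) ∈ T := fun k hk =>
    ⟨⟨hk, hK.one_mem⟩, mem_univ _, by simpa using hK.one_mem⟩
  refine ⟨_, hcE, _, hself, _, hGE.isOpen_source hcE, ⟨hG.mem_chartAt _, mem_univ _⟩, Subset.rfl,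
    mapsTo_univ _ _, ?_⟩
  have hTg := hGG.good_image hcφ hT inter_subset_left
  have hs : IsSmoothOn ((c.prod φ).toFun '' T) (rep (c.prod φ) φ fun p : K × K => p.1 * p.2 * p.1⁻¹) :=
    hK.mSmooth_conj₂.rep_smooth hcφ hφ inter_subset_left (subset_univ _) fun p hp => hp.2.2
  -- In the chart, Ad(k) x is the differential of (k, g) ↦ k g k⁻¹ at (k, 1) in direction (0, x);
  -- this is the smooth map inserting these arguments.
  have hj : IsSmoothOn ((c.prod ⟨univ, id⟩).toFun '' (c.prod (⟨univ, id⟩ : LCChart E E)).source)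
      (fun q : E × E => ((q.1, φ.toFun 1), ((0 : E), q.2))) :=
    ((IsSmoothOn.linear _ (.fst ℝ E E)).prodMk (.const _ _)).prodMk
      ((IsSmoothOn.const _ _).prodMk (.linear _ (.snd ℝ E E)))
  refine ((hs.differential hTg).comp (hGE.good _ hcE) hTg.prod_univ hj ?_).congr ?_
  · rintro _ ⟨q, hq, rfl⟩
    exact ⟨⟨_, hm _ hq.1, rfl⟩, mem_univ _⟩
  · rintro _ ⟨q, hq, rfl⟩
    rw [rep_apply (hGE.injOn _ hcE) _ hq]
    show _ = Ad K q.1 q.2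
    rw [Ad_eq, chartDeriv_partial_right (G := fun p : K × K => p.1 * p.2 * p.1⁻¹) hG hG hG
      hK.mSmooth_conj₂ hc hφ hφ hq.1 hK.one_mem (hm _ hq.1).2.2,
      chartDeriv_eq_differential' hGG hcφ hT inter_subset_left (fun p hp => hp.2.2) (hm _ hq.1)]
    rfl

/-! The multiplication in the chart at the identity -/

omit hK

variable (E K) in
/-- The pairs in the domain of the chart at `1` whose product is in this domain. -/
def mulDom : Set (K × K) := ((oneChart E K).prod (oneChart E K)).source ∩
  (univ ∩ (fun p : K × K => p.1 * p.2) ⁻¹' (oneChart E K).source)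

variable (E K) in
/-- The differential of the multiplication in the chart at `1`. -/
noncomputable def mulD : (E × E) × (E × E) → E :=
  differential (((oneChart E K).prod (oneChart E K)).toFun '' mulDom E K)
    (rep ((oneChart E K).prod (oneChart E K)) (oneChart E K) fun p : K × K => p.1 * p.2)

variable (E K) in
/-- The second differential of the multiplication in the chart at `1`. -/
noncomputable def mulDD : ((E × E) × (E × E)) × ((E × E) × (E × E)) → E :=
  differential ((((oneChart E K).prod (oneChart E K)).toFun '' mulDom E K) ×ˢ univ) (mulD E K)

variable (K) in
/-- The bilinear part of the multiplication in the chart at `1`. -/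
noncomputable def mulBilin (x y : E) : E :=
  mulDD E K ((((oneChart E K).toFun 1, (oneChart E K).toFun 1), (0, y)), ((x, 0), (0, 0)))

include hK

lemma isOpen_mulDom : IsOpen[((groupAtlas E K).prod (groupAtlas E K)).top] (mulDom E K) :=
  IsOpen.inter ((hK.isMfd.prod hK.isMfd).isOpen_source
    (LCChart.prod_mem hK.oneChart_mem hK.oneChart_mem)) (hK.smooth_mul.isOpen_inter_preimage
      (@isOpen_univ _ ((groupAtlas E K).prod (groupAtlas E K)).top)
      (hK.isMfd.isOpen_source hK.oneChart_mem))

lemma isOpen_image_mulDom :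
    IsOpen (((oneChart E K).prod (oneChart E K)).toFun '' mulDom E K) := by
  have hm := LCChart.prod_mem hK.oneChart_mem hK.oneChart_mem
  obtain ⟨O, hO, h, -⟩ := (hK.isMfd.prod hK.isMfd).exists_image_inter hm hK.isOpen_mulDom
  have h1 := h _ Subset.rfl
  rw [inter_eq_self_of_subset_right (show mulDom E K ⊆ _ from inter_subset_left)] at h1
  rw [h1]
  refine hO.inter ?_
  have h2 : IsOpen ((oneChart E K).toFun '' (oneChart E K).source) :=
    hK.isOpen_image _ (hK.isMfd.isOpen_source hK.oneChart_mem) Subset.rfl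
  exact (LCChart.prod_image (b := oneChart E K) (d := oneChart E K) _ _) ▸ h2.prod h2

lemma hasDiff_mul : HasDiff (((oneChart E K).prod (oneChart E K)).toFun '' mulDom E K)
    (rep ((oneChart E K).prod (oneChart E K)) (oneChart E K) fun p : K × K => p.1 * p.2)
    (mulD E K) :=
  (hK.smooth_mul.rep_smooth (LCChart.prod_mem hK.oneChart_mem hK.oneChart_mem) hK.oneChart_mem
    inter_subset_left (subset_univ _) fun _ hp => hp.2.2).hasDiff hK.isOpen_image_mulDom.good

lemma hasDiff_mulD : HasDiff ((((oneChart E K).prod (oneChart E K)).toFun '' mulDom E K) ×ˢ univ)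
    (mulD E K) (mulDD E K) :=
  ((hK.smooth_mul.rep_smooth (LCChart.prod_mem hK.oneChart_mem hK.oneChart_mem) hK.oneChart_mem
    inter_subset_left (subset_univ _) fun _ hp => hp.2.2).differential
    hK.isOpen_image_mulDom.good).hasDiff hK.isOpen_image_mulDom.good.prod_univ

lemma mem_mulDom_right {g : K} (hg : g ∈ (oneChart E K).source) : (g, (1 : K)) ∈ mulDom E K :=
  ⟨⟨hg, hK.one_mem⟩, mem_univ _, by simpa using hg⟩

lemma mem_mulDom_left {g : K} (hg : g ∈ (oneChart E K).source) : ((1 : K), g) ∈ mulDom E K :=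
  ⟨⟨hK.one_mem, hg⟩, mem_univ _, by simpa using hg⟩

lemma one_mem_image : ((oneChart E K).toFun 1, (oneChart E K).toFun 1) ∈
    ((oneChart E K).prod (oneChart E K)).toFun '' mulDom E K :=
  ⟨_, hK.mem_mulDom_right hK.one_mem, rfl⟩

/-- The field is a partial derivative of the multiplication at (g, 1), hence expressed by `mulD`,
which can be differentiated once more in g. -/
lemma leftField_eq {g : K} (hg : g ∈ (oneChart E K).source) (y : E) : leftField K y g =
    mulD E K (((oneChart E K).toFun g, (oneChart E K).toFun 1), (0, y)) := by
  have h := hK.isMfd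
  have hφ := hK.oneChart_mem
  refine (chartDeriv_partial_right (G := fun p : K × K => p.1 * p.2) h h h hK.smooth_mul hφ hφ hφ hg
    hK.one_mem (hK.mem_mulDom_right hg).2.2 y).trans ?_
  exact chartDeriv_eq_differential' (h.prod h) (LCChart.prod_mem hφ hφ) hK.isOpen_mulDom
    inter_subset_left (fun p hp => hp.2.2) (hK.mem_mulDom_right hg) _

lemma chartDeriv_mul_right {g : K} (hg : g ∈ (oneChart E K).source) (y : E) :
    chartDeriv (oneChart E K) (oneChart E K) (fun h => h * g) 1 y =
    mulD E K (((oneChart E K).toFun 1, (oneChart E K).toFun g), (y, 0)) := by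
  have h := hK.isMfd
  have hφ := hK.oneChart_mem
  refine (chartDeriv_partial_left (G := fun p : K × K => p.1 * p.2) h h h hK.smooth_mul hφ hφ hφ
    hK.one_mem hg (hK.mem_mulDom_left hg).2.2 y).trans ?_
  exact chartDeriv_eq_differential' (h.prod h) (LCChart.prod_mem hφ hφ) hK.isOpen_mulDom
    inter_subset_left (fun p hp => hp.2.2) (hK.mem_mulDom_left hg) _

lemma leftField_one (y : E) : leftField K y 1 = y := by
  have : (fun h : K => 1 * h) = id := funext one_mul
  unfold leftField
  rw [this]
  exact chartDeriv_id_self hK.isMfd hK.oneChart_mem hK.one_mem y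

/-- The left invariant vector fields in the chart at `1` and their derivatives. -/
lemma hasDiff_leftField (y : E) : HasDiff ((oneChart E K).toFun '' (oneChart E K).source)
    (fun u => mulD E K ((u, (oneChart E K).toFun 1), (0, y)))
    (fun p => mulDD E K (((p.1, (oneChart E K).toFun 1), (0, y)), ((p.2, 0), (0, 0)))) := by
  refine hK.hasDiff_mulD.comp hK.isOpen_image_mulDom.good.prod_univ
    (f := fun u => ((u, (oneChart E K).toFun 1), ((0 : E), y)))
    (df := fun p => ((p.2, 0), (0, 0))) ?_ ?_
  · exact ((HasDiff.linear _ (.id ℝ E)).prodMk (.const _ _)).prodMk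
      ((HasDiff.const _ _).prodMk (.const _ _))
  · rintro _ ⟨g, hg, rfl⟩
    exact ⟨⟨_, hK.mem_mulDom_right hg, rfl⟩, mem_univ _⟩

lemma isOpen_oneChart_image : IsOpen ((oneChart E K).toFun '' (oneChart E K).source) :=
  hK.isOpen_image _ (hK.isMfd.isOpen_source hK.oneChart_mem) Subset.rfl

lemma chartDeriv_leftField (x y : E) :
    chartDeriv (oneChart E K) ⟨univ, id⟩ (leftField K y) 1 x = mulBilin K x y := by
  have h := hK.isMfd
  have hφ := hK.oneChart_mem
  rw [chartDeriv_eq_differential' h hφ (h.isOpen_source hφ) Subset.rfl (mapsTo_univ _ _) hK.one_mem]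
  refine (((hK.hasDiff_leftField y).congr ?_ fun _ _ => rfl).differential_eq
    hK.isOpen_oneChart_image.good ⟨⟨_, hK.one_mem, rfl⟩, mem_univ _⟩).trans rfl
  rintro _ ⟨g, hg, rfl⟩
  exact (hK.leftField_eq hg y).symm.trans
    (rep_apply (c' := ⟨univ, id⟩) (h.injOn _ hφ) (leftField K y) hg).symm

/-- The derivative at 1 of the left invariant field of y along x is the mixed second derivative b(x,
y) of the multiplication. -/
lemma lieBr_eq (x y : E) : lieBr K x y = mulBilin K x y - mulBilin K y x := by
  rw [← hK.chartDeriv_leftField, ← hK.chartDeriv_leftField]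
  rfl

lemma mulDD_symm (v w : E × E) :
    mulDD E K ((((oneChart E K).toFun 1, (oneChart E K).toFun 1), v), (w, 0)) =
    mulDD E K ((((oneChart E K).toFun 1, (oneChart E K).toFun 1), w), (v, 0)) :=
  hK.hasDiff_mul.symmetric hK.hasDiff_mulD
    (by rw [hK.isOpen_image_mulDom.interior_eq]; exact hK.one_mem_image) v w

lemma exists_mulDD_linear (v : E × E) : ∃ L : (E × E) × (E × E) →L[ℝ] E, ∀ w, L w =
    mulDD E K ((((oneChart E K).toFun 1, (oneChart E K).toFun 1), v), w) :=
  hK.hasDiff_mulD.exists_linear hK.isOpen_image_mulDom.good.prod_univ ⟨hK.one_mem_image, mem_univ _⟩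

lemma exists_mulBilin_linear_left (y : E) : ∃ L : E →L[ℝ] E, ∀ x, L x = mulBilin K x y := by
  obtain ⟨L, hL⟩ := hK.exists_mulDD_linear (0, y)
  exact ⟨L.comp ((ContinuousLinearMap.inl ℝ (E × E) (E × E)).comp (.inl ℝ E E)), fun x => hL _⟩

/-- Linearity is built in only for the last direction of a second derivative; symmetry of second
derivatives exchanges the two directions. -/
lemma exists_mulBilin_linear_right (x : E) : ∃ L : E →L[ℝ] E, ∀ y, L y = mulBilin K x y := by
  obtain ⟨L, hL⟩ := hK.exists_mulDD_linear (x, 0)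
  exact ⟨L.comp ((ContinuousLinearMap.inl ℝ (E × E) (E × E)).comp (.inr ℝ E E)), fun y =>
    (hL _).trans (hK.mulDD_symm _ _)⟩

lemma continuous_mulBilin : Continuous fun p : E × E => mulBilin K p.1 p.2 := by
  refine continuousOn_univ.1 (hK.hasDiff_mulD.dcont.comp (f := fun p : E × E =>
    ((((oneChart E K).toFun 1, (oneChart E K).toFun 1), ((0 : E), p.2)),
      ((p.1, (0 : E)), ((0 : E), (0 : E))))) ?_ fun p _ => ?_)
  · exact Continuous.continuousOn (by fun_prop)
  · exact ⟨⟨hK.one_mem_image, mem_univ _⟩, mem_univ _⟩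

/-- The Lie bracket as a bilinear map. -/
lemma exists_lieBr_bilinear : ∃ β : E →ₗ[ℝ] E →ₗ[ℝ] E, ∀ x y, β x y = lieBr K x y := by
  refine ⟨LinearMap.mk₂ ℝ (lieBr K) ?_ ?_ ?_ ?_, fun x y => rfl⟩
  all_goals
    intros
    simp only [hK.lieBr_eq]
  · rename_i x x' y
    obtain ⟨L, hL⟩ := hK.exists_mulBilin_linear_left y
    obtain ⟨L', hL'⟩ := hK.exists_mulBilin_linear_right y
    simp only [← hL, ← hL', map_add]
    abel
  · rename_i r x y
    obtain ⟨L, hL⟩ := hK.exists_mulBilin_linear_left y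
    obtain ⟨L', hL'⟩ := hK.exists_mulBilin_linear_right y
    simp only [← hL, ← hL', map_smul, smul_sub]
  · rename_i y x x'
    obtain ⟨L, hL⟩ := hK.exists_mulBilin_linear_left y
    obtain ⟨L', hL'⟩ := hK.exists_mulBilin_linear_right y
    simp only [← hL, ← hL', map_add]
    abel
  · rename_i r y x
    obtain ⟨L, hL⟩ := hK.exists_mulBilin_linear_left y
    obtain ⟨L', hL'⟩ := hK.exists_mulBilin_linear_right y
    simp only [← hL, ← hL', map_smul, smul_sub]

lemma continuous_lieBr : Continuous fun p : E × E => lieBr K p.1 p.2 := by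
  simp only [hK.lieBr_eq]
  exact hK.continuous_mulBilin.sub (hK.continuous_mulBilin.comp continuous_swap)

/-- The adjoint action respects the Lie bracket. -/
lemma Ad_lieBr (k : K) (x y : E) : Ad K k (lieBr K x y) = lieBr K (Ad K k x) (Ad K k y) := by
  have h := hK.isMfd
  have hφ := hK.oneChart_mem
  have o := @isOpen_univ _ (groupAtlas E K).top
  set φ := oneChart E K with hφdef
  set c : K → K := fun g => k * g * k⁻¹ with hcdef
  have hc := hK.mSmooth_conj k
  have c1 : c 1 = 1 := by simp [hcdef]
  have hcm : ∀ g h, c (g * h) = c g * c h := fun g h => by simp [hcdef, mul_assoc]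
  set T : Set K := φ.source ∩ (univ ∩ c ⁻¹' φ.source)
  have hT : IsOpen[(groupAtlas E K).top] T := IsOpen.inter (h.isOpen_source hφ)
    (hc.isOpen_inter_preimage o (h.isOpen_source hφ))
  have h1T : (1 : K) ∈ T := ⟨hK.one_mem, mem_univ _, by
    show c 1 ∈ φ.source
    rw [c1]
    exact hK.one_mem⟩
  have hTs : T ⊆ φ.source := inter_subset_left
  have hΦo : IsOpen (φ.toFun '' T) := hK.isOpen_image _ hT hTs
  have hΦ : Good (φ.toFun '' T) := hΦo.good
  set γ := rep φ φ c
  have hγ : IsSmoothOn (φ.toFun '' T) γ :=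
    hc.rep_smooth hφ hφ hTs (subset_univ _) fun g hg => hg.2.2
  set γ' := differential (φ.toFun '' T) γ
  have hγ1 : HasDiff _ γ γ' := hγ.hasDiff hΦ
  have hγ2 := (hγ.differential hΦ).hasDiff hΦ.prod_univ
  set γ'' := differential ((φ.toFun '' T) ×ˢ univ) γ'
  have he : φ.toFun 1 ∈ φ.toFun '' T := ⟨1, h1T, rfl⟩
  have hAd : ∀ x, γ' (φ.toFun 1, x) = Ad K k x := fun x => by
    rw [Ad_eq, chartDeriv_eq_differential' h hφ hT hTs (fun g hg => hg.2.2) h1T]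
  have hγr : ∀ g ∈ T, γ (φ.toFun g) = φ.toFun (c g) := fun g hg =>
    rep_apply (h.injOn _ hφ) c (hTs hg)
  have hγe : γ (φ.toFun 1) = φ.toFun 1 := by
    rw [hγr _ h1T, c1]
  -- Conjugation by k carries the left invariant field of y to that of Ad(k) y. This is the
  -- derivative at h = 1 of c(g h) = c(g) c(h), written in the chart.
  have key : ∀ y, EqOn (fun u => γ' (u, mulD E K ((u, φ.toFun 1), (0, y))))
      (fun u => mulD E K ((γ u, φ.toFun 1), (0, Ad K k y))) (φ.toFun '' T) := by
    rintro y _ ⟨g, hg, rfl⟩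
    show γ' (φ.toFun g, mulD E K ((φ.toFun g, φ.toFun 1), (0, y))) =
      mulD E K ((γ (φ.toFun g), φ.toFun 1), (0, Ad K k y))
    rw [hγr g hg, ← hK.leftField_eq (hTs hg),
      ← hK.leftField_eq hg.2.2]
    have e1 : γ' (φ.toFun g, leftField K y g) = chartDeriv φ φ c g (leftField K y g) :=
      (chartDeriv_eq_differential' h hφ hT hTs (fun g hg => hg.2.2) hg _).symm
    have hg1 : g * 1 ∈ φ.source := by rw [mul_one]; exact hTs hg
    have e2 := chartDeriv_comp h h h o o hc (hK.mSmooth_mul_left g) hφ hφ hφ (mem_univ 1) (mem_univ _)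
      hK.one_mem hg1 (by rw [mul_one]; exact hg.2.2) y
    have e3 := chartDeriv_comp h h h o o (hK.mSmooth_mul_left (c g)) hc hφ hφ hφ (mem_univ 1)
      (mem_univ _) hK.one_mem h1T.2.2 (show c g * c 1 ∈ _ by rw [c1, mul_one]; exact hg.2.2) y
    have e4 : (c ∘ fun h => g * h) = ((fun h => c g * h) ∘ c) := funext fun h => hcm g h
    rw [mul_one] at e2
    rw [e1]
    refine e2.symm.trans ?_
    have c1' : k * 1 * k⁻¹ = 1 := c1
    rw [e4]
    refine e3.trans ?_
    rw [c1', Ad_eq]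
    rfl
  -- Differentiating `key` at 1 in direction x produces, besides the terms in b, the second
  -- derivative of conjugation applied to x and y.
  have main : ∀ x y, γ'' ((φ.toFun 1, y), (x, 0)) + Ad K k (mulBilin K x y) =
      mulBilin K (Ad K k x) (Ad K k y) := by
    intro x y
    have hl := (hK.hasDiff_leftField y).mono (image_mono hTs)
    have d1 := hγ2.comp hΦ.prod_univ ((HasDiff.linear (φ.toFun '' T) (.id ℝ E)).prodMk hl)
      fun u hu => ⟨hu, mem_univ _⟩
    have d2 := (hK.hasDiff_leftField (Ad K k y)).comp hK.isOpen_oneChart_image.good hγ1 (by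
      rintro _ ⟨g, hg, rfl⟩
      rw [hγr g hg]
      exact ⟨_, hg.2.2, rfl⟩)
    have d3 := d1.eq_of_eqOn hΦ d2 (key y) he x
    have d4 : mulD E K ((φ.toFun 1, φ.toFun 1), (0, y)) = y := by
      rw [← hK.leftField_eq hK.one_mem, hK.leftField_one]
    obtain ⟨L, hL⟩ := hγ2.exists_linear hΦ.prod_univ (x := (φ.toFun 1, y)) ⟨he, mem_univ _⟩
    have d5 : γ'' ((φ.toFun 1, y), (x, mulBilin K x y)) =
        γ'' ((φ.toFun 1, y), (x, 0)) + γ'' ((φ.toFun 1, y), (0, mulBilin K x y)) := by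
      rw [← hL, ← hL, ← hL, ← map_add]
      simp
    have d6 : γ'' ((φ.toFun 1, y), (0, mulBilin K x y)) = Ad K k (mulBilin K x y) :=
      (hγ1.vertical hΦ hγ2 (by rwa [hΦo.interior_eq]) y _).trans (hAd _)
    have d7 : γ'' ((φ.toFun 1, mulD E K ((φ.toFun 1, φ.toFun 1), (0, y))), (x, mulBilin K x y)) =
        mulDD E K (((γ (φ.toFun 1), φ.toFun 1), (0, Ad K k y)), ((γ' (φ.toFun 1, x), 0), (0, 0))) := d3
    rw [d4, d5, d6, hγe, hAd] at d7
    exact d7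
  -- That extra term is symmetric in x and y, so it cancels in the antisymmetrisation.
  have hsym := hγ1.symmetric hγ2 (by rwa [hΦo.interior_eq]) x y
  rw [hK.lieBr_eq, hK.lieBr_eq, hK.Ad_sub, ← main x y, ← main y x, hsym]
  abel

/-- The derivative of `k ↦ Ad k x` at `1`. -/
lemma hasDiff_Ad (x : E) : ∃ α' : E × E → E,
    HasDiff ((oneChart E K).toFun '' (oneChart E K).source)
      (rep (oneChart E K) ⟨univ, id⟩ fun k : K => Ad K k x) α' ∧
    ∀ z, α' ((oneChart E K).toFun 1, z) = lieBr K z x := by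
  have h := hK.isMfd
  have hφ := hK.oneChart_mem
  have o := @isOpen_univ _ (groupAtlas E K).top
  have hE := selfAtlas_isMfd E
  set φ := oneChart E K with hφdef
  have hΦo := hK.isOpen_oneChart_image
  have hΦ := hΦo.good
  have hs : MSmooth (groupAtlas E K) (selfAtlas E) fun k : K => Ad K k x :=
    MSmoothOn.comp (f := fun k : K => (k, x)) h (h.prod hE) hE o
      (@isOpen_univ _ ((groupAtlas E K).prod (selfAtlas E)).top) hK.mSmooth_Ad
      (MSmoothOn.prodMk h h hE o (mSmooth_id h) (mSmooth_const h hE x)) (mapsTo_univ _ _)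
  have hα : IsSmoothOn (φ.toFun '' φ.source) (rep φ ⟨univ, id⟩ fun k : K => Ad K k x) :=
    hs.rep_smooth (c' := ⟨univ, id⟩) hφ rfl Subset.rfl (subset_univ _) (mapsTo_univ _ _)
  refine ⟨_, hα.hasDiff hΦ, fun z => ?_⟩
  set α := rep φ ⟨univ, id⟩ fun k : K => Ad K k x
  have he : φ.toFun 1 ∈ φ.toFun '' φ.source := ⟨1, hK.one_mem, rfl⟩
  have αe : ∀ k ∈ φ.source, α (φ.toFun k) = Ad K k x := fun k hk =>
    rep_apply (c' := ⟨univ, id⟩) (h.injOn _ hφ) _ hk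
  -- Since (k g k⁻¹) k = k g, right translation by k of Ad(k) x equals left translation by k of x.
  have key : EqOn (fun u => mulD E K ((φ.toFun 1, u), (α u, 0)))
      (fun u => mulD E K ((u, φ.toFun 1), (0, x))) (φ.toFun '' φ.source) := by
    rintro _ ⟨k, hk, rfl⟩
    show mulD E K ((φ.toFun 1, φ.toFun k), (α (φ.toFun k), 0)) =
      mulD E K ((φ.toFun k, φ.toFun 1), (0, x))
    have c1 : k * 1 * k⁻¹ = 1 := by simp
    rw [αe k hk, ← hK.leftField_eq hk, ← hK.chartDeriv_mul_right hk, Ad_eq]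
    have e1 := chartDeriv_comp h h h o o (hK.mSmooth_mul_right k) (hK.mSmooth_conj k) hφ hφ hφ
      (mem_univ 1) (mem_univ _) hK.one_mem (c1.symm ▸ hK.one_mem) (by rw [c1, one_mul]; exact hk) x
    have e2 : ((fun g => g * k) ∘ fun g => k * g * k⁻¹) = fun g => k * g := by
      funext g
      simp
    rw [e2] at e1
    refine Eq.trans ?_ e1.symm
    rw [c1]
  have d1 := hK.hasDiff_mulD.comp hK.isOpen_image_mulDom.good.prod_univ
    (((HasDiff.const (φ.toFun '' φ.source) (φ.toFun 1)).prodMk (.linear _ (.id ℝ E))).prodMk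
      ((hα.hasDiff hΦ).prodMk (.const _ (0 : E)))) (by
    rintro _ ⟨k, hk, rfl⟩
    exact ⟨⟨_, hK.mem_mulDom_left hk, rfl⟩, mem_univ _⟩)
  -- The derivative at k = 1 along z reads b(x, z) + α'(z) = b(z, x), so α'(z) = [z, x].
  have d2 := d1.eq_of_eqOn hΦ (hK.hasDiff_leftField x) key he z
  set α' := differential (φ.toFun '' φ.source) α
  have d3 : mulDD E K (((φ.toFun 1, φ.toFun 1), (α (φ.toFun 1), 0)),
      ((0, z), (α' (φ.toFun 1, z), 0))) = mulBilin K z x := d2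
  rw [αe 1 hK.one_mem, hK.Ad_one] at d3
  obtain ⟨L, hL⟩ := hK.exists_mulDD_linear (x, 0)
  have d4 : mulDD E K (((φ.toFun 1, φ.toFun 1), (x, 0)), ((0, z), (α' (φ.toFun 1, z), 0))) =
      mulDD E K (((φ.toFun 1, φ.toFun 1), (x, 0)), ((0, z), 0)) +
      mulDD E K (((φ.toFun 1, φ.toFun 1), (x, 0)), (0, (α' (φ.toFun 1, z), 0))) := by
    rw [← hL, ← hL, ← hL, ← map_add]
    simp
  have d5 : mulDD E K (((φ.toFun 1, φ.toFun 1), (x, 0)), (0, (α' (φ.toFun 1, z), 0))) =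
      α' (φ.toFun 1, z) := by
    rw [hK.hasDiff_mul.vertical hK.isOpen_image_mulDom.good hK.hasDiff_mulD
      (by rw [hK.isOpen_image_mulDom.interior_eq]; exact hK.one_mem_image),
      ← hK.chartDeriv_mul_right hK.one_mem]
    have : (fun g : K => g * 1) = id := funext mul_one
    rw [this, chartDeriv_id_self h hφ hK.one_mem]
  have d6 : mulDD E K (((φ.toFun 1, φ.toFun 1), (x, 0)), ((0, z), 0)) = mulBilin K x z :=
    hK.mulDD_symm _ _
  rw [d4, d5, d6] at d3
  rw [hK.lieBr_eq, ← d3]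
  abel

lemma lieBr_self (x : E) : lieBr K x x = 0 := by
  rw [hK.lieBr_eq, sub_self]

/-- The Jacobi identity. -/
lemma lieBr_jacobi (z x y : E) : lieBr K z (lieBr K x y) =
    lieBr K (lieBr K z x) y + lieBr K x (lieBr K z y) := by
  have h := hK.isMfd
  have hφ := hK.oneChart_mem
  obtain ⟨β, hβ⟩ := hK.exists_lieBr_bilinear
  have hβc : Continuous fun p : E × E => β p.1 p.2 := by
    simp only [hβ]
    exact hK.continuous_lieBr
  obtain ⟨a, ha, ha'⟩ := hK.hasDiff_Ad x
  obtain ⟨b, hb, hb'⟩ := hK.hasDiff_Ad y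
  obtain ⟨d, hd, hd'⟩ := hK.hasDiff_Ad (lieBr K x y)
  have h1 := (HasDiff.bilinear β hβc).comp (IsOpen.good isOpen_univ) (ha.prodMk hb) (mapsTo_univ _ _)
  have he : (oneChart E K).toFun 1 ∈ (oneChart E K).toFun '' (oneChart E K).source :=
    ⟨1, hK.one_mem, rfl⟩
  have hr : ∀ w : E, ∀ k ∈ (oneChart E K).source,
      rep (oneChart E K) ⟨univ, id⟩ (fun k : K => Ad K k w) ((oneChart E K).toFun k) = Ad K k w :=
    fun w k hk => rep_apply (c' := ⟨univ, id⟩) (h.injOn _ hφ) _ hk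
  -- Both sides of Ad(k)[x, y] = [Ad(k) x, Ad(k) y] are differentiated at k = 1 along z, the right
  -- one by the product rule for the bracket.
  have h2 := hd.eq_of_eqOn hK.isOpen_oneChart_image.good h1 (by
    rintro _ ⟨k, hk, rfl⟩
    simp only [Function.comp]
    rw [hr _ k hk, hr _ k hk, hr _ k hk, hβ, hK.Ad_lieBr]) he z
  simp only [hd', ha', hb', hβ, hr _ 1 hK.one_mem, hK.Ad_one] at h2
  rw [h2, add_comm]

end IsLCLieGroup

end LieGroup

/-! ### Locality of smoothness, and smoothness of charts -/

section Local

variable {X : Type*} {M : Type*} {Y : Type*} {N : Type*}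
  [AddCommGroup X] [Module ℝ X] [TopologicalSpace X]
  [AddCommGroup Y] [Module ℝ Y] [TopologicalSpace Y] [LCS X] [LCS Y]
  {A : LCAtlas X M} {B : LCAtlas Y N} {f : M → N} {U : Set M} {c : LCChart X M}

lemma mSmoothOn_of_nhds (hA : A.IsMfd) (hB : B.IsMfd) (hU : IsOpen[A.top] U)
    (h : ∀ x ∈ U, ∃ T, IsOpen[A.top] T ∧ x ∈ T ∧ MSmoothOn A B f T) : MSmoothOn A B f U := by
  let := A.top
  refine mSmoothOn_of_local hA hB hU fun x hx => ?_
  obtain ⟨T, hT, hxT, hf⟩ := h x hx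
  have hc := hA.chartAt_mem x
  have hc' := hB.chartAt_mem (f x)
  refine ⟨_, hc, _, hc', (A.chartAt x).source ∩ (T ∩ f ⁻¹' (B.chartAt (f x)).source),
    (hA.isOpen_source hc).inter (hf.isOpen_inter_preimage hT (hB.isOpen_source hc')),
    ⟨hA.mem_chartAt x, hxT, hB.mem_chartAt (f x)⟩, inter_subset_left, fun y hy => hy.2.2,
    hf.rep_smooth hc hc' inter_subset_left (fun y hy => hy.2.1) fun y hy => hy.2.2⟩

lemma mSmoothOn_chart (hA : A.IsMfd) (hc : c ∈ A.atlas) :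
    MSmoothOn A (selfAtlas X) c.toFun c.source := by
  refine mSmoothOn_of_local hA (selfAtlas_isMfd X) (hA.isOpen_source hc) fun x hx =>
    ⟨c, hc, ⟨univ, id⟩, rfl, c.source, hA.isOpen_source hc, hx, Subset.rfl, fun _ _ => trivial, ?_⟩
  refine (IsSmoothOn.linear _ (ContinuousLinearMap.id ℝ X)).congr ?_
  rintro _ ⟨y, hy, rfl⟩
  exact (rep_apply (hA.injOn c hc) (c' := ⟨univ, id⟩) c.toFun hy).symm

end Local

/-! ### Principal bundles: local sections and the division map -/

section Bundle

variable {n : ℕ} {E : Type u} [AddCommGroup E] [Module ℝ E] [TopologicalSpace E] [LCS E]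
  {K : Type u} [Group K] [TopologicalSpace K] [ChartedSpace E K]
  {M : Type u} [TopologicalSpace M] [ChartedSpace (EuclideanQuadrant n) M]
  {P : Type u} [TopologicalSpace P] [ChartedSpace (EuclideanQuadrant n × E) P]
  [MulAction Kᵐᵒᵖ P] {π : P → M}

open Classical in
/-- The element of the structure group taking `p` to `q`, for `p` and `q` in the same fibre. -/
noncomputable def delta (K : Type*) {P : Type*} [Group K] [MulAction Kᵐᵒᵖ P] (p q : P) : K :=
  if h : ∃ k : K, q = p <• k then h.choose else 1

variable (n E) in
/-- `s` is a smooth section over the open set `U`. -/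
structure IsLocalSection (π : P → M) (U : Set M) (s : M → P) : Prop where
  isOpen : IsOpen U
  smooth : MSmoothOn (cornerAtlas n M) (totalAtlas n E P) s U
  proj : ∀ m ∈ U, π (s m) = m

lemma smul_op_mul (p : P) (k l : K) : p <• (k * l) = (p <• k) <• l := by
  rw [MulOpposite.op_mul, mul_smul]

lemma smul_op_one (p : P) : p <• (1 : K) = p := by simp

namespace IsSmoothPrincipalBundle

variable (hP : IsSmoothPrincipalBundle n E K π)
include hP

lemma isMfd : (totalAtlas n E P).IsMfd := totalAtlas_isMfd hP.smoothAtlas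

lemma continuous_proj : Continuous π := continuousOn_univ.1 hP.smooth_proj.1

/-- In an equivariant trivialisation the fibre is K with right multiplication, which is transitive;
the next lemma uses that it is free. -/
lemma exists_smul_eq {p q : P} (h : π p = π q) : ∃ k : K, q = p <• k := by
  obtain ⟨e, he, -, -, h3⟩ := hP.locally_trivial (π p)
  have hp : p ∈ e.source := e.mem_source.2 he
  have hq : q ∈ e.source := e.mem_source.2 (h ▸ he)
  refine ⟨(e p).2⁻¹ * (e q).2, e.injOn hq (e.mem_source.2 ?_) ?_⟩
  · rwa [hP.proj_action]
  · change e q = e (p <• _)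
    rw [h3 p hp, mul_inv_cancel_left]
    exact Prod.ext (by rw [e.coe_fst hp, e.coe_fst hq, h]) rfl

lemma smul_injective {p : P} {k l : K} (h : p <• k = p <• l) : k = l := by
  obtain ⟨e, he, -, -, h3⟩ := hP.locally_trivial (π p)
  have hp : p ∈ e.source := e.mem_source.2 he
  have := h3 p hp l
  rw [← h, h3 p hp] at this
  exact mul_left_cancel (congrArg Prod.snd this)

lemma smul_delta {p q : P} (h : π p = π q) : p <• delta K p q = q := by
  have h' := hP.exists_smul_eq h
  rw [delta, dif_pos h']
  exact h'.choose_spec.symm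

lemma delta_eq {p q : P} {k : K} (h : p <• k = q) : delta K p q = k :=
  hP.smul_injective (p := p) (by
    rw [h, hP.smul_delta]
    rw [← h, hP.proj_action])

lemma delta_self (p : P) : delta K p p = 1 := hP.delta_eq (smul_op_one p)

lemma delta_smul {p q : P} (h : π p = π q) (k : K) : delta K p (q <• k) = delta K p q * k :=
  hP.delta_eq (by rw [smul_op_mul, hP.smul_delta h])

lemma delta_mul {p q r : P} (h : π p = π q) (h' : π q = π r) :
    delta K p r = delta K p q * delta K q r :=
  hP.delta_eq (by rw [smul_op_mul, hP.smul_delta h, hP.smul_delta h'])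

lemma exists_section (hK : IsLCLieGroup E K) (hM : SmoothAtlas (cornerAtlas n M)) (m : M) :
    ∃ U s, m ∈ U ∧ IsLocalSection n E π U s := by
  obtain ⟨e, he, -, h2, -⟩ := hP.locally_trivial m
  have hA := cornerAtlas_isMfd hM
  refine ⟨e.baseSet, fun m => e.toOpenPartialHomeomorph.symm (m, 1), he, e.open_baseSet, ?_,
    fun m hm => e.proj_symm_apply' hm⟩
  exact MSmoothOn.comp (g := e.toOpenPartialHomeomorph.symm) (f := fun m => (m, (1 : K)))
    hA (hA.prod hK.isMfd) hP.isMfd e.open_baseSet e.open_target h2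
    (MSmoothOn.prodMk hA hA hK.isMfd e.open_baseSet ((mSmooth_id hA).mSmoothOn _)
      ((mSmooth_const hA hK.isMfd 1).mSmoothOn _)) fun m hm => e.mem_target.2 hm

lemma surjective_proj (hK : IsLCLieGroup E K) (hM : SmoothAtlas (cornerAtlas n M)) :
    Function.Surjective π := fun m => by
  obtain ⟨U, s, hm, hs⟩ := hP.exists_section hK hM m
  exact ⟨s m, hs.proj m hm⟩

lemma t2Space (hK : IsLCLieGroup E K) [T2Space M] : T2Space P := by
  have := hK.t2Space
  refine ⟨fun p q hpq => ?_⟩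
  by_cases h : π p = π q
  · obtain ⟨e, he, -⟩ := hP.locally_trivial (π p)
    have hp : p ∈ e.source := e.mem_source.2 he
    have hq : q ∈ e.source := e.mem_source.2 (h ▸ he)
    obtain ⟨V, W, hV, hW, hpV, hqW, hd⟩ := t2_separation fun h' : e p = e q =>
      hpq (e.injOn hp hq h')
    refine ⟨_, _, e.toOpenPartialHomeomorph.isOpen_inter_preimage hV,
      e.toOpenPartialHomeomorph.isOpen_inter_preimage hW, ⟨hp, hpV⟩, ⟨hq, hqW⟩, ?_⟩
    exact (hd.preimage _).mono inter_subset_right inter_subset_right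
  · obtain ⟨V, W, hV, hW, hpV, hqW, hd⟩ := t2_separation h
    exact ⟨_, _, hV.preimage hP.continuous_proj, hW.preimage hP.continuous_proj, hpV, hqW,
      hd.preimage _⟩

/-- In a trivialisation the division map is the quotient of the group components, k⁻¹ l, and
inversion and multiplication are smooth. -/
lemma mSmoothOn_delta (hK : IsLCLieGroup E K) (hM : SmoothAtlas (cornerAtlas n M))
    {X Q : Type*} [AddCommGroup X] [Module ℝ X] [TopologicalSpace X] [LCS X]
    {C : LCAtlas X Q} (hC : C.IsMfd) {U : Set Q} (hU : IsOpen[C.top] U) {s t : Q → P}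
    (hs : MSmoothOn C (totalAtlas n E P) s U) (ht : MSmoothOn C (totalAtlas n E P) t U)
    (hst : ∀ x ∈ U, π (s x) = π (t x)) :
    MSmoothOn C (groupAtlas E K) (fun x => delta K (s x) (t x)) U := by
  have hA := cornerAtlas_isMfd hM
  refine mSmoothOn_of_nhds hC hK.isMfd hU fun x hx => ?_
  obtain ⟨e, he, h1, -, h3⟩ := hP.locally_trivial (π (s x))
  have hT := hs.isOpen_inter_preimage hU e.open_source
  have key : ∀ r : Q → P, MSmoothOn C (totalAtlas n E P) r U →
      MapsTo r (U ∩ s ⁻¹' e.source) e.source →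
      MSmoothOn C (groupAtlas E K) (fun x => (e (r x)).2) (U ∩ s ⁻¹' e.source) := fun r hr hm =>
    ((mSmooth_snd hA hK.isMfd).mSmoothOn univ).comp hC (hA.prod hK.isMfd) hK.isMfd hT
      (let := (cornerAtlas n M).top; let := (groupAtlas E K).top; isOpen_univ)
      (h1.comp hC hP.isMfd (hA.prod hK.isMfd) hT e.open_source
      (hr.mono inter_subset_left) hm) fun _ _ => trivial
  have hts : MapsTo t (U ∩ s ⁻¹' e.source) e.source := fun y hy =>
    e.mem_source.2 (hst y hy.1 ▸ e.mem_source.1 hy.2)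
  refine ⟨_, hT, ⟨hx, e.mem_source.2 he⟩, (hK.mSmoothOn_mul hC hT
    (hK.mSmoothOn_inv hC hT (key s hs fun y hy => hy.2)) (key t ht hts)).congr hC fun y hy => ?_⟩
  refine (hP.delta_eq (e.injOn (e.mem_source.2 ?_) (hts hy) ?_)).symm
  · rw [hP.proj_action]; exact e.mem_source.1 hy.2
  · change e (s y <• _) = e (t y)
    rw [h3 _ hy.2, mul_inv_cancel_left]
    exact Prod.ext (by rw [e.coe_fst hy.2, e.coe_fst (hts hy), hst y hy.1]) rfl

end IsSmoothPrincipalBundle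

end Bundle

/-! ### The adjoint bundle: points, coordinates and bundle charts -/

section AdBundle

variable {n : ℕ} {E : Type u} [AddCommGroup E] [Module ℝ E] [TopologicalSpace E] [LCS E]
  {K : Type u} [Group K] [TopologicalSpace K] [ChartedSpace E K]
  {M : Type u} [TopologicalSpace M] [ChartedSpace (EuclideanQuadrant n) M]
  {P : Type u} [TopologicalSpace P] [ChartedSpace (EuclideanQuadrant n × E) P]
  [MulAction Kᵐᵒᵖ P] {π : P → M}

/-- The projection of the adjoint bundle. -/
noncomputable def adProj (π : P → M) (ζ : AdBundle E K P) : M := π (Quot.out ζ).1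

/-- The coordinate of a point of the adjoint bundle with respect to the point `p` of the fibre. -/
noncomputable def adCoord (p : P) (ζ : AdBundle E K P) : E :=
  Ad K (delta K p (Quot.out ζ).1) (Quot.out ζ).2

lemma AdBundle.mk_smul (hK : IsLCLieGroup E K) (p : P) (k : K) (x : E) :
    AdBundle.mk K (p <• k) x = AdBundle.mk K p (Ad K k x) :=
  (Quot.sound ⟨k, by rw [hK.Ad_inv_Ad]⟩).symm

lemma AdBundle.exists_mk (ζ : AdBundle E K P) : ∃ p x, ζ = AdBundle.mk K p x :=
  ⟨(Quot.out ζ).1, (Quot.out ζ).2, (Quot.out_eq ζ).symm⟩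

/-- The relation defining the quotient is the orbit relation of a group action, hence already an
equivalence, and equality in the quotient adds nothing to it. -/
lemma AdBundle.mk_eq_iff (hK : IsLCLieGroup E K) {p q : P} {x y : E} :
    AdBundle.mk K p x = AdBundle.mk K q y ↔ ∃ k : K, q = p <• k ∧ y = Ad K k⁻¹ x := by
  constructor
  · intro h
    have hr : Equivalence fun a b : P × E => ∃ k : K, b = (a.1 <• k, Ad K k⁻¹ a.2) := by
      refine ⟨fun a => ⟨1, ?_⟩, ?_, ?_⟩
      · rw [smul_op_one, inv_one, hK.Ad_one]
      · rintro ⟨p, x⟩ _ ⟨k, rfl⟩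
        refine ⟨k⁻¹, ?_⟩
        simp only
        rw [← smul_op_mul, mul_inv_cancel, smul_op_one, inv_inv, hK.Ad_Ad_inv]
      · rintro ⟨p, x⟩ _ _ ⟨k, rfl⟩ ⟨l, rfl⟩
        exact ⟨k * l, by simp only; rw [smul_op_mul, mul_inv_rev, hK.Ad_mul]⟩
    obtain ⟨k, hk⟩ := hr.eqvGen_iff.1 (Quot.eqvGen_exact h)
    exact ⟨k, congrArg Prod.fst hk, congrArg Prod.snd hk⟩
  · rintro ⟨k, rfl, rfl⟩
    rw [AdBundle.mk_smul hK, hK.Ad_Ad_inv]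

namespace IsSmoothPrincipalBundle

variable (hP : IsSmoothPrincipalBundle n E K π) (hK : IsLCLieGroup E K)
include hP hK

lemma exists_out (p : P) (x : E) : ∃ k : K, (Quot.out (AdBundle.mk K p x)).1 = p <• k ∧
    (Quot.out (AdBundle.mk K p x)).2 = Ad K k⁻¹ x :=
  (AdBundle.mk_eq_iff hK).1 (Quot.out_eq (AdBundle.mk K p x)).symm

lemma adProj_mk (p : P) (x : E) : adProj π (AdBundle.mk K p x) = π p := by
  obtain ⟨k, h, -⟩ := hP.exists_out hK p x
  rw [adProj, h, hP.proj_action]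

lemma adCoord_mk' {p q : P} (h : π p = π q) (x : E) :
    adCoord p (AdBundle.mk K q x) = Ad K (delta K p q) x := by
  obtain ⟨k, h1, h2⟩ := hP.exists_out hK q x
  rw [adCoord, h1, h2, hP.delta_smul h, hK.Ad_mul, hK.Ad_Ad_inv]

lemma adCoord_mk (p : P) (x : E) : adCoord p (AdBundle.mk K p x) = x := by
  rw [hP.adCoord_mk' hK rfl, hP.delta_self, hK.Ad_one]

lemma mk_adCoord {p : P} {ζ : AdBundle E K P} (h : π p = adProj π ζ) :
    AdBundle.mk K p (adCoord p ζ) = ζ := by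
  obtain ⟨q, x, rfl⟩ := AdBundle.exists_mk ζ
  rw [hP.adProj_mk hK] at h
  rw [hP.adCoord_mk' hK h, ← AdBundle.mk_smul hK, hP.smul_delta h]

lemma continuous_adProj : Continuous[(adAtlas n E K π).top, _] (adProj π) :=
  continuous_quot_lift (fun a b => by
    rintro ⟨k, rfl⟩
    exact (hP.proj_action _ _).symm) (hP.continuous_proj.comp continuous_fst) |>.congr fun ζ => by
      obtain ⟨p, x, rfl⟩ := AdBundle.exists_mk ζ
      exact (hP.adProj_mk hK p x).symm

lemma isOpen_adProj_preimage {U : Set M} (hU : IsOpen U) :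
    IsOpen[(adAtlas n E K π).top] (adProj π ⁻¹' U) :=
  let := (adAtlas n E K π).top
  hU.preimage (hP.continuous_adProj hK)

end IsSmoothPrincipalBundle

/-- The bundle chart of the adjoint bundle given by a local section and a chart of the base. -/
noncomputable def adChart (π : P → M) (U : Set M) (s : M → P)
    (c : LCChart (EuclideanSpace ℝ (Fin n)) M) :
    LCChart (EuclideanSpace ℝ (Fin n) × E) (AdBundle E K P) where
  source := adProj π ⁻¹' (U ∩ c.source)
  toFun ζ := (c.toFun (adProj π ζ), adCoord (s (adProj π ζ)) ζ)

section Chart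

variable {U : Set M} {s : M → P} {c : LCChart (EuclideanSpace ℝ (Fin n)) M}
  {a : LCChart (EuclideanSpace ℝ (Fin n) × E) (AdBundle E K P)}

lemma IsLocalSection.mem_adChart_source (hP : IsSmoothPrincipalBundle n E K π)
    (hK : IsLCLieGroup E K) (hs : IsLocalSection n E π U s) {ζ : AdBundle E K P} :
    ζ ∈ (adChart (K := K) π U s c).source ↔ ∃ m ∈ U ∩ c.source, ∃ x : E, ζ = AdBundle.mk K (s m) x := by
  constructor
  · intro h
    exact ⟨adProj π ζ, h, _, (hP.mk_adCoord hK (hs.proj _ h.1)).symm⟩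
  · rintro ⟨m, hm, x, rfl⟩
    change adProj π (AdBundle.mk K (s m) x) ∈ U ∩ c.source
    rwa [hP.adProj_mk hK, hs.proj m hm.1]

lemma IsLocalSection.adChart_mk (hP : IsSmoothPrincipalBundle n E K π)
    (hK : IsLCLieGroup E K) (hs : IsLocalSection n E π U s) {m : M} (hm : m ∈ U) (x : E) :
    (adChart π U s c).toFun (AdBundle.mk K (s m) x) = (c.toFun m, x) := by
  change (c.toFun (adProj π _), adCoord (s (adProj π _)) _) = _
  rw [hP.adProj_mk hK, hs.proj m hm, hP.adCoord_mk hK]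

lemma IsLocalSection.isAdChart (hP : IsSmoothPrincipalBundle n E K π)
    (hK : IsLCLieGroup E K) (hs : IsLocalSection n E π U s) (hc : c ∈ (cornerAtlas n M).atlas) :
    IsAdChart n E K π (adChart π U s c) :=
  ⟨U, s, c, hc, hs.isOpen, hs.smooth, hs.proj, ext fun _ => hs.mem_adChart_source hP hK,
    fun _ hm x => hs.adChart_mk hP hK hm.1 x⟩

lemma IsAdChart.exists_section (hP : IsSmoothPrincipalBundle n E K π) (hK : IsLCLieGroup E K)
    (ha : IsAdChart n E K π a) : ∃ U s, ∃ c ∈ (cornerAtlas n M).atlas, IsLocalSection n E π U s ∧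
      a.source = adProj π ⁻¹' (U ∩ c.source) ∧
      ∀ m ∈ U ∩ c.source, ∀ x : E, a.toFun (AdBundle.mk K (s m) x) = (c.toFun m, x) := by
  obtain ⟨U, s, c, hc, hU, hs, hp, h1, h2⟩ := ha
  have hs' : IsLocalSection n E π U s := ⟨hU, hs, hp⟩
  exact ⟨U, s, c, hc, hs', h1.trans (ext fun _ => (hs'.mem_adChart_source hP hK).symm), h2⟩

end Chart

namespace IsLocalSection

variable {U : Set M} {s : M → P} (hs : IsLocalSection n E π U s)
  (hP : IsSmoothPrincipalBundle n E K π) (hK : IsLCLieGroup E K)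
  (hM : SmoothAtlas (cornerAtlas n M))
include hs hP hK hM

lemma mSmoothOn_delta : MSmoothOn (totalAtlas n E P) (groupAtlas E K)
    (fun p => delta K (s (π p)) p) (π ⁻¹' U) :=
  have hU := hs.isOpen.preimage hP.continuous_proj
  hP.mSmoothOn_delta hK hM hP.isMfd hU
    (hs.smooth.comp hP.isMfd (cornerAtlas_isMfd hM) hP.isMfd hU hs.isOpen
      (hP.smooth_proj.mSmoothOn _) fun _ h => h) ((mSmooth_id hP.isMfd).mSmoothOn _)
    fun _ hp => hs.proj _ hp

lemma continuousOn_mk : @ContinuousOn _ _ _ (adAtlas n E K π).top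
    (fun q : M × E => AdBundle.mk K (s q.1) q.2) (U ×ˢ univ) := by
  let := (adAtlas n E K π).top
  have h : Continuous fun q : P × E => AdBundle.mk K q.1 q.2 := continuous_quot_mk
  have h1 : ContinuousOn s U := hs.smooth.1
  exact h.comp_continuousOn ((h1.comp continuousOn_fst fun q hq => hq.1).prodMk continuousOn_snd)

/-- Openness in the quotient topology is openness of the preimage in P × E. There the chart becomes
(p, x) ↦ (c(π p), Ad(δ(s(π p), p)) x), a smooth and so continuous map. -/
lemma isOpen_adChart_preimage {c : LCChart (EuclideanSpace ℝ (Fin n)) M}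
    (hc : c ∈ (cornerAtlas n M).atlas) {O : Set (EuclideanSpace ℝ (Fin n) × E)} (hO : IsOpen O) :
    IsOpen[(adAtlas n E K π).top]
      ((adChart (K := K) π U s c).source ∩ (adChart π U s c).toFun ⁻¹' O) := by
  have hA := cornerAtlas_isMfd hM
  have hE := selfAtlas_isMfd E
  have hPE := hP.isMfd.prod hE
  have hcs : IsOpen c.source := hA.isOpen_source hc
  have hUc : IsOpen (π ⁻¹' (U ∩ c.source)) := (hs.isOpen.inter hcs).preimage hP.continuous_proj
  have hW : IsOpen[((totalAtlas n E P).prod (selfAtlas E)).top]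
      ((π ⁻¹' (U ∩ c.source)) ×ˢ (univ : Set E)) := hUc.prod isOpen_univ
  have h1 : MSmoothOn ((totalAtlas n E P).prod (selfAtlas E)) (totalAtlas n E P) Prod.fst
      ((π ⁻¹' (U ∩ c.source)) ×ˢ (univ : Set E)) :=
    (mSmooth_fst hP.isMfd hE).mSmoothOn _
  have h2 := ((mSmoothOn_chart hA hc).comp hP.isMfd hA (selfAtlas_isMfd _) hUc hcs
    (hP.smooth_proj.mSmoothOn _) fun p hp => hp.2).comp hPE hP.isMfd (selfAtlas_isMfd _) hW hUc h1
    fun q hq => hq.1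
  have h3 := ((hs.mSmoothOn_delta hP hK hM).mono (preimage_mono inter_subset_left)).comp hPE
    hP.isMfd hK.isMfd hW hUc h1 fun q hq => hq.1
  have h4 := (hK.mSmooth_Ad.mSmoothOn univ).comp hPE (hK.isMfd.prod hE) hE hW
    (let := (groupAtlas E K).top; let := (selfAtlas E).top; isOpen_univ)
    (h3.prodMk hPE hK.isMfd hE hW ((mSmooth_snd hP.isMfd hE).mSmoothOn _)) fun _ _ => trivial
  have h5 := (h2.prodMk hPE (selfAtlas_isMfd _) hE hW h4).isOpen_inter_preimage hW (V := O) hO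
  suffices h6 : (fun q : P × E => AdBundle.mk K q.1 q.2) ⁻¹'
      ((adChart (K := K) π U s c).source ∩ (adChart π U s c).toFun ⁻¹' O) =
        ((π ⁻¹' (U ∩ c.source)) ×ˢ (univ : Set E)) ∩ (fun q : P × E =>
          (c.toFun (π q.1), Ad K (delta K (s (π q.1)) q.1) q.2)) ⁻¹' O by
    change IsOpen ((fun q : P × E => AdBundle.mk K q.1 q.2) ⁻¹' _)
    rw [h6]
    exact h5
  ext ⟨p, x⟩
  have hp := hP.adProj_mk hK p x
  change adProj π (AdBundle.mk K p x) ∈ U ∩ c.source ∧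
    (c.toFun (adProj π (AdBundle.mk K p x)),
      adCoord (s (adProj π (AdBundle.mk K p x))) (AdBundle.mk K p x)) ∈ O ↔
    (π p ∈ U ∩ c.source ∧ True) ∧ (c.toFun (π p), Ad K (delta K (s (π p)) p) x) ∈ O
  rw [hp]
  constructor
  · rintro ⟨h, h'⟩
    rw [hP.adCoord_mk' hK (hs.proj _ h.1)] at h'
    exact ⟨⟨h, trivial⟩, h'⟩
  · rintro ⟨⟨h, -⟩, h'⟩
    rw [hP.adCoord_mk' hK (hs.proj _ h.1)]
    exact ⟨h, h'⟩

end IsLocalSection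

end AdBundle

/-! ### The adjoint bundle as a manifold -/

section AdAtlas

variable {n : ℕ} {E : Type u} [AddCommGroup E] [Module ℝ E] [TopologicalSpace E] [LCS E]
  {K : Type u} [Group K] [TopologicalSpace K] [ChartedSpace E K]
  {M : Type u} [TopologicalSpace M] [ChartedSpace (EuclideanQuadrant n) M]
  {P : Type u} [TopologicalSpace P] [ChartedSpace (EuclideanQuadrant n × E) P]
  [MulAction Kᵐᵒᵖ P] {π : P → M}
  (hP : IsSmoothPrincipalBundle n E K π) (hK : IsLCLieGroup E K)
  (hM : SmoothAtlas (cornerAtlas n M))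

/-- The identity as a chart. -/
def idChart (X : Type*) : LCChart X X := ⟨univ, id⟩

lemma idChart_mem (X : Type*) [TopologicalSpace X] : idChart X ∈ (selfAtlas X).atlas := rfl

lemma prod_idChart_image {X Y : Type*} [AddCommGroup X] [Module ℝ X] [TopologicalSpace X] [LCS X]
    [AddCommGroup Y] [Module ℝ Y] [TopologicalSpace Y] [LCS Y] {N : Type*} (c : LCChart X N)
    (T : Set N) :
    (c.prod (idChart Y)).toFun '' (T ×ˢ univ) = (c.toFun '' T) ×ˢ univ := by
  rw [LCChart.prod_image]
  congr 1
  exact image_id _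

include hP hK in
lemma IsAdChart.image_eq {U : Set M} {s : M → P} {c : LCChart (EuclideanSpace ℝ (Fin n)) M}
    {a : LCChart (EuclideanSpace ℝ (Fin n) × E) (AdBundle E K P)}
    (hs : IsLocalSection n E π U s)
    (ha : ∀ m ∈ U ∩ c.source, ∀ x : E, a.toFun (AdBundle.mk K (s m) x) = (c.toFun m, x))
    {T : Set M} (hT : T ⊆ U ∩ c.source) :
    a.toFun '' (adProj π ⁻¹' T) = (c.prod (idChart E)).toFun '' (T ×ˢ univ) := by
  ext y
  constructor
  · rintro ⟨ζ, hζ, rfl⟩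
    obtain ⟨m, hm, x, rfl⟩ := (hs.mem_adChart_source (c := c) hP hK).1 (hT hζ)
    rw [mem_preimage, hP.adProj_mk hK, hs.proj m hm.1] at hζ
    exact ⟨(m, x), ⟨hζ, trivial⟩, (ha m hm x).symm⟩
  · rintro ⟨⟨m, x⟩, ⟨hm, -⟩, rfl⟩
    refine ⟨AdBundle.mk K (s m) x, ?_, ha m (hT hm) x⟩
    rw [mem_preimage, hP.adProj_mk hK, hs.proj m (hT hm).1]
    exact hm

include hP hK hM

/-- A change of bundle charts is (m, x) ↦ (c'(m), Ad(δ(s'(m), s(m))) x) in base coordinates;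
smoothness is that of the division map and of Ad. -/
lemma isAdChart_trans {a a' : LCChart (EuclideanSpace ℝ (Fin n) × E) (AdBundle E K P)}
    (ha : IsAdChart n E K π a) (ha' : IsAdChart n E K π a') :
    IsSmoothOn (a.toFun '' (a.source ∩ a'.source)) (rep a a' id) := by
  obtain ⟨U, s, c, hc, hs, h1, h2⟩ := ha.exists_section hP hK
  obtain ⟨U', s', c', hc', hs', h1', h2'⟩ := ha'.exists_section hP hK
  have hA := cornerAtlas_isMfd hM
  have hE := selfAtlas_isMfd E
  have hX := selfAtlas_isMfd (EuclideanSpace ℝ (Fin n))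
  have hAE := hA.prod hE
  set T := (U ∩ c.source) ∩ (U' ∩ c'.source) with hTdef
  have hT : IsOpen T := (hs.isOpen.inter (hA.isOpen_source hc)).inter
    (hs'.isOpen.inter (hA.isOpen_source hc'))
  have hTE : IsOpen[((cornerAtlas n M).prod (selfAtlas E)).top] (T ×ˢ (univ : Set E)) :=
    hT.prod isOpen_univ
  have hf : MSmoothOn ((cornerAtlas n M).prod (selfAtlas E)) (cornerAtlas n M) Prod.fst
    (T ×ˢ (univ : Set E)) := (mSmooth_fst hA hE).mSmoothOn _
  have k1 := ((mSmoothOn_chart hA hc').mono (U' := T) fun m hm => hm.2.2).comp hAE hA hX hTE hT hf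
    fun q hq => hq.1
  have k2 := (hP.mSmoothOn_delta hK hM hA hT (hs'.smooth.mono fun m hm => hm.2.1)
    (hs.smooth.mono fun m hm => hm.1.1) fun m hm => (hs'.proj m hm.2.1).trans
      (hs.proj m hm.1.1).symm).comp hAE hA hK.isMfd hTE hT hf fun q hq => hq.1
  have k3 := (hK.mSmooth_Ad.mSmoothOn univ).comp hAE (hK.isMfd.prod hE) hE hTE
    (let := (groupAtlas E K).top; let := (selfAtlas E).top; isOpen_univ)
    (k2.prodMk hAE hK.isMfd hE hTE ((mSmooth_snd hA hE).mSmoothOn _)) fun _ _ => trivial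
  have hcE := LCChart.prod_mem hc (idChart_mem E)
  have k4 := (k1.prodMk hAE hX hE hTE k3).rep_smooth hcE
    (LCChart.prod_mem (idChart_mem _) (idChart_mem E)) (T := T ×ˢ univ)
    (fun q hq => ⟨hq.1.1.2, trivial⟩) Subset.rfl fun q hq => ⟨trivial, trivial⟩
  have hinj : InjOn a.toFun a.source := by
    rw [h1]
    intro ζ hζ ζ' hζ' h
    obtain ⟨m, hm, x, rfl⟩ := (hs.mem_adChart_source (c := c) hP hK).1 hζ
    obtain ⟨m', hm', x', rfl⟩ := (hs.mem_adChart_source (c := c) hP hK).1 hζ'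
    rw [h2 m hm, h2 m' hm', Prod.mk.injEq] at h
    rw [hA.injOn c hc hm.2 hm'.2 h.1, h.2]
  rw [h1, h1', ← preimage_inter, IsAdChart.image_eq hP hK hs h2 inter_subset_left]
  refine k4.congr ?_
  rintro _ ⟨⟨m, x⟩, ⟨hm, -⟩, rfl⟩
  rw [rep_apply (hAE.injOn _ hcE) _ ⟨hm.1.2, trivial⟩]
  have hmem : AdBundle.mk K (s m) x ∈ a.source := by
    rw [h1, mem_preimage, hP.adProj_mk hK, hs.proj m hm.1.1]
    exact hm.1
  have e1 : (c.prod (idChart E)).toFun (m, x) = a.toFun (AdBundle.mk K (s m) x) :=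
    (h2 m hm.1 x).symm
  have hp : π (s' m) = π (s m) := (hs'.proj m hm.2.1).trans (hs.proj m hm.1.1).symm
  rw [e1, rep_apply hinj _ hmem, id, ← hP.smul_delta hp, AdBundle.mk_smul hK, h2' m hm.2]
  rfl

lemma adAtlas_isMfd : (adAtlas n E K π).IsMfd where
  isOpen_preimage a ha O hO := by
    obtain ⟨U, s, c, hc, hs, h1, h2⟩ := IsAdChart.exists_section hP hK ha
    convert hs.isOpen_adChart_preimage hP hK hM hc hO using 1
    ext ζ
    rw [h1]
    refine and_congr_right fun hζ => ?_
    obtain ⟨m, hm, x, rfl⟩ := (hs.mem_adChart_source (c := c) hP hK).1 hζ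
    rw [mem_preimage, mem_preimage, h2 m hm, hs.adChart_mk hP hK hm.1]
  exists_open a ha W hW := by
    obtain ⟨U, s, c, hc, hs, h1, h2⟩ := IsAdChart.exists_section hP hK ha
    have hA := cornerAtlas_isMfd hM
    have hE := selfAtlas_isMfd E
    let := (adAtlas n E K π).top
    -- The local parametrisation (m, x) ↦ [s(m), x] is continuous, so `W` pulls back to an open
    -- subset of M × E, which is cut out by an open set in coordinates.
    have hV := (hs.continuousOn_mk hP hK hM).isOpen_inter_preimage (hs.isOpen.prod isOpen_univ) hW
    obtain ⟨O, hO, h⟩ := (hA.prod hE).exists_open _ (LCChart.prod_mem hc (idChart_mem E)) _ hV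
    refine ⟨O, hO, ?_⟩
    ext ζ
    refine and_congr_right fun hζ => ?_
    rw [h1] at hζ
    obtain ⟨m, hm, x, rfl⟩ := (hs.mem_adChart_source (c := c) hP hK).1 hζ
    rw [mem_preimage, h2 m hm]
    have hq : (m, x) ∈ (c.prod (idChart E)).source := ⟨hm.2, trivial⟩
    have := Set.ext_iff.1 h (m, x)
    constructor
    · intro h3
      exact (this.1 ⟨hq, ⟨hm.1, trivial⟩, h3⟩).2
    · intro h3
      exact (this.2 ⟨hq, h3⟩).2.2
  injOn a ha := by
    obtain ⟨U, s, c, hc, hs, h1, h2⟩ := IsAdChart.exists_section hP hK ha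
    rw [h1]
    intro ζ hζ ζ' hζ' h
    obtain ⟨m, hm, x, rfl⟩ := (hs.mem_adChart_source (c := c) hP hK).1 hζ
    obtain ⟨m', hm', x', rfl⟩ := (hs.mem_adChart_source (c := c) hP hK).1 hζ'
    rw [h2 m hm, h2 m' hm', Prod.mk.injEq] at h
    rw [(cornerAtlas_isMfd hM).injOn c hc hm.2 hm'.2 h.1, h.2]
  good a ha := by
    obtain ⟨U, s, c, hc, hs, h1, h2⟩ := IsAdChart.exists_section hP hK ha
    rw [h1, IsAdChart.image_eq hP hK hs h2 Subset.rfl, prod_idChart_image]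
    have hA := cornerAtlas_isMfd hM
    have h3 : IsOpen (U ∩ c.source) := hs.isOpen.inter (hA.isOpen_source hc)
    exact (hA.good_image hc h3 inter_subset_right).prod_univ
  smooth a ha a' ha' := isAdChart_trans hP hK hM ha ha'
  chartAt_mem ζ := by
    obtain ⟨U, s, hm, hs⟩ := hP.exists_section hK hM (adProj π ζ)
    have hA := cornerAtlas_isMfd hM
    exact (Classical.epsilon_spec (p := fun a => IsAdChart n E K π a ∧ ζ ∈ a.source)
      ⟨_, hs.isAdChart hP hK (hA.chartAt_mem (adProj π ζ)), hm, hA.mem_chartAt _⟩).1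
  mem_chartAt ζ := by
    obtain ⟨U, s, hm, hs⟩ := hP.exists_section hK hM (adProj π ζ)
    have hA := cornerAtlas_isMfd hM
    exact (Classical.epsilon_spec (p := fun a => IsAdChart n E K π a ∧ ζ ∈ a.source)
      ⟨_, hs.isAdChart hP hK (hA.chartAt_mem (adProj π ζ)), hm, hA.mem_chartAt _⟩).2

namespace IsLocalSection

variable {U : Set M} {s : M → P} (hs : IsLocalSection n E π U s)
include hs

/-- In the product chart and the bundle chart of the same section this map is the identity; in the
next lemma the coordinate is the second projection. -/
lemma mSmoothOn_mk : MSmoothOn ((cornerAtlas n M).prod (selfAtlas E)) (adAtlas n E K π)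
    (fun q : M × E => AdBundle.mk K (s q.1) q.2) (U ×ˢ univ) := by
  have hA := cornerAtlas_isMfd hM
  have hE := selfAtlas_isMfd E
  have hAE := hA.prod hE
  refine mSmoothOn_of_local hAE (adAtlas_isMfd hP hK hM) (hs.isOpen.prod isOpen_univ) ?_
  rintro ⟨m, x⟩ ⟨hm, -⟩
  have hc := hA.chartAt_mem m
  have hcE := LCChart.prod_mem hc (idChart_mem E)
  set c := (cornerAtlas n M).chartAt m
  have hT : IsOpen (U ∩ c.source) := hs.isOpen.inter (hA.isOpen_source hc)
  refine ⟨_, hcE, _, hs.isAdChart hP hK hc, (U ∩ c.source) ×ˢ univ, hT.prod isOpen_univ,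
    ⟨⟨hm, hA.mem_chartAt m⟩, trivial⟩, fun q hq => ⟨hq.1.2, trivial⟩,
    fun q hq => (hs.mem_adChart_source hP hK).2 ⟨_, hq.1, _, rfl⟩,
    (IsSmoothOn.linear _ (ContinuousLinearMap.id ℝ _)).congr ?_⟩
  rintro _ ⟨q, hq, rfl⟩
  rw [rep_apply (hAE.injOn _ hcE) _ ⟨hq.1.2, trivial⟩, hs.adChart_mk hP hK hq.1.1]
  rfl

lemma mSmoothOn_adCoord : MSmoothOn (adAtlas n E K π) (selfAtlas E)
    (fun ζ => adCoord (s (adProj π ζ)) ζ) (adProj π ⁻¹' U) := by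
  have hA := cornerAtlas_isMfd hM
  have hE := selfAtlas_isMfd E
  have hD := adAtlas_isMfd hP hK hM
  refine mSmoothOn_of_local hD hE (hP.isOpen_adProj_preimage hK hs.isOpen) fun ζ hζ => ?_
  have hc := hA.chartAt_mem (adProj π ζ)
  set c := (cornerAtlas n M).chartAt (adProj π ζ)
  have ha := hs.isAdChart hP hK hc
  refine ⟨_, ha, _, idChart_mem E, (adChart π U s c).source, hD.isOpen_source ha,
    ⟨hζ, hA.mem_chartAt _⟩, Subset.rfl, fun _ _ => trivial,
    (IsSmoothOn.linear _ (ContinuousLinearMap.snd ℝ _ _)).congr ?_⟩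
  rintro _ ⟨q, hq, rfl⟩
  rw [rep_apply (hD.injOn _ ha) _ hq]
  rfl

end IsLocalSection

end AdAtlas

/-! ### Gluing equivariant functions from their values along local sections -/

section Glue

variable {n : ℕ} {E : Type u} [AddCommGroup E] [Module ℝ E] [TopologicalSpace E] [LCS E]
  {K : Type u} [Group K] [TopologicalSpace K] [ChartedSpace E K]
  {M : Type u} [TopologicalSpace M] [T2Space M] [ChartedSpace (EuclideanQuadrant n) M]
  {P : Type u} [TopologicalSpace P] [ChartedSpace (EuclideanQuadrant n × E) P]
  [MulAction Kᵐᵒᵖ P] {π : P → M}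
  (hP : IsSmoothPrincipalBundle n E K π) (hK : IsLCLieGroup E K)
  (hM : SmoothAtlas (cornerAtlas n M))

/-- The equivariant function on `π⁻¹(U)` whose value along the section `s` is `f`. -/
noncomputable def equivariantExt (K : Type u) [Group K] [TopologicalSpace K] [ChartedSpace E K]
    [MulAction Kᵐᵒᵖ P] (π : P → M) (s : M → P) (f : M → E) (p : P) : E :=
  Ad K (delta K (s (π p)) p)⁻¹ (f (π p))

lemma equivariantExt_eq (s : M → P) (f : M → E) : equivariantExt K π s f =
    (fun q : K × E => Ad K q.1 q.2) ∘ fun p => ((delta K (s (π p)) p)⁻¹, f (π p)) := rfl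

namespace IsLocalSection

variable {U : Set M} {s : M → P} (hs : IsLocalSection n E π U s)
include hs hP hK hM

lemma mSmoothOn_delta_inv : MSmoothOn (totalAtlas n E P) (groupAtlas E K)
    (fun p => (delta K (s (π p)) p)⁻¹) (π ⁻¹' U) :=
  hK.mSmoothOn_inv hP.isMfd (hs.isOpen.preimage hP.continuous_proj) (hs.mSmoothOn_delta hP hK hM)

lemma mSmoothOn_pair {f : M → E} (hf : MSmoothOn (cornerAtlas n M) (selfAtlas E) f U) :
    MSmoothOn (totalAtlas n E P) ((groupAtlas E K).prod (selfAtlas E))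
      (fun p => ((delta K (s (π p)) p)⁻¹, f (π p))) (π ⁻¹' U) :=
  have hE := selfAtlas_isMfd E
  have hU := hs.isOpen.preimage hP.continuous_proj
  (hs.mSmoothOn_delta_inv hP hK hM).prodMk hP.isMfd hK.isMfd hE hU
    (hf.comp hP.isMfd (cornerAtlas_isMfd hM) hE hU hs.isOpen (hP.smooth_proj.mSmoothOn _)
      fun _ h => h)

lemma mSmoothOn_equivariantExt {f : M → E}
    (hf : MSmoothOn (cornerAtlas n M) (selfAtlas E) f U) :
    MSmoothOn (totalAtlas n E P) (selfAtlas E) (equivariantExt K π s f) (π ⁻¹' U) := by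
  have hE := selfAtlas_isMfd E
  have hKE : IsOpen[((groupAtlas E K).prod (selfAtlas E)).top] univ :=
    let := ((groupAtlas E K).prod (selfAtlas E)).top
    isOpen_univ
  rw [equivariantExt_eq]
  exact (hK.mSmooth_Ad.mSmoothOn univ).comp hP.isMfd (hK.isMfd.prod hE) hE
    (hs.isOpen.preimage hP.continuous_proj) hKE (hs.mSmoothOn_pair hP hK hM hf) fun _ _ => trivial

/-- The extension is composition with π, pairing with a fixed smooth map into K, and composition
with the adjoint action, each of which preserves continuity of jets. -/
lemma jetCont_equivariantExt {T : Type*} [TopologicalSpace T] {F : T → M → E} {k : ℕ}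
    (hF : ∀ t, MSmoothOn (cornerAtlas n M) (selfAtlas E) (F t) U)
    (hJ : JetCont.{u, 0, u, u} k (cornerAtlas n M) (selfAtlas E) U F) :
    JetCont.{u, u, u, u} k (totalAtlas n E P) (selfAtlas E) (π ⁻¹' U)
      fun t => equivariantExt K π s (F t) := by
  have hE := selfAtlas_isMfd E
  have hA := cornerAtlas_isMfd hM
  have hU := hs.isOpen.preimage hP.continuous_proj
  have h1 : JetCont.{u, u, u, u} k (totalAtlas n E P) (selfAtlas E) (π ⁻¹' U)
      fun t => F t ∘ π :=
    JetCont.precomp.{u, u, u, 0, u, u, _} hP.isMfd hA hE hU hs.isOpen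
      (hP.smooth_proj.mSmoothOn _) (fun _ h => h) hF hJ
  have h2 := JetCont.prodMk.{u, u, u, u, u, u, _} hP.isMfd hK.isMfd hE (hP.t2Space hK) hU
    (fun _ => hs.mSmoothOn_delta_inv hP hK hM)
    (fun t => (hF t).comp hP.isMfd hA hE hU hs.isOpen (hP.smooth_proj.mSmoothOn _) fun _ h => h)
    (jetCont_const.{u, u, u, u, _} (T := T) (k := k) (A := totalAtlas n E P)
      (B := groupAtlas E K) (U := π ⁻¹' U) fun p => (delta K (s (π p)) p)⁻¹) h1
  have hKE : IsOpen[((groupAtlas E K).prod (selfAtlas E)).top] univ :=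
    let := ((groupAtlas E K).prod (selfAtlas E)).top
    isOpen_univ
  simp only [equivariantExt_eq]
  exact JetCont.postcomp.{u, u, u, u, u, u, _} hP.isMfd (hK.isMfd.prod hE) hE hU hKE
    (hK.mSmooth_Ad.mSmoothOn univ) (fun t => hs.mSmoothOn_pair hP hK hM (hF t))
    (fun _ _ _ => trivial) h2

end IsLocalSection

include hP in
lemma equivariantExt_apply (hK : IsLCLieGroup E K) {s : M → P} {m : M} (h : π (s m) = m)
    (f : M → E) : equivariantExt K π s f (s m) = f m := by
  rw [equivariantExt, h, hP.delta_self, inv_one, hK.Ad_one]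

variable {ι : Type*} {U : ι → Set M} {s : ι → M → P} (hs : ∀ i, IsLocalSection n E π (U i) (s i))
  (hU : ⋃ i, U i = univ)

include hP hK hs hU in
lemma gaugeAlgebra_ext {η η' : gaugeAlgebra n E K P}
    (h : ∀ i, ∀ m ∈ U i, η.1.1 (s i m) = η'.1.1 (s i m)) : η = η' := by
  refine Subtype.ext (Subtype.ext (funext fun p => ?_))
  obtain ⟨i, hi⟩ := mem_iUnion.1 (hU.symm.subset (mem_univ (π p)))
  have hp := hP.smul_delta ((hs i).proj _ hi)
  rw [← hp, η.2, η'.2, h i _ hi]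

include hP hK hM hs hU in
-- The common inverse construction. The parameter space `T` is arbitrary, so one statement gives
-- existence of the equivariant function and its continuous dependence on the data, both for
-- sections of Ad(P) and for families.
lemma exists_glue {T : Type*} [TopologicalSpace T] (F : T → ι → M → E)
    (hF : ∀ t i, MSmoothOn (cornerAtlas n M) (selfAtlas E) (F t i) (U i))
    (hJ : ∀ i k, JetCont.{u, 0, u, u} k (cornerAtlas n M) (selfAtlas E) (U i) fun t => F t i)
    (hc : ∀ t i j, ∀ m ∈ U i ∩ U j, ∀ k : K, s i m <• k = s j m →
      F t i m = Ad K k (F t j m)) :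
    ∃ Ψ : T → gaugeAlgebra n E K P, Continuous Ψ ∧
      ∀ t i, ∀ m ∈ U i, (Ψ t).1.1 (s i m) = F t i m := by
  have hcov : ∀ m, ∃ i, m ∈ U i := fun m => mem_iUnion.1 (hU.symm.subset (mem_univ m))
  -- An arbitrary index for each point of the base; `key` shows by the compatibility condition that
  -- the choice has no effect.
  choose j hj using hcov
  have hE := selfAtlas_isMfd E
  have hUP : ∀ i, IsOpen (π ⁻¹' U i) := fun i => (hs i).isOpen.preimage hP.continuous_proj
  set f : T → P → E := fun t p => equivariantExt K π (s (j (π p))) (F t (j (π p))) p with hf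
  have key : ∀ t i, EqOn (equivariantExt K π (s i) (F t i)) (f t) (π ⁻¹' U i) := by
    intro t i p hp
    have h1 : π (s i (π p)) = π (s (j (π p)) (π p)) :=
      ((hs i).proj _ hp).trans ((hs _).proj _ (hj _)).symm
    simp only [hf, equivariantExt]
    rw [hc t i (j (π p)) (π p) ⟨hp, hj _⟩ _ (hP.smul_delta h1),
      hP.delta_mul h1 ((hs _).proj _ (hj _)), mul_inv_rev, hK.Ad_mul, hK.Ad_inv_Ad]
  have hsm : ∀ t i, MSmoothOn (totalAtlas n E P) (selfAtlas E) (f t) (π ⁻¹' U i) := fun t i =>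
    ((hs i).mSmoothOn_equivariantExt hP hK hM (hF t i)).congr hP.isMfd (key t i)
  have hsm' : ∀ t, MSmooth (totalAtlas n E P) (selfAtlas E) (f t) := fun t =>
    mSmoothOn_of_nhds hP.isMfd hE isOpen_univ fun p _ =>
      ⟨_, hUP (j (π p)), hj (π p), hsm t _⟩
  refine ⟨fun t => ⟨⟨f t, hsm' t⟩, fun p k => ?_⟩, ?_, fun t i m hm => ?_⟩
  · change f t (p <• k) = Ad K k⁻¹ (f t p)
    simp only [hf, equivariantExt, hP.proj_action]
    rw [hP.delta_smul ((hs _).proj _ (hj _)), mul_inv_rev, hK.Ad_mul]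
  · refine Continuous.subtype_mk (continuous_smoothMap_iff.{u, u, u, u}.2 fun k => ?_) _
    -- Continuity is checked over each π⁻¹(U i), where the glued function is the explicit extension
    -- along one section.
    have h1 := JetCont.iUnion.{u, u, u, u, _} hP.isMfd (hP.t2Space hK) hUP fun i =>
      ((hs i).jetCont_equivariantExt hP hK hM (hF · i) (hJ i k)).congr hP.isMfd (hUP i)
        (key · i)
    rwa [← preimage_iUnion, hU, preimage_univ] at h1
  · have hm' : s i m ∈ π ⁻¹' U i := by rwa [mem_preimage, (hs i).proj m hm]
    exact (key t i hm').symm.trans (equivariantExt_apply hP hK ((hs i).proj m hm) _)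

end Glue

/-! ### Passage between functions on an open subset and their extensions to the whole manifold -/

section Extend

variable {T : Type*} [TopologicalSpace T]
  {X : Type v₁} {M : Type (max u₁ v₁)} {Y : Type v₂} {N : Type (max u₂ v₂)}
  [AddCommGroup X] [Module ℝ X] [TopologicalSpace X]
  [AddCommGroup Y] [Module ℝ Y] [TopologicalSpace Y] [LCS X] [LCS Y]
  {A : LCAtlas X M} {B : LCAtlas Y N} {U : Set M}

/-- A map from the whole of `M`, smooth on `U` and the identity there, turns statements about the
subtype `U` into statements on a subset of `M` by mere precomposition. -/
lemma exists_retraction (hA : A.IsMfd) (hU : IsOpen[A.top] U) (hne : U.Nonempty) :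
    ∃ r : M → U, MSmoothOn A (A.restrict U) r U ∧ ∀ x (h : x ∈ U), r x = ⟨x, h⟩ := by
  classical
  obtain ⟨y, hy⟩ := hne
  have h : ∀ x (h : x ∈ U), (if h : x ∈ U then ⟨x, h⟩ else ⟨y, hy⟩ : U) = ⟨x, h⟩ :=
    fun x h => dif_pos h
  exact ⟨_, mSmoothOn_retraction hA hU fun x hx => congrArg Subtype.val (h x hx), h⟩

lemma isOpen_univ_restrict : IsOpen[(A.restrict U).top] univ :=
  let := (A.restrict U).top
  isOpen_univ

lemma MSmooth.mSmoothOn_extension (hA : A.IsMfd) (hB : B.IsMfd) (hU : IsOpen[A.top] U) {f : U → N}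
    (hf : MSmooth (A.restrict U) B f) {g : M → N} (h : ∀ x (h : x ∈ U), f ⟨x, h⟩ = g x) :
    MSmoothOn A B g U := by
  refine mSmoothOn_of_nhds hA hB hU fun x hx => ⟨U, hU, hx, ?_⟩
  obtain ⟨r, hr, hr'⟩ := exists_retraction hA hU ⟨x, hx⟩
  refine (MSmoothOn.comp hA (hA.restrict hU) hB hU isOpen_univ_restrict hf hr
    fun _ _ => trivial).congr hA fun y hy => ?_
  rw [Function.comp, hr' y hy, h]

lemma JetCont.extension (hA : A.IsMfd) (hA2 : @T2Space M A.top) (hB : B.IsMfd)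
    (hU : IsOpen[A.top] U) {F : T → U → N} (hF : ∀ t, MSmooth (A.restrict U) B (F t)) {k : ℕ}
    (hJ : JetCont.{u₁, v₁, u₂, v₂} k (A.restrict U) B univ F) {G : T → M → N}
    (h : ∀ t x (h : x ∈ U), F t ⟨x, h⟩ = G t x) : JetCont.{u₁, v₁, u₂, v₂} k A B U G := by
  rcases U.eq_empty_or_nonempty with rfl | hne
  -- With `U` empty there is no retraction; continuity of jets over the empty set is the case of a
  -- union over no indices.
  · have := JetCont.iUnion.{u₁, v₁, u₂, v₂, _} (k := k) (B := B) (F := G) hA hA2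
      (U := fun _ : Empty => ∅) (fun i => i.elim) fun i => i.elim
    rwa [iUnion_of_empty] at this
  · obtain ⟨r, hr, hr'⟩ := exists_retraction hA hU hne
    refine (JetCont.precomp.{u₁, v₁, u₁, v₁, u₂, v₂, _} hA (hA.restrict hU) hB hU
      isOpen_univ_restrict hr (fun _ _ => trivial) hF hJ).congr hA hU fun t x hx => ?_
    rw [Function.comp, hr' x hx, h]

end Extend

/-! ### The three homeomorphisms -/

section Homeo

variable {n : ℕ} {E : Type u} [AddCommGroup E] [Module ℝ E] [TopologicalSpace E] [LCS E]
  {K : Type u} [Group K] [TopologicalSpace K] [ChartedSpace E K]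
  {M : Type u} [TopologicalSpace M] [T2Space M] [ChartedSpace (EuclideanQuadrant n) M]
  {P : Type u} [TopologicalSpace P] [ChartedSpace (EuclideanQuadrant n × E) P]
  [MulAction Kᵐᵒᵖ P] {π : P → M}
  (hP : IsSmoothPrincipalBundle n E K π) (hK : IsLCLieGroup E K)
  (hM : SmoothAtlas (cornerAtlas n M)) {I : Type w} (𝒱 : ClosedTrivSystem n E π I)

lemma jetCont_gaugeAlgebra (k : ℕ) : JetCont.{u, u, u, u} k (totalAtlas n E P) (selfAtlas E) univ
    fun η : gaugeAlgebra n E K P => η.1.1 :=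
  continuous_smoothMap_iff.{u, u, u, u}.1 continuous_subtype_val k

lemma jetCont_adSections (k : ℕ) : JetCont.{u, 0, u, u} k (cornerAtlas n M) (adAtlas n E K π) univ
    fun ξ : adSections n E K π => ξ.1.1 :=
  continuous_smoothMap_iff.{u, 0, u, u}.1 continuous_subtype_val k

section Sections

include hP hK hM

lemma mSmooth_mk_section {η : P → E} (hη : MSmooth (totalAtlas n E P) (selfAtlas E) η)
    {U : Set M} {s : M → P} (hs : IsLocalSection n E π U s) :
    MSmoothOn (cornerAtlas n M) ((cornerAtlas n M).prod (selfAtlas E))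
      (fun m => (m, η (s m))) U := by
  have hA := cornerAtlas_isMfd hM
  have hE := selfAtlas_isMfd E
  exact ((mSmooth_id hA).mSmoothOn U).prodMk hA hA hE hs.isOpen
    (hη.comp hA hP.isMfd hE hs.isOpen isOpen_univ hs.smooth fun _ _ => trivial)

/-- Locally a section of Ad(P) is m ↦ [s(m), η(s(m))]. One direction composes with this smooth
parametrisation; the other glues the coordinates of the section with respect to local sections of P.
-/
lemma exists_gauge_adSections_homeomorph : ∃ h : gaugeAlgebra n E K P ≃ₜ adSections n E K π,
    ∀ η p, (h η).1.1 (π p) = AdBundle.mk K p (η.1.1 p) := by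
  have hA := cornerAtlas_isMfd hM
  have hE := selfAtlas_isMfd E
  have hD := adAtlas_isMfd hP hK hM
  choose U s hm hs using hP.exists_section hK hM
  have hU : ⋃ i, U i = univ := eq_univ_of_forall fun m => mem_iUnion.2 ⟨m, hm m⟩
  -- There is one local section for each point of M, used here only at that point; by equivariance
  -- any other point of the fibre gives the same class.
  set f : (P → E) → M → AdBundle E K P := fun η m => AdBundle.mk K (s m m) (η (s m m)) with hf
  have hf' : ∀ (η : gaugeAlgebra n E K P) p, f η.1.1 (π p) = AdBundle.mk K p (η.1.1 p) := by
    intro η p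
    obtain ⟨k, hk⟩ := hP.exists_smul_eq ((hs (π p)).proj _ (hm _))
    simp only [hf]
    conv_rhs => rw [hk, η.2, AdBundle.mk_smul hK, hK.Ad_Ad_inv]
  have hfs : ∀ (η : gaugeAlgebra n E K P) i, EqOn ((fun q : M × E => AdBundle.mk K (s i q.1) q.2) ∘
      fun m => (m, η.1.1 (s i m))) (f η.1.1) (U i) := fun η i m hmi => by
    have := hf' η (s i m)
    rw [(hs i).proj m hmi] at this
    exact this.symm
  have hUE : ∀ i, IsOpen[((cornerAtlas n M).prod (selfAtlas E)).top] (U i ×ˢ (univ : Set E)) :=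
    fun i => (hs i).isOpen.prod isOpen_univ
  have hsm : ∀ η : gaugeAlgebra n E K P, MSmooth (cornerAtlas n M) (adAtlas n E K π) (f η.1.1) :=
    fun η => mSmoothOn_of_nhds hA hD isOpen_univ fun m _ => ⟨U m, (hs m).isOpen, hm m,
      (((hs m).mSmoothOn_mk hP hK hM).comp hA (hA.prod hE) hD (hs m).isOpen (hUE m)
        (mSmooth_mk_section hP hK hM η.1.2 (hs m)) fun _ h => ⟨h, trivial⟩).congr hA (hfs η m)⟩
  set Φ : gaugeAlgebra n E K P → adSections n E K π := fun η => ⟨⟨f η.1.1, hsm η⟩, fun m =>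
    ⟨s m m, η.1.1 (s m m), (hs m).proj m (hm m), rfl⟩⟩ with hΦ
  have hΦc : Continuous Φ := by
    refine Continuous.subtype_mk (continuous_smoothMap_iff.{u, 0, u, u}.2 fun k => ?_) _
    rw [← hU]
    refine JetCont.iUnion.{u, 0, u, u, _} hA ‹_› (fun i => (hs i).isOpen) fun i => ?_
    have h1 : JetCont.{u, 0, u, u} k (cornerAtlas n M) (selfAtlas E) (U i)
        fun η : gaugeAlgebra n E K P => η.1.1 ∘ s i :=
      JetCont.precomp.{u, 0, u, u, u, u, _} hA hP.isMfd hE (hs i).isOpen isOpen_univ (hs i).smooth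
        (fun _ _ => trivial) (fun η => η.1.2) (jetCont_gaugeAlgebra k)
    have h2 := JetCont.prodMk.{u, 0, u, 0, u, u, _} hA hA hE ‹_› (hs i).isOpen
      (fun _ => (mSmooth_id hA).mSmoothOn _)
      (fun η : gaugeAlgebra n E K P => MSmoothOn.comp hA hP.isMfd hE (hs i).isOpen isOpen_univ
        η.1.2 (hs i).smooth fun _ _ => trivial)
      (jetCont_const.{u, 0, u, 0, _} _) h1
    exact (JetCont.postcomp.{u, 0, u, u, u, u, _} hA (hA.prod hE) hD (hs i).isOpen (hUE i)
      ((hs i).mSmoothOn_mk hP hK hM)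
      (fun η : gaugeAlgebra n E K P => mSmooth_mk_section hP hK hM η.1.2 (hs i))
      (fun _ _ h => ⟨h, trivial⟩) h2).congr hA (hs i).isOpen fun η => hfs η i
  have hproj : ∀ (ξ : adSections n E K π) m, adProj π (ξ.1.1 m) = m := fun ξ m => by
    obtain ⟨p, x, h1, h2⟩ := ξ.2 m
    rw [h2, hP.adProj_mk hK, h1]
  have hDU : ∀ i, IsOpen[(adAtlas n E K π).top] (adProj π ⁻¹' U i) := fun i =>
    hP.isOpen_adProj_preimage hK (hs i).isOpen
  have hmaps : ∀ (ξ : adSections n E K π) i, MapsTo ξ.1.1 (U i) (adProj π ⁻¹' U i) :=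
    fun ξ i m h => by rwa [mem_preimage, hproj]
  have heq : ∀ (ξ : adSections n E K π) i, EqOn ((fun ζ => adCoord (s i (adProj π ζ)) ζ) ∘ ξ.1.1)
      (fun m => adCoord (s i m) (ξ.1.1 m)) (U i) := fun ξ i m _ => by
    simp only [Function.comp, hproj]
  obtain ⟨Ψ, hΨ, hΨs⟩ := exists_glue hP hK hM hs hU
    (fun (ξ : adSections n E K π) i m => adCoord (s i m) (ξ.1.1 m))
    (fun ξ i => (((hs i).mSmoothOn_adCoord hP hK hM).comp hA hD hE (hs i).isOpen (hDU i)
      (ξ.1.2.mSmoothOn _) (hmaps ξ i)).congr hA (heq ξ i))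
    (fun i k => (JetCont.postcomp.{u, 0, u, u, u, u, _} hA hD hE (hs i).isOpen (hDU i)
      ((hs i).mSmoothOn_adCoord hP hK hM) (fun ξ : adSections n E K π => ξ.1.2.mSmoothOn _)
      (fun ξ => hmaps ξ i) (JetCont.mono.{u, 0, u, u, _} (jetCont_adSections k) (subset_univ _))).congr hA (hs i).isOpen
      fun ξ => heq ξ i)
    (by
      -- The coordinates with respect to two sections differ by Ad of the transition element, by the
      -- cocycle identity of the division map.
      rintro ξ i j m ⟨hi, hj⟩ k hk
      obtain ⟨p, x, h1, h2⟩ := ξ.2 m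
      rw [h2, hP.adCoord_mk' hK (((hs i).proj m hi).trans h1.symm),
        hP.adCoord_mk' hK (((hs j).proj m hj).trans h1.symm), ← hK.Ad_mul, ← hP.delta_eq hk,
        ← hP.delta_mul (((hs i).proj m hi).trans ((hs j).proj m hj).symm)
          (((hs j).proj m hj).trans h1.symm)])
  refine ⟨⟨⟨Φ, Ψ, fun η => gaugeAlgebra_ext hP hK hs hU fun i m hi => ?_, fun ξ => ?_⟩, hΦc, hΨ⟩, hf'⟩
  · rw [hΨs _ i m hi]
    change adCoord (s i m) (f η.1.1 m) = _
    rw [← hfs η i hi]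
    exact hP.adCoord_mk hK _ _
  · refine Subtype.ext (Subtype.ext (funext fun m => ?_))
    change AdBundle.mk K (s m m) ((Ψ ξ).1.1 (s m m)) = ξ.1.1 m
    rw [hΨs ξ m m (hm m), hP.mk_adCoord hK]
    rw [hproj, (hs m).proj m (hm m)]

end Sections

section Families

include hP hK hM

namespace ClosedTrivSystem

lemma isMfd_restrict (i : I) : ((cornerAtlas n M).restrict (𝒱.V i)).IsMfd :=
  (cornerAtlas_isMfd hM).restrict (𝒱.isOpen_V i)

lemma mSmooth_σ_inclusion (i : I) :
    MSmooth ((cornerAtlas n M).restrict (𝒱.V i)) (totalAtlas n E P)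
      (fun m => 𝒱.σ i (inclusion subset_closure m)) :=
  MSmoothOn.comp (𝒱.isMfd_restrict hP hK hM i) (cornerAtlas_isMfd (𝒱.smoothAtlas i)) hP.isMfd
    isOpen_univ_restrict isOpen_univ (𝒱.smooth_σ i) (𝒱.smooth_incl_open i) fun _ _ => trivial

open Classical in
/-- The sections over the open sets of the system, extended by arbitrary values. -/
noncomputable def extσ (i : I) (m : M) : P :=
  if h : m ∈ 𝒱.V i then 𝒱.σ i ⟨m, subset_closure h⟩ else (hP.surjective_proj hK hM m).choose

lemma extσ_apply (i : I) {m : M} (h : m ∈ 𝒱.V i) :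
    𝒱.extσ hP hK hM i m = 𝒱.σ i ⟨m, subset_closure h⟩ := dif_pos h

lemma isLocalSection (i : I) : IsLocalSection n E π (𝒱.V i) (𝒱.extσ hP hK hM i) where
  isOpen := 𝒱.isOpen_V i
  smooth := (𝒱.mSmooth_σ_inclusion hP hK hM i).mSmoothOn_extension (cornerAtlas_isMfd hM) hP.isMfd
    (𝒱.isOpen_V i) fun _ h => (𝒱.extσ_apply hP hK hM i h).symm
  proj m hm := by rw [extσ_apply hP hK hM 𝒱 i hm, 𝒱.proj_σ]

/-- The restriction of equivariant functions to the sections over the open sets of the system. -/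
noncomputable def toOpen (η : gaugeAlgebra n E K P) : openFamilies K 𝒱 :=
  ⟨fun i => ⟨fun m => η.1.1 (𝒱.σ i ⟨m, subset_closure m.2⟩),
    MSmoothOn.comp (𝒱.isMfd_restrict hP hK hM i) hP.isMfd (selfAtlas_isMfd E)
      isOpen_univ_restrict isOpen_univ η.1.2 (𝒱.mSmooth_σ_inclusion hP hK hM i)
      fun _ _ => trivial⟩,
    fun i j m hi hj k h => by
      change η.1.1 _ = Ad K k (η.1.1 _)
      rw [← h, η.2, hK.Ad_Ad_inv]⟩

/-- The restriction of equivariant functions to the sections over the closed sets of the system. -/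
noncomputable def toClosed (η : gaugeAlgebra n E K P) : closedFamilies K 𝒱 :=
  ⟨fun i => ⟨fun m => η.1.1 (𝒱.σ i m),
    MSmoothOn.comp (cornerAtlas_isMfd (𝒱.smoothAtlas i)) hP.isMfd (selfAtlas_isMfd E)
      isOpen_univ isOpen_univ η.1.2 (𝒱.smooth_σ i) fun _ _ => trivial⟩,
    fun i j m hi hj k h => by
      change η.1.1 _ = Ad K k (η.1.1 _)
      rw [← h, η.2, hK.Ad_Ad_inv]⟩

/-- The restriction of families on the closed sets to the open sets of the system. -/
noncomputable def closedToOpen (f : closedFamilies K 𝒱) : openFamilies K 𝒱 :=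
  ⟨fun i => ⟨fun m => (f.1 i).1 (inclusion subset_closure m),
    MSmoothOn.comp (𝒱.isMfd_restrict hP hK hM i) (cornerAtlas_isMfd (𝒱.smoothAtlas i))
      (selfAtlas_isMfd E) isOpen_univ_restrict isOpen_univ (f.1 i).2 (𝒱.smooth_incl_open i)
      fun _ _ => trivial⟩,
    fun i j m hi hj k h => f.2 i j m (subset_closure hi) (subset_closure hj) k h⟩

lemma continuous_toOpen : Continuous (𝒱.toOpen hP hK hM) := by
  refine Continuous.subtype_mk (continuous_pi fun i =>
    continuous_smoothMap_iff.{u, 0, u, u}.2 fun k => ?_) _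
  exact JetCont.precomp.{u, 0, u, u, u, u, _} (𝒱.isMfd_restrict hP hK hM i) hP.isMfd
    (selfAtlas_isMfd E) isOpen_univ_restrict isOpen_univ (𝒱.mSmooth_σ_inclusion hP hK hM i)
    (fun _ _ => trivial) (fun η => η.1.2) (jetCont_gaugeAlgebra k)

lemma continuous_toClosed : Continuous (𝒱.toClosed hP hK) := by
  refine Continuous.subtype_mk (continuous_pi fun i =>
    continuous_smoothMap_iff.{u, 0, u, u}.2 fun k => ?_) _
  exact JetCont.precomp.{u, 0, u, u, u, u, _} (cornerAtlas_isMfd (𝒱.smoothAtlas i)) hP.isMfd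
    (selfAtlas_isMfd E) isOpen_univ isOpen_univ (𝒱.smooth_σ i)
    (fun _ _ => trivial) (fun η => η.1.2) (jetCont_gaugeAlgebra k)

lemma continuous_closedToOpen : Continuous (𝒱.closedToOpen hP hK hM) := by
  refine Continuous.subtype_mk (continuous_pi fun i =>
    continuous_smoothMap_iff.{u, 0, u, u}.2 fun k => ?_) _
  exact JetCont.precomp.{u, 0, u, 0, u, u, _} (𝒱.isMfd_restrict hP hK hM i)
    (cornerAtlas_isMfd (𝒱.smoothAtlas i)) (selfAtlas_isMfd E) isOpen_univ_restrict isOpen_univ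
    (𝒱.smooth_incl_open i) (fun _ _ => trivial) (fun f => (f.1 i).2)
    (continuous_smoothMap_iff.{u, 0, u, u}.1
      ((continuous_apply i).comp continuous_subtype_val) k)

open Classical in
lemma exists_gauge_of_openFamilies : ∃ Ψ : openFamilies K 𝒱 → gaugeAlgebra n E K P,
    Continuous Ψ ∧ ∀ f i (m : 𝒱.V i), (Ψ f).1.1 (𝒱.σ i ⟨m, subset_closure m.2⟩) = (f.1 i).1 m := by
  have hA := cornerAtlas_isMfd hM
  have hE := selfAtlas_isMfd E
  set G : openFamilies K 𝒱 → I → M → E := fun f i m =>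
    if h : m ∈ 𝒱.V i then (f.1 i).1 ⟨m, h⟩ else 0 with hG
  have hG' : ∀ f i m (h : m ∈ 𝒱.V i), (f.1 i).1 ⟨m, h⟩ = G f i m := fun f i m h => by
    simp only [hG, dif_pos h]
  obtain ⟨Ψ, hΨ, hΨs⟩ := exists_glue hP hK hM (𝒱.isLocalSection hP hK hM) 𝒱.cover G
    (fun f i => (f.1 i).2.mSmoothOn_extension hA hE (𝒱.isOpen_V i) (hG' f i))
    (fun i k => JetCont.extension.{u, 0, u, u, _} hA ‹_› hE (𝒱.isOpen_V i)
      (F := fun f : openFamilies K 𝒱 => (f.1 i).1) (fun f => (f.1 i).2)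
      (continuous_smoothMap_iff.{u, 0, u, u}.1
        ((continuous_apply i).comp continuous_subtype_val) k) fun f => hG' f i)
    fun f i j m hm k hk => by
      rw [← hG' f i m hm.1, ← hG' f j m hm.2]
      rw [extσ_apply hP hK hM 𝒱 i hm.1, extσ_apply hP hK hM 𝒱 j hm.2] at hk
      exact f.2 i j m hm.1 hm.2 k hk
  refine ⟨Ψ, hΨ, fun f i m => ?_⟩
  rw [← extσ_apply hP hK hM 𝒱 i m.2, hΨs f i m m.2, ← hG' f i m m.2]

lemma gauge_ext {η η' : gaugeAlgebra n E K P} (h : ∀ i (m : 𝒱.V i),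
    η.1.1 (𝒱.σ i ⟨m, subset_closure m.2⟩) = η'.1.1 (𝒱.σ i ⟨m, subset_closure m.2⟩)) : η = η' :=
  gaugeAlgebra_ext hP hK (𝒱.isLocalSection hP hK hM) 𝒱.cover fun i m hm => by
    rw [extσ_apply hP hK hM 𝒱 i hm]
    exact h i ⟨m, hm⟩

lemma exists_gauge_openFamilies_homeomorph : ∃ h : gaugeAlgebra n E K P ≃ₜ openFamilies K 𝒱,
    ∀ η i (m : 𝒱.V i), ((h η).1 i).1 m = η.1.1 (𝒱.σ i ⟨m, subset_closure m.2⟩) := by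
  obtain ⟨Ψ, hΨ, hΨs⟩ := 𝒱.exists_gauge_of_openFamilies hP hK hM
  exact ⟨⟨⟨𝒱.toOpen hP hK hM, Ψ, fun η => 𝒱.gauge_ext hP hK hM fun i m => hΨs _ i m,
    fun f => Subtype.ext (funext fun i => Subtype.ext (funext fun m => hΨs f i m))⟩,
    𝒱.continuous_toOpen hP hK hM, hΨ⟩, fun _ _ _ => rfl⟩

/-- The inverse restricts a closed family to the open sets and glues there, so its continuity comes
for free. That it is an inverse on the closures holds because both functions are continuous and
agree on the dense subset V i. -/
lemma exists_gauge_closedFamilies_homeomorph : ∃ h : gaugeAlgebra n E K P ≃ₜ closedFamilies K 𝒱,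
    ∀ η i m, ((h η).1 i).1 m = η.1.1 (𝒱.σ i m) := by
  obtain ⟨Ψ, hΨ, hΨs⟩ := 𝒱.exists_gauge_of_openFamilies hP hK hM
  refine ⟨⟨⟨𝒱.toClosed hP hK, Ψ ∘ 𝒱.closedToOpen hP hK hM,
    fun η => 𝒱.gauge_ext hP hK hM fun i m => hΨs _ i m,
    fun f => Subtype.ext (funext fun i => Subtype.ext ?_)⟩,
    𝒱.continuous_toClosed hP hK hM, hΨ.comp (𝒱.continuous_closedToOpen hP hK hM)⟩,
    fun _ _ _ => rfl⟩
  have hd : DenseRange (inclusion (subset_closure : 𝒱.V i ⊆ closure (𝒱.V i))) := by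
    rw [denseRange_inclusion_iff]
  have hc : ∀ g : SmoothMap.{u, 0, u, u} (cornerAtlas n (closure (𝒱.V i))) (selfAtlas E),
      Continuous g.1 := fun g => continuousOn_univ.1 g.2.1
  exact hd.equalizer (hc _) (hc _) (funext fun m => hΨs _ i m)

end ClosedTrivSystem

end Families

end Homeo

/-! ### Transport of Lie algebra structures along homeomorphisms -/

section Transport

variable {L L' : Type*} [TopologicalSpace L] [LieRing L] [LieAlgebra ℝ L] [TopologicalSpace L']

lemma IsLCLieAlgebra.of_isLCTop (h : IsLCTop L ‹_›) (h2 : T2Space L)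
    (hb : Continuous fun p : L × L => ⁅p.1, p.2⁆) : IsLCLieAlgebra L :=
  ⟨h.1, h.2.1, h.2.2, h2, hb⟩

/-- The structure on L' is the one making `h` an isomorphism; its topology is then induced by a
linear map into L, hence locally convex. That the operations are the natural ones is a separate
matter, settled from the formula for `h`. -/
lemma IsLCLieAlgebra.exists_transport (hL : IsLCLieAlgebra L) (h : L ≃ₜ L') :
    ∃ (_ : LieRing L') (_ : LieAlgebra ℝ L'), IsLCLieAlgebra L' ∧
      ∃ Φ : L ≃ₗ⁅ℝ⁆ L', IsHomeomorph Φ ∧ ∀ a, Φ a = h a := by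
  let : AddCommGroup L' := h.symm.toEquiv.addCommGroup
  let : Module ℝ L' := h.symm.toEquiv.module ℝ
  let φ : L' ≃ₗ[ℝ] L := h.symm.toEquiv.linearEquiv ℝ
  let : LieRing L' :=
    { bracket := fun a b => φ.symm ⁅φ a, φ b⁆
      add_lie := fun a b c => by simp
      lie_add := fun a b c => by simp
      lie_self := fun a => by simp
      leibniz_lie := fun a b c => by simp }
  have hbr : ∀ a b : L', φ ⁅a, b⁆ = ⁅φ a, φ b⁆ := fun a b => φ.apply_symm_apply _
  let : LieAlgebra ℝ L' := { lie_smul := fun r a b => φ.injective (by simp [hbr]) }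
  have := hL.t2
  refine ⟨inferInstance, inferInstance, .of_isLCTop ?_ h.t2Space ?_,
    { φ.symm with map_lie' := fun {a b} => ?_ }, h.isHomeomorph, fun _ => rfl⟩
  · rw [h.symm.isInducing.eq_induced]
    exact IsLCTop.induced ⟨hL.1, hL.2, hL.3⟩ φ.toLinearMap
  · exact h.continuous.comp (hL.5.comp ((h.symm.continuous.comp continuous_fst).prodMk
      (h.symm.continuous.comp continuous_snd)))
  · exact φ.injective (by simp [hbr])

end Transport

section TransportOperations

variable {L L' J J' E : Type*} [LieRing L] [LieAlgebra ℝ L] [LieRing L'] [LieAlgebra ℝ L']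
  [AddCommGroup E] [Module ℝ E] {br : E → E → E} {ev : L → J → E}

lemma PointwiseLie.transport (h : PointwiseLie br ev) (Φ : L ≃ₗ⁅ℝ⁆ L') (g : J' → J)
    {ev' : L' → J' → E} (hev : ∀ a j, ev' (Φ a) j = ev a (g j)) : PointwiseLie br ev' where
  add a b j := by
    obtain ⟨a, rfl⟩ : ∃ c, Φ c = a := Φ.surjective a
    obtain ⟨b, rfl⟩ : ∃ c, Φ c = b := Φ.surjective b
    rw [← map_add, hev, hev, hev, h.add]
  smul r a j := by
    obtain ⟨a, rfl⟩ : ∃ c, Φ c = a := Φ.surjective a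
    rw [← map_smul, hev, hev, h.smul]
  lie a b j := by
    obtain ⟨a, rfl⟩ : ∃ c, Φ c = a := Φ.surjective a
    obtain ⟨b, rfl⟩ : ∃ c, Φ c = b := Φ.surjective b
    rw [← LieEquiv.map_lie, hev, hev, hev, h.lie]

/-- The representative of a class over a fixed p is unique, so the hypotheses on representatives
determine the values of the equivariant functions. -/
lemma PointwiseLie.fibrewiseLie {M F : Type*} (h : PointwiseLie br ev) (Φ : L ≃ₗ⁅ℝ⁆ L')
    {mk : J → E → F} (hmk : ∀ p x y, mk p x = mk p y → x = y) {π : J → M} {ev' : L' → M → F}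
    (hev : ∀ a p, ev' (Φ a) (π p) = mk p (ev a p)) : FibrewiseLie mk π br ev' where
  add a b p x y hx hy := by
    obtain ⟨a, rfl⟩ : ∃ c, Φ c = a := Φ.surjective a
    obtain ⟨b, rfl⟩ : ∃ c, Φ c = b := Φ.surjective b
    rw [hev] at hx hy
    rw [← map_add, hev, h.add, hmk _ _ _ hx, hmk _ _ _ hy]
  smul r a p x hx := by
    obtain ⟨a, rfl⟩ : ∃ c, Φ c = a := Φ.surjective a
    rw [hev] at hx
    rw [← map_smul, hev, h.smul, hmk _ _ _ hx]
  lie a b p x y hx hy := by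
    obtain ⟨a, rfl⟩ : ∃ c, Φ c = a := Φ.surjective a
    obtain ⟨b, rfl⟩ : ∃ c, Φ c = b := Φ.surjective b
    rw [hev] at hx hy
    rw [← LieEquiv.map_lie, hev, h.lie, hmk _ _ _ hx, hmk _ _ _ hy]

end TransportOperations

/-! ### The gauge algebra as a locally convex Lie algebra -/

section Gauge

variable {n : ℕ} {E : Type u} [AddCommGroup E] [Module ℝ E] [TopologicalSpace E] [LCS E]
  {K : Type u} [Group K] [TopologicalSpace K] [ChartedSpace E K]
  {M : Type u} [TopologicalSpace M] [ChartedSpace (EuclideanQuadrant n) M]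
  {P : Type u} [TopologicalSpace P] [ChartedSpace (EuclideanQuadrant n × E) P]
  [MulAction Kᵐᵒᵖ P] {π : P → M}
  (hP : IsSmoothPrincipalBundle n E K π) (hK : IsLCLieGroup E K)

include hK in
lemma IsLCLieGroup.mSmooth_lieBr : MSmooth ((selfAtlas E).prod (selfAtlas E)) (selfAtlas E)
    (fun q : E × E => lieBr K q.1 q.2) := by
  obtain ⟨β, hβ⟩ := hK.exists_lieBr_bilinear
  have hc := hK.continuous_lieBr
  simp only [← hβ] at hc ⊢
  rw [selfAtlas_prod]
  exact mSmoothOn_selfAtlas isOpen_univ (.bilinear β hc)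

/-- The gauge algebra as a space of functions. -/
def gaugeSubmodule : Submodule ℝ (P → E) where
  carrier := {f | MSmooth (totalAtlas n E P) (selfAtlas E) f ∧
    ∀ (p : P) (k : K), f (p <• k) = Ad K k⁻¹ (f p)}
  add_mem' {f g} hf hg := ⟨(smoothSubmodule E hP.isMfd).add_mem hf.1 hg.1, fun p k => by
    rw [Pi.add_apply, hf.2, hg.2, ← hK.Ad_add, Pi.add_apply]⟩
  zero_mem' := ⟨(smoothSubmodule E hP.isMfd).zero_mem, fun p k => by
    have := hK.Ad_smul k⁻¹ 0 (0 : E)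
    rw [zero_smul, zero_smul] at this
    exact this.symm⟩
  smul_mem' r f hf := ⟨(smoothSubmodule E hP.isMfd).smul_mem r hf.1, fun p k => by
    rw [Pi.smul_apply, hf.2, ← hK.Ad_smul, Pi.smul_apply]⟩

/-- The gauge algebra is a space of functions. -/
def gaugeEquiv : gaugeSubmodule hP hK ≃ gaugeAlgebra n E K P where
  toFun f := ⟨⟨f.1, f.2.1⟩, f.2.2⟩
  invFun η := ⟨η.1.1, η.1.2, η.2⟩
  left_inv _ := rfl
  right_inv _ := rfl

lemma mSmooth_pair_gauge (f g : gaugeSubmodule hP hK) :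
    MSmooth (totalAtlas n E P) ((selfAtlas E).prod (selfAtlas E)) fun p => (f.1 p, g.1 p) :=
  have hE := selfAtlas_isMfd E
  MSmoothOn.prodMk hP.isMfd hE hE isOpen_univ f.2.1 g.2.1

lemma isOpen_univ_prod_selfAtlas : IsOpen[((selfAtlas E).prod (selfAtlas E)).top] univ :=
  let := ((selfAtlas E).prod (selfAtlas E)).top
  isOpen_univ

/-- Equivariance of the pointwise bracket is the fact that Ad acts by Lie algebra automorphisms. -/
lemma lieBr_mem_gaugeSubmodule (f g : gaugeSubmodule hP hK) :
    (fun p => lieBr K (f.1 p) (g.1 p)) ∈ gaugeSubmodule hP hK := by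
  have hE := selfAtlas_isMfd E
  have h := MSmoothOn.comp hP.isMfd (hE.prod hE) hE isOpen_univ isOpen_univ_prod_selfAtlas
    hK.mSmooth_lieBr (mSmooth_pair_gauge hP hK f g) fun _ _ => trivial
  exact ⟨h, fun p k => by simp only [f.2.2, g.2.2, hK.Ad_lieBr]⟩

include hP hK in
-- The bracket of functions is their pair followed by the smooth bracket of E, so joint continuity
-- follows from the rules for pairs and composition.
lemma jetCont_lieBr (k : ℕ) [T2Space M] :
    JetCont.{u, u, u, u} k (totalAtlas n E P) (selfAtlas E) univ
      fun (q : gaugeAlgebra n E K P × gaugeAlgebra n E K P) p =>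
        lieBr K (q.1.1.1 p) (q.2.1.1 p) := by
  have hE := selfAtlas_isMfd E
  have h := JetCont.prodMk.{u, u, u, u, u, u, _} hP.isMfd hE hE (hP.t2Space hK) isOpen_univ
    (fun q : gaugeAlgebra n E K P × gaugeAlgebra n E K P => q.1.1.2) (fun q => q.2.1.2)
    (JetCont.comp_continuous.{u, u, u, u, _, _} (F := fun η : gaugeAlgebra n E K P => η.1.1)
      continuous_fst (jetCont_gaugeAlgebra k))
    (JetCont.comp_continuous.{u, u, u, u, _, _} (F := fun η : gaugeAlgebra n E K P => η.1.1)
      continuous_snd (jetCont_gaugeAlgebra k))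
  have hs : ∀ q : gaugeAlgebra n E K P × gaugeAlgebra n E K P, MSmoothOn (totalAtlas n E P)
      ((selfAtlas E).prod (selfAtlas E)) (fun p => (q.1.1.1 p, q.2.1.1 p)) univ := fun q =>
    MSmoothOn.prodMk hP.isMfd hE hE isOpen_univ q.1.1.2 q.2.1.2
  have h' := JetCont.postcomp.{u, u, u, u, u, u, _} hP.isMfd (hE.prod hE) hE isOpen_univ
    isOpen_univ_prod_selfAtlas hK.mSmooth_lieBr hs (fun _ _ _ => trivial) h
  exact h'.congr hP.isMfd isOpen_univ fun _ _ _ => rfl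

/-- Points are compact, so evaluations are continuous already for the order zero topology, and they
separate functions. -/
lemma gaugeAlgebra_t2Space : T2Space (gaugeAlgebra n E K P) := by
  refine T2Space.of_injective_continuous (f := fun (η : gaugeAlgebra n E K P) (p : P) => η.1.1 p)
    (fun η η' h => Subtype.ext (Subtype.ext h)) (continuous_pi fun p => ?_)
  refine continuous_def.2 fun W hW => ?_
  have := jetCont_gaugeAlgebra (n := n) (E := E) (K := K) (P := P) 0 {p} (subset_univ _)
    isCompact_singleton W hW
  simp only [mapsTo_singleton] at this
  exact this

include hP hK in
lemma exists_lieAlgebra_gaugeAlgebra [T2Space M] : ∃ (_ : LieRing (gaugeAlgebra n E K P))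
    (_ : LieAlgebra ℝ (gaugeAlgebra n E K P)),
    (PointwiseLie (lieBr K) fun (η : gaugeAlgebra n E K P) (p : P) => η.1.1 p) ∧
    IsLCLieAlgebra (gaugeAlgebra n E K P) := by
  obtain ⟨β, hβ⟩ := hK.exists_lieBr_bilinear
  have hE := selfAtlas_isMfd E
  set e := gaugeEquiv (n := n) hP hK
  let : AddCommGroup (gaugeAlgebra n E K P) := e.symm.addCommGroup
  let : Module ℝ (gaugeAlgebra n E K P) := e.symm.module ℝ
  have ext : ∀ {a b : gaugeAlgebra n E K P}, (∀ p, a.1.1 p = b.1.1 p) → a = b := fun h =>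
    Subtype.ext (Subtype.ext (funext h))
  let : LieRing (gaugeAlgebra n E K P) :=
    { bracket := fun a b => e ⟨_, lieBr_mem_gaugeSubmodule hP hK (e.symm a) (e.symm b)⟩
      add_lie := fun f g h => ext fun p => by
        change lieBr K (f.1.1 p + g.1.1 p) (h.1.1 p) =
          lieBr K (f.1.1 p) (h.1.1 p) + lieBr K (g.1.1 p) (h.1.1 p)
        simp only [← hβ, map_add, LinearMap.add_apply]
      lie_add := fun f g h => ext fun p => by
        change lieBr K (f.1.1 p) (g.1.1 p + h.1.1 p) =
          lieBr K (f.1.1 p) (g.1.1 p) + lieBr K (f.1.1 p) (h.1.1 p)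
        simp only [← hβ, map_add]
      lie_self := fun f => ext fun p => hK.lieBr_self _
      leibniz_lie := fun f g h => ext fun p => hK.lieBr_jacobi _ _ _ }
  let : LieAlgebra ℝ (gaugeAlgebra n E K P) :=
    { lie_smul := fun r f g => ext fun p => by
        change lieBr K (f.1.1 p) (r • g.1.1 p) = r • lieBr K (f.1.1 p) (g.1.1 p)
        simp only [← hβ, map_smul] }
  refine ⟨inferInstance, inferInstance, ⟨fun _ _ _ => rfl, fun _ _ _ => rfl, fun _ _ _ => rfl⟩,
    .of_isLCTop ?_ gaugeAlgebra_t2Space ?_⟩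
  · let ψ : gaugeAlgebra n E K P →ₗ[ℝ] smoothSubmodule E hP.isMfd :=
      { toFun := fun η => ⟨η.1.1, η.1.2⟩
        map_add' := fun _ _ => rfl
        map_smul' := fun _ _ => rfl }
    have h := (induced_smooth_isLCTop.{u, u, u} (Y := E) hP.isMfd).induced ψ
    -- The topology is defined by two nested inclusions; both descriptions are the topology induced
    -- by η ↦ η as a map P → E.
    have h' : instTopologicalSpaceSubtype = TopologicalSpace.induced ψ
        (TopologicalSpace.induced Subtype.val (⨅ k : ℕ, jetTop.{u, u, u, u} k (totalAtlas n E P)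
          (selfAtlas E))) := by
      rw [induced_compose]
      exact induced_compose
    rw [h']
    exact h
  · refine Continuous.subtype_mk (continuous_smoothMap_iff.{u, u, u, u}.2 fun k => ?_) _
    exact jetCont_lieBr hP hK k

end Gauge

end LCGeom

/-! ### Assembly of the four Lie algebras and the isomorphisms -/

theorem mainTheorem9 {n : ℕ}
    {E : Type u} [AddCommGroup E] [Module ℝ E] [TopologicalSpace E] [IsTopologicalAddGroup E]
    [ContinuousSMul ℝ E] [LocallyConvexSpace ℝ E] [T2Space E]
    {K : Type u} [Group K] [TopologicalSpace K] [ChartedSpace E K] (hK : IsLCLieGroup E K)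
    {M : Type u} [TopologicalSpace M] [T2Space M] [ChartedSpace (EuclideanQuadrant n) M]
    (hM : SmoothAtlas (cornerAtlas n M))
    {P : Type u} [TopologicalSpace P] [ChartedSpace (EuclideanQuadrant n × E) P]
    [MulAction Kᵐᵒᵖ P] {π : P → M} (hP : IsSmoothPrincipalBundle n E K π)
    {I : Type w} (𝒱 : ClosedTrivSystem n E π I) :
    ∃ (_ : LieRing (gaugeAlgebra n E K P)) (_ : LieAlgebra ℝ (gaugeAlgebra n E K P))
      (_ : LieRing (adSections n E K π)) (_ : LieAlgebra ℝ (adSections n E K π))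
      (_ : LieRing (openFamilies K 𝒱)) (_ : LieAlgebra ℝ (openFamilies K 𝒱))
      (_ : LieRing (closedFamilies K 𝒱)) (_ : LieAlgebra ℝ (closedFamilies K 𝒱)),
      -- the Lie algebra structures are the natural ones
      (PointwiseLie (lieBr K) fun (η : gaugeAlgebra n E K P) (p : P) => η.1.1 p) ∧
      (FibrewiseLie (AdBundle.mk K) π (lieBr K) fun (ξ : adSections n E K π) (m : M) => ξ.1.1 m) ∧
      (PointwiseLie (lieBr K)
        fun (η : openFamilies K 𝒱) (q : Σ i, 𝒱.V i) => (η.1 q.1).1 q.2) ∧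
      (PointwiseLie (lieBr K)
        fun (η : closedFamilies K 𝒱) (q : Σ i, closure (𝒱.V i)) => (η.1 q.1).1 q.2) ∧
      -- they are locally convex Lie algebras
      IsLCLieAlgebra (gaugeAlgebra n E K P) ∧
      IsLCLieAlgebra (adSections n E K π) ∧
      IsLCLieAlgebra (openFamilies K 𝒱) ∧
      IsLCLieAlgebra (closedFamilies K 𝒱) ∧
      -- the natural maps are isomorphisms of topological Lie algebras
      (∃ Φ : gaugeAlgebra n E K P ≃ₗ⁅ℝ⁆ adSections n E K π, IsHomeomorph Φ ∧
        ∀ η p, (Φ η).1.1 (π p) = AdBundle.mk K p (η.1.1 p)) ∧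
      (∃ Φ : gaugeAlgebra n E K P ≃ₗ⁅ℝ⁆ openFamilies K 𝒱, IsHomeomorph Φ ∧
        ∀ η i (m : 𝒱.V i), ((Φ η).1 i).1 m = η.1.1 (𝒱.σ i ⟨m, subset_closure m.2⟩)) ∧
      (∃ Φ : gaugeAlgebra n E K P ≃ₗ⁅ℝ⁆ closedFamilies K 𝒱, IsHomeomorph Φ ∧
        ∀ η i m, ((Φ η).1 i).1 m = η.1.1 (𝒱.σ i m)) := by
  have : LCS E := {}
  obtain ⟨g1, g2, hpt, hlc⟩ := exists_lieAlgebra_gaugeAlgebra hP hK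
  obtain ⟨h1, hh1⟩ := exists_gauge_adSections_homeomorph hP hK hM
  obtain ⟨h2, hh2⟩ := 𝒱.exists_gauge_openFamilies_homeomorph hP hK hM
  obtain ⟨h3, hh3⟩ := 𝒱.exists_gauge_closedFamilies_homeomorph hP hK hM
  obtain ⟨a1, a2, ha, Φ₁, hΦ₁, e1⟩ := hlc.exists_transport h1
  obtain ⟨o1, o2, ho, Φ₂, hΦ₂, e2⟩ := hlc.exists_transport h2
  obtain ⟨c1, c2, hc, Φ₃, hΦ₃, e3⟩ := hlc.exists_transport h3
  have f1 : ∀ η p, (Φ₁ η).1.1 (π p) = AdBundle.mk K p (η.1.1 p) := fun η p => by rw [e1, hh1]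
  have f2 : ∀ η i (m : 𝒱.V i), ((Φ₂ η).1 i).1 m = η.1.1 (𝒱.σ i ⟨m, subset_closure m.2⟩) :=
    fun η i m => by rw [e2, hh2]
  have f3 : ∀ η i m, ((Φ₃ η).1 i).1 m = η.1.1 (𝒱.σ i m) := fun η i m => by rw [e3, hh3]
  -- The coordinate with respect to p recovers x from [p, x], which makes the fibrewise operations
  -- on Ad(P) well defined.
  have hmk : ∀ (p : P) (x y : E), AdBundle.mk K p x = AdBundle.mk K p y → x = y := fun p x y h => by
    rw [← hP.adCoord_mk hK p x, h, hP.adCoord_mk hK]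
  exact ⟨g1, g2, a1, a2, o1, o2, c1, c2, hpt, hpt.fibrewiseLie Φ₁ hmk f1,
    hpt.transport Φ₂ (fun q => 𝒱.σ q.1 ⟨q.2, subset_closure q.2.2⟩) fun η q => f2 η q.1 q.2,
    hpt.transport Φ₃ (fun q => 𝒱.σ q.1 q.2) fun η q => f3 η q.1 q.2,
    hlc, ha, ho, hc, ⟨Φ₁, hΦ₁, f1⟩, ⟨Φ₂, hΦ₂, f2⟩, ⟨Φ₃, hΦ₃, f3⟩⟩
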